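/- Let $n\ge 2$ and let $M$ be a smooth $n$-manifold with a $GL(2,\mathbb R)$ structure, i.e. a smooth field of rational normal curves of degree $n-1$ in $\mathbb P T^*M$: near every point there is a smooth coframe $\omega_0,\dots,\omega_{n-1}$ (an *adapted coframe*) such that the curve at $x$ is $\{[\omega(\lambda)_x] : \lambda\in\mathbb R\cup\{\infty\}\}$, where $\omega(\lambda)=\omega_0+\lambda\omega_1+\dots+\lambda^{n-1}\omega_{n-1}$ and $\omega(\infty)=\omega_{n-1}$. The kernels of the covectors on these curves are the $\alpha$-hyperplanes; an $\alpha$-manifold is a smooth embedded hypersurface (not necessarily closed) all of whose tangent spaces are $\alpha$-hyperplanes. Assume that the structure is involutive: every $\alpha$-hyperplane is the tangent space of some $\alpha$-manifold. Then the local $\alpha$-manifolds are parametrized by one function of one variable, in the following sense. Let $x\in M$ and let $H\subset T_xM$ be an $\alpha$-hyperplane. There are an adapted coframe on an open set $U\ni x$ with $H=\ker\omega(0)_x$, an open neighbourhood $W\subset U\times\mathbb R$ of $(x,0)$, and a smooth submersion $\rho:W\to J^1(\mathbb R,\mathbb R)=\mathbb R^3(t,z,p)$ such that, for $(y,\lambda)\in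 W$, the form $\rho^*(dz-p\,dt)$ at $(y,\lambda)$ is a nonzero multiple of $\omega(\lambda)_y$ (pulled back to $W$), $\rho(x,0)=0$, $dt(d\rho_{(x,0)}(\partial_\lambda))=0$, and, with $\pi:W\to M$ the projection: 1. For every $c=(y,\lambda)\in W$, the assignment $\gamma\mapsto\pi(\rho^{-1}(\gamma))$ is a bijection from the germs at $\rho(c)$ of (unparametrized, immersed, smooth) Legendrian curves $\gamma$ in $J^1$ that are not tangent to $d\rho_c(\partial_\lambda)$, onto the germs at $y$ of $\alpha$-manifolds with tangent space $\ker\omega(\lambda)_y$ at $y$ (here $\rho^{-1}(\gamma)$ stands for its germ at $c$). 2. The assignment taking $f$ to the germ at $x$ of $\{y : \exists\lambda,\ (y,\lambda)\text{ near }(x,0),\ \rho(y,\lambda)=(s,f(s),f'(s))\text{ for some }s\text{ near }0\}$ is a bijection from the germs at $0$ of smooth functions $f$ of one variable with $f(0)=f'(0)=0$ onto the germs at $x$ of $\alpha$-manifolds with tangent space $H$ at $x$. -/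

import Mathlib

open scoped Manifold ContDiff Topology Bundle

noncomputable section

namespace GL2

/-- The model space `ℝⁿ`. -/
abbrev Model (n : ℕ) : Type := EuclideanSpace ℝ (Fin n)

/-- The cotangent space of the `n`-manifold `M` at `x`. -/
abbrev Cotangent (n : ℕ) {M : Type*} [TopologicalSpace M] [ChartedSpace (Model n) M] (x : M) :
    Type :=
  TangentSpace (𝓡 n) x →L[ℝ] Bundle.Trivial M ℝ x

section Structures

variable {n : ℕ} {M : Type*} [TopologicalSpace M] [ChartedSpace (Model n) M]

/-- The `1`-form `θ(λ) = θ₀ + λ θ₁ + ⋯ + λⁿ⁻¹ θₙ₋₁`. -/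
def form (θ : Fin n → (x : M) → Cotangent n x) (l : ℝ) (x : M) : Cotangent n x :=
  ∑ i : Fin n, l ^ (i : ℕ) • θ i x

/-- Its homogeneous version `θ(a : b) = ∑ aⁿ⁻¹⁻ⁱ bⁱ θᵢ`; the value at `(1 : l)` is `θ(l)`, and
`(0 : 1)` is the parameter `λ = ∞`. -/
def homForm (θ : Fin n → (x : M) → Cotangent n x) (a b : ℝ) (x : M) : Cotangent n x :=
  ∑ i : Fin n, (a ^ (n - 1 - (i : ℕ)) * b ^ (i : ℕ)) • θ i x

variable [IsManifold (𝓡 n) ∞ M]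

/-- `θ₀, …, θₙ₋₁` is a smooth coframe on the open set `U`, and over `U` the given cones of covectors
are the (punctured) cones over the rational normal curves `(a : b) ↦ [θ(a : b)]`. -/
structure IsAdaptedCoframe (cone : (x : M) → Set (Cotangent n x)) (U : Set M)
    (θ : Fin n → (x : M) → Cotangent n x) : Prop where
  isOpen : IsOpen U
  smooth : ∀ i, ContMDiffOn (𝓡 n) ((𝓡 n).prod 𝓘(ℝ, Model n →L[ℝ] ℝ)) ∞
    (fun x => Bundle.TotalSpace.mk' (Model n →L[ℝ] ℝ)
      (E := fun x : M => TangentSpace (𝓡 n) x →L[ℝ] Bundle.Trivial M ℝ x) x (θ i x)) U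
  linearIndependent : ∀ x ∈ U, LinearIndependent ℝ (fun i => θ i x)
  cone_eq : ∀ x ∈ U, cone x =
    {ξ | ∃ r a b : ℝ, r ≠ 0 ∧ (a, b) ≠ (0, 0) ∧ ξ = r • homForm θ a b x}

end Structures

/-- A `GL(2, ℝ)` structure on an `n`-manifold: a smooth field of rational normal curves of degree
`n - 1` in the projectivised cotangent bundle. The curve at `x` is recorded by the set `cone x` of
the nonzero covectors that represent its points. -/
structure GL2Structure (n : ℕ) (M : Type*) [TopologicalSpace M] [ChartedSpace (Model n) M]
    [IsManifold (𝓡 n) ∞ M] where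
  cone : (x : M) → Set (Cotangent n x)
  exists_coframe : ∀ x : M, ∃ U θ, x ∈ U ∧ IsAdaptedCoframe cone U θ

section Hypersurfaces

variable {n : ℕ} {M : Type*} [TopologicalSpace M] [ChartedSpace (Model n) M]

/-- On the open set `U`, `N` is the zero set of the smooth function `g`, and `dg ≠ 0` on `N`. -/
structure IsLocalEquation (n : ℕ) {M : Type*} [TopologicalSpace M] [ChartedSpace (Model n) M]
    (N U : Set M) (g : M → ℝ) : Prop where
  isOpen : IsOpen U
  smooth : ContMDiffOn (𝓡 n) 𝓘(ℝ, ℝ) ∞ g U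
  mem_iff : ∀ y ∈ U, y ∈ N ↔ g y = 0
  mfderiv_ne_zero : ∀ y ∈ U, y ∈ N → mfderiv (𝓡 n) 𝓘(ℝ, ℝ) g y ≠ 0

/-- `N` is a smooth embedded submanifold of codimension one (not necessarily closed in `M`). -/
def IsHypersurface (n : ℕ) {M : Type*} [TopologicalSpace M] [ChartedSpace (Model n) M]
    (N : Set M) : Prop :=
  ∀ x ∈ N, ∃ U g, x ∈ U ∧ IsLocalEquation n N U g

/-- Near its point `x` the set `N` is a hypersurface, and its tangent space at `x` is `H`. -/
def HasTangentSpace (N : Set M) (x : M) (H : Submodule ℝ (TangentSpace (𝓡 n) x)) : Prop :=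
  x ∈ N ∧ ∃ U g, x ∈ U ∧ IsLocalEquation n N U g ∧
    H = LinearMap.ker (mfderiv (𝓡 n) 𝓘(ℝ, ℝ) g x).toLinearMap

end Hypersurfaces

namespace GL2Structure

variable {n : ℕ} {M : Type*} [TopologicalSpace M] [ChartedSpace (Model n) M]
  [IsManifold (𝓡 n) ∞ M]

/-- The `α`-hyperplanes in `T_x M`. -/
def IsAlphaHyperplane (G : GL2Structure n M) (x : M)
    (H : Submodule ℝ (TangentSpace (𝓡 n) x)) : Prop :=
  ∃ ξ ∈ G.cone x, H = LinearMap.ker ξ.toLinearMap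

/-- The `α`-manifolds: hypersurfaces all of whose tangent spaces are `α`-hyperplanes. -/
def IsAlphaManifold (G : GL2Structure n M) (N : Set M) : Prop :=
  IsHypersurface n N ∧ ∀ x H, HasTangentSpace N x H → G.IsAlphaHyperplane x H

/-- Every `α`-hyperplane is tangent to some `α`-manifold. -/
def Involutive (G : GL2Structure n M) : Prop :=
  ∀ x H, G.IsAlphaHyperplane x H → ∃ N, G.IsAlphaManifold N ∧ HasTangentSpace N x H

end GL2Structure

/-- The space `J¹(ℝ, ℝ)` of `1`-jets, with coordinates `(t, z, p)`. -/
abbrev J1 : Type := ℝ × ℝ × ℝ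

/-- The standard contact form `dz - p dt` at the point `s` of `J¹`, on the tangent vector `v`. -/
def contactForm (s v : J1) : ℝ := v.2.1 - s.2.2 * v.1

/-- Near the parameter `s₀`, `γ` is a smooth immersed Legendrian curve in `J¹`. -/
def IsLegendrianAt (γ : ℝ → J1) (s₀ : ℝ) : Prop :=
  ∃ I : Set ℝ, IsOpen I ∧ s₀ ∈ I ∧ ContDiffOn ℝ ∞ γ I ∧
    ∀ s ∈ I, deriv γ s ≠ 0 ∧ contactForm (γ s) (deriv γ s) = 0

/-- The `1`-jet prolongation `t ↦ (t, f(t), f'(t))` of a function of one variable. -/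
def jet (f : ℝ → ℝ) (t : ℝ) : J1 := (t, f t, deriv f t)

/-- `γ₁` and `γ₂` trace out, near the parameter `0`, the same germ of an unparametrised curve. -/
def SameCurveGerm (γ₁ γ₂ : ℝ → J1) : Prop :=
  (∀ I ∈ 𝓝 (0 : ℝ), ∃ J ∈ 𝓝 (0 : ℝ), γ₁ '' J ⊆ γ₂ '' I) ∧
    ∀ I ∈ 𝓝 (0 : ℝ), ∃ J ∈ 𝓝 (0 : ℝ), γ₂ '' J ⊆ γ₁ '' I

section Reduction

variable {n : ℕ} {M : Type*} [TopologicalSpace M] [ChartedSpace (Model n) M]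

/-- The differential of a map `ρ` from the correspondence space `M × ℝ`, with coordinates
`(x, λ)`, to `J¹`, applied to the tangent vector `v + τ ∂_λ`. -/
def diff (ρ : M × ℝ → J1) (c : M × ℝ) (v : TangentSpace (𝓡 n) c.1) (τ : ℝ) : J1 :=
  mfderiv ((𝓡 n).prod 𝓘(ℝ, ℝ)) 𝓘(ℝ, J1) ρ c (v, τ)

/-- `ρ` is a smooth submersion of the open set `W` of the correspondence space onto an open set of
`J¹`, and it pulls the contact distribution of `J¹` back to the distribution `θ(λ) = 0` on `W`.
(The fibres of `ρ` are then integral manifolds of the Cauchy characteristics of that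
distribution.) -/
structure IsContactReduction (θ : Fin n → (x : M) → Cotangent n x) (W : Set (M × ℝ))
    (ρ : M × ℝ → J1) : Prop where
  isOpen : IsOpen W
  smooth : ContMDiffOn ((𝓡 n).prod 𝓘(ℝ, ℝ)) 𝓘(ℝ, J1) ∞ ρ W
  submersion : ∀ c ∈ W, ∀ y : J1, ∃ (v : TangentSpace (𝓡 n) c.1) (τ : ℝ), diff ρ c v τ = y
  contact : ∀ c ∈ W, ∃ r : ℝ, r ≠ 0 ∧ ∀ (v : TangentSpace (𝓡 n) c.1) (τ : ℝ),
    contactForm (ρ c) (diff ρ c v τ) = r * (form θ c.2 c.1 v : ℝ)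

/-- The projection to `M` of the part in `V` of the preimage under `ρ` of the curve `γ(I)`. -/
def lift (ρ : M × ℝ → J1) (V : Set (M × ℝ)) (γ : ℝ → J1) (I : Set ℝ) : Set M :=
  {y | ∃ l : ℝ, (y, l) ∈ V ∧ ρ (y, l) ∈ γ '' I}

/-- `N` coincides near `c.1` with the projection to `M` of the germ at `c` of the preimage under
`ρ` of the germ of the curve `γ` at `s₀`. -/
def IsLiftAt (ρ : M × ℝ → J1) (c : M × ℝ) (γ : ℝ → J1) (s₀ : ℝ) (N : Set M) : Prop :=
  ∃ V₀ ∈ 𝓝 c, ∃ I₀ ∈ 𝓝 s₀, ∀ V ∈ 𝓝 c, V ⊆ V₀ → ∀ I ∈ 𝓝 s₀, I ⊆ I₀ →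
    ∀ᶠ y in 𝓝 c.1, y ∈ N ↔ y ∈ lift ρ V γ I

/-- `γ` is near the parameter `0` a Legendrian curve in `J¹` that passes through `ρ(c)` and is not
tangent there to the image under `ρ` of the fibre of `M × ℝ → M` through `c`. -/
def IsTransverseLegendrian (n : ℕ) {M : Type*} [TopologicalSpace M] [ChartedSpace (Model n) M]
    (ρ : M × ℝ → J1) (c : M × ℝ) (γ : ℝ → J1) : Prop :=
  IsLegendrianAt γ 0 ∧ γ 0 = ρ c ∧ LinearIndependent ℝ ![deriv γ 0, diff (n := n) ρ c 0 1]

variable [IsManifold (𝓡 n) ∞ M]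

/-- Germs at `c.1` of `α`-manifolds tangent there to the hyperplane `θ(c.2) = 0` correspond
one-to-one to germs of unparametrised Legendrian curves through `ρ(c)` that are not tangent to the
image of the fibre of `M × ℝ → M`: the correspondence takes a curve to the projection of its
preimage under `ρ`. -/
structure LegendrianCorrespondence (G : GL2Structure n M) (θ : Fin n → (x : M) → Cotangent n x)
    (ρ : M × ℝ → J1) (c : M × ℝ) : Prop where
  exists_alphaManifold : ∀ γ, IsTransverseLegendrian n ρ c γ → ∃ N, G.IsAlphaManifold N ∧
    HasTangentSpace N c.1 (LinearMap.ker (form θ c.2 c.1).toLinearMap) ∧ IsLiftAt ρ c γ 0 N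
  exists_curve : ∀ N, G.IsAlphaManifold N →
    HasTangentSpace N c.1 (LinearMap.ker (form θ c.2 c.1).toLinearMap) →
    ∃ γ, IsTransverseLegendrian n ρ c γ ∧ IsLiftAt ρ c γ 0 N
  unique : ∀ γ₁ γ₂ N₁ N₂, IsTransverseLegendrian n ρ c γ₁ → IsTransverseLegendrian n ρ c γ₂ →
    IsLiftAt ρ c γ₁ 0 N₁ → IsLiftAt ρ c γ₂ 0 N₂ →
    ((∀ᶠ y in 𝓝 c.1, y ∈ N₁ ↔ y ∈ N₂) ↔ SameCurveGerm γ₁ γ₂)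

/-- `f` is smooth near `0` with `f(0) = f'(0) = 0`. -/
def IsParameterFunction (f : ℝ → ℝ) : Prop :=
  (∃ I ∈ 𝓝 (0 : ℝ), ContDiffOn ℝ ∞ f I) ∧ f 0 = 0 ∧ deriv f 0 = 0

/-- The germs at `x` of `α`-manifolds with tangent space `H` at `x` correspond one-to-one to the
germs at `0` of smooth functions `f` of one variable with `f(0) = f'(0) = 0`: the correspondence
takes `f` to the projection to `M` of the preimage under `ρ` of the curve `(t, f(t), f'(t))`. -/
structure FunctionParametrization (G : GL2Structure n M) (ρ : M × ℝ → J1) (x : M)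
    (H : Submodule ℝ (TangentSpace (𝓡 n) x)) : Prop where
  exists_alphaManifold : ∀ f, IsParameterFunction f → ∃ N, G.IsAlphaManifold N ∧
    HasTangentSpace N x H ∧ IsLiftAt ρ (x, 0) (jet f) 0 N
  exists_function : ∀ N, G.IsAlphaManifold N → HasTangentSpace N x H →
    ∃ f, IsParameterFunction f ∧ IsLiftAt ρ (x, 0) (jet f) 0 N
  unique : ∀ f₁ f₂ N₁ N₂, IsParameterFunction f₁ → IsParameterFunction f₂ →
    IsLiftAt ρ (x, 0) (jet f₁) 0 N₁ → IsLiftAt ρ (x, 0) (jet f₂) 0 N₂ →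
    ((∀ᶠ y in 𝓝 x, y ∈ N₁ ↔ y ∈ N₂) ↔ f₁ =ᶠ[𝓝 0] f₂)

end Reduction

end GL2

end

/-! On the correspondence space `M × ℝ`, of dimension n + 1, consider the one-form Θ = ω(λ). An
α-manifold whose tangent space at y is ker ω(λ(y)) lifts to the submanifold of points (y, λ(y)). The
lift has dimension n - 1, and Θ and dΘ vanish on it. Involutivity thus gives, at every point near
(x, 0), a hyperplane of ker Θ that is isotropic for dΘ, so dΘ has rank at most two on ker Θ
(`IsAlphaEquation.exists_symmetric`). The rank is two, because dΘ(∂_λ, ·) = ω'(λ) is not a multiple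
of ω(λ). Hence the Cauchy characteristics of Θ have rank n - 2, and their local leaf space is a
contact manifold of dimension three. Darboux's theorem turns the projection to the leaf space into ρ
(`exists_contact_map_of_symmetric`).

The preimage under ρ of a Legendrian curve has dimension n - 1 and is tangent to Θ = 0. If the curve
is not tangent to ρ_*∂_λ, the preimage is transverse to the fibres of π, and it projects to a
hypersurface with tangent spaces ker ω(λ) (`exists_equation_of_legendrian`). Conversely, ρ maps the
lift of an α-manifold tangentially to the contact distribution. Its rank on the lift is at most one,
as dz = p dt forces dp ∧ dt = 0, and it is not zero, as ker dρ has dimension n - 2 only; the image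
is a Legendrian curve (`exists_legendrian_of_equation`). At (x, 0) the vector ρ_*∂_λ is parallel to
∂_p, so the admissible curves there are the 1-jets of functions.

The passage to the leaf space is `exists_slice_map`. Instead of integrating the distribution by
Frobenius, each point flows along it to a transverse slice (`exists_retraction`), and a Gronwall
estimate shows that ker Θ is preserved. Smooth dependence of the flow on the point comes from the
implicit function theorem in C([0, 1], Z) (`exists_flow`). The same slice map, applied to a line
field, proves Darboux's theorem (`exists_darboux_chart`). -/

open Filter

set_option linter.unusedSectionVars false

namespace GL2

/-! ### Smoothness near a point; inverse and implicit functions -/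

section SmoothNear

variable {E F G : Type*} [NormedAddCommGroup E] [NormedSpace ℝ E] [NormedAddCommGroup F]
  [NormedSpace ℝ F] [NormedAddCommGroup G] [NormedSpace ℝ G]

/-- `f` is smooth on a neighbourhood of `z`. -/
def SmoothNear (f : E → F) (z : E) : Prop := ∀ᶠ y in 𝓝 z, ContDiffAt ℝ ∞ f y

theorem SmoothNear.contDiffAt {f : E → F} {z : E} (h : SmoothNear f z) : ContDiffAt ℝ ∞ f z :=
  h.self_of_nhds

theorem SmoothNear.continuousAt {f : E → F} {z : E} (h : SmoothNear f z) : ContinuousAt f z :=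
  h.contDiffAt.continuousAt

theorem SmoothNear.differentiableAt {f : E → F} {z : E} (h : SmoothNear f z) :
    DifferentiableAt ℝ f z :=
  h.contDiffAt.differentiableAt (by simp)

/-- The reason for the definition: `ContDiffAt ℝ ∞` at a single point only gives a neighbourhood for
each finite order, and these may shrink to the point. -/
theorem SmoothNear.eventually_nhds {f : E → F} {z : E} (h : SmoothNear f z) :
    ∀ᶠ y in 𝓝 z, SmoothNear f y :=
  eventually_eventually_nhds.2 h

theorem smoothNear_of_contDiff {f : E → F} (h : ContDiff ℝ ∞ f) (z : E) : SmoothNear f z :=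
  Eventually.of_forall fun _ => h.contDiffAt

theorem SmoothNear.congr {f g : E → F} {z : E} (h : SmoothNear f z) (hfg : f =ᶠ[𝓝 z] g) :
    SmoothNear g z := by
  filter_upwards [h, hfg.eventuallyEq_nhds] with y hy hfy
  exact hy.congr_of_eventuallyEq hfy.symm

theorem SmoothNear.comp {g : F → G} {f : E → F} {z : E} (hg : SmoothNear g (f z))
    (hf : SmoothNear f z) : SmoothNear (fun y => g (f y)) z := by
  filter_upwards [hf, hf.continuousAt.eventually hg] with y h1 h2
  exact h2.comp y h1

theorem SmoothNear.comp_of_eq {g : F → G} {f : E → F} {z : E} {w : F} (hg : SmoothNear g w)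
    (hf : SmoothNear f z) (h : f z = w) : SmoothNear (fun y => g (f y)) z := by
  subst h; exact hg.comp hf

theorem SmoothNear.fderiv_right {f : E → F} {z : E} (h : SmoothNear f z) :
    SmoothNear (fderiv ℝ f) z := by
  filter_upwards [h] with y hy
  exact hy.fderiv_right (by simp)

theorem SmoothNear.add {f g : E → F} {z : E} (hf : SmoothNear f z) (hg : SmoothNear g z) :
    SmoothNear (fun y => f y + g y) z := by
  filter_upwards [hf, hg] with y h1 h2 using h1.add h2

theorem SmoothNear.sub {f g : E → F} {z : E} (hf : SmoothNear f z) (hg : SmoothNear g z) :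
    SmoothNear (fun y => f y - g y) z := by
  filter_upwards [hf, hg] with y h1 h2 using h1.sub h2

theorem SmoothNear.smul {f : E → ℝ} {g : E → F} {z : E} (hf : SmoothNear f z)
    (hg : SmoothNear g z) : SmoothNear (fun y => f y • g y) z := by
  filter_upwards [hf, hg] with y h1 h2 using h1.smul h2

theorem SmoothNear.mul {f g : E → ℝ} {z : E} (hf : SmoothNear f z)
    (hg : SmoothNear g z) : SmoothNear (fun y => f y * g y) z := by
  filter_upwards [hf, hg] with y h1 h2 using h1.mul h2

theorem SmoothNear.div {f g : E → ℝ} {z : E} (hf : SmoothNear f z)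
    (hg : SmoothNear g z) (h0 : g z ≠ 0) : SmoothNear (fun y => f y / g y) z := by
  filter_upwards [hf, hg, hg.continuousAt.eventually_ne h0] with y h1 h2 h3 using h1.div h2 h3

theorem SmoothNear.prodMk {f : E → F} {g : E → G} {z : E} (hf : SmoothNear f z)
    (hg : SmoothNear g z) : SmoothNear (fun y => (f y, g y)) z := by
  filter_upwards [hf, hg] with y h1 h2 using h1.prodMk h2

theorem SmoothNear.clm_apply {f : E → F →L[ℝ] G} {g : E → F} {z : E} (hf : SmoothNear f z)
    (hg : SmoothNear g z) : SmoothNear (fun y => f y (g y)) z := by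
  filter_upwards [hf, hg] with y h1 h2 using h1.clm_apply h2

theorem SmoothNear.clm_comp {H : Type*} [NormedAddCommGroup H] [NormedSpace ℝ H]
    {f : E → G →L[ℝ] H} {g : E → F →L[ℝ] G} {z : E} (hf : SmoothNear f z)
    (hg : SmoothNear g z) : SmoothNear (fun y => (f y).comp (g y)) z := by
  filter_upwards [hf, hg] with y h1 h2 using h1.clm_comp h2

theorem SmoothNear.sum {ι : Type*} {s : Finset ι} {f : ι → E → F} {z : E}
    (hf : ∀ i ∈ s, SmoothNear (f i) z) : SmoothNear (fun y => ∑ i ∈ s, f i y) z := by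
  filter_upwards [(Finset.eventually_all s).2 hf] with y h1 using ContDiffAt.sum h1

theorem smoothNear_const (c : F) (z : E) : SmoothNear (fun _ => c) z :=
  smoothNear_of_contDiff contDiff_const z

/-- The inverse function theorem, for maps that are smooth near a point. -/
theorem SmoothNear.exists_inverse [CompleteSpace E] {f : E → F} {x : E} {f' : E ≃L[ℝ] F}
    (hf : SmoothNear f x) (hf' : HasFDerivAt f (f' : E →L[ℝ] F) x) :
    ∃ g : F → E, SmoothNear g (f x) ∧ g (f x) = x ∧ (∀ᶠ y in 𝓝 x, g (f y) = y) ∧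
      ∀ᶠ y in 𝓝 (f x), f (g y) = y := by
  have hn : (∞ : WithTop ℕ∞) ≠ 0 := by simp
  set e := hf.contDiffAt.toOpenPartialHomeomorph f hf' hn with he
  have hcoe : ∀ y, e y = f y := fun y => by
    rw [he, ContDiffAt.toOpenPartialHomeomorph_coe]
  have hx : x ∈ e.source := hf.contDiffAt.mem_toOpenPartialHomeomorph_source hf' hn
  have hfx : f x ∈ e.target := hcoe x ▸ e.map_source hx
  have hgx : e.symm (f x) = x := by rw [← hcoe, e.left_inv hx]
  refine ⟨e.symm, ?_, hgx, ?_, ?_⟩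
  · have hc : ContinuousAt e.symm (f x) := e.continuousAt_symm hfx
    -- Invertible operators form an open set, so the inverse is smooth at all points near `f x` and
    -- not only at `f x`.
    have hinv : ∀ᶠ y in 𝓝 x, ∃ A : E ≃L[ℝ] F, HasFDerivAt f (A : E →L[ℝ] F) y := by
      have h1 : Tendsto (fderiv ℝ f) (𝓝 x) (𝓝 (f' : E →L[ℝ] F)) := by
        have := hf.fderiv_right.continuousAt
        rwa [ContinuousAt, hf'.fderiv] at this
      filter_upwards [h1.eventually (ContinuousLinearEquiv.nhds f'), hf] with y ⟨A, hA⟩ hy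
      refine ⟨A, ?_⟩
      have := (hy.differentiableAt hn).hasFDerivAt
      rwa [← hA] at this
    have h2 : Tendsto e.symm (𝓝 (f x)) (𝓝 x) := by
      have := hc.tendsto; rwa [hgx] at this
    filter_upwards [h2.eventually hinv, h2.eventually hf, e.open_target.mem_nhds hfx]
      with y ⟨A, hA⟩ hy hyt
    have hfun : (e : E → F) = f := funext hcoe
    exact e.contDiffAt_symm hyt (f₀' := A) (hfun ▸ hA) (hfun ▸ hy)
  · filter_upwards [e.open_source.mem_nhds hx] with y hy
    rw [← hcoe, e.left_inv hy]
  · filter_upwards [e.open_target.mem_nhds hfx] with y hy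
    rw [← hcoe, e.right_inv hy]

/-- The implicit function theorem, for maps that are smooth near a point. -/
theorem SmoothNear.exists_implicit [CompleteSpace E] [CompleteSpace F] {Φ : E × F → G} {p : E}
    {q : F} (hΦ : SmoothNear Φ (p, q)) (h0 : Φ (p, q) = 0) (A : F ≃L[ℝ] G)
    (hA : ∀ v, fderiv ℝ Φ (p, q) (0, v) = A v) :
    ∃ ψ : E → F, SmoothNear ψ p ∧ ψ p = q ∧ (∀ᶠ y in 𝓝 p, Φ (y, ψ y) = 0) ∧
      ∀ᶠ y in 𝓝 (p, q), Φ y = 0 → y.2 = ψ y.1 := by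
  set B : E →L[ℝ] G := (fderiv ℝ Φ (p, q)).comp (ContinuousLinearMap.inl ℝ E F)
  -- The derivative of (u, v) ↦ (u, Φ(u, v)) is block triangular with diagonal blocks the identity
  -- and `A`.
  let T : (E × F) ≃L[ℝ] (E × G) := ContinuousLinearEquiv.equivOfInverse
    ((ContinuousLinearMap.fst ℝ E F).prod (fderiv ℝ Φ (p, q)))
    ((ContinuousLinearMap.fst ℝ E G).prod ((A.symm : G →L[ℝ] F).comp
      (ContinuousLinearMap.snd ℝ E G - B.comp (ContinuousLinearMap.fst ℝ E G))))
    (by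
      rintro ⟨u, v⟩
      have h : fderiv ℝ Φ (p, q) (u, v) = B u + A v := by
        rw [← hA, ContinuousLinearMap.comp_apply, ← map_add]; simp
      simp [h])
    (by
      rintro ⟨u, v⟩
      have h : ∀ w, fderiv ℝ Φ (p, q) (u, w) = B u + A w := fun w => by
        rw [← hA, ContinuousLinearMap.comp_apply, ← map_add]; simp
      simp [h])
  have hd : HasFDerivAt (fun y : E × F => (y.1, Φ y)) (T : E × F →L[ℝ] E × G) (p, q) :=
    hasFDerivAt_fst.prodMk hΦ.differentiableAt.hasFDerivAt
  obtain ⟨g, hg, hg0, hgl, hgr⟩ :=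
    SmoothNear.exists_inverse ((smoothNear_of_contDiff contDiff_fst _).prodMk hΦ) hd
  simp only [h0] at hg hg0 hgr
  have hι : ContDiff ℝ ∞ (fun y : E => (y, (0 : G))) := by fun_prop
  refine ⟨fun y => (g (y, 0)).2, ?_, by simp [hg0], ?_, ?_⟩
  · exact (smoothNear_of_contDiff (contDiff_snd (𝕜 := ℝ) (E := E) (F := F) (n := ∞)) _).comp
      (hg.comp (f := fun y : E => (y, (0 : G))) (smoothNear_of_contDiff hι p))
  · have hc : Tendsto (fun y : E => (y, (0 : G))) (𝓝 p) (𝓝 (p, 0)) := hι.continuous.tendsto p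
    filter_upwards [hc.eventually hgr] with y hy
    have h1 : (g (y, 0)).1 = y := congrArg Prod.fst hy
    have h2 : Φ (g (y, 0)) = 0 := congrArg Prod.snd hy
    have h3 : (y, (g (y, 0)).2) = g (y, 0) := Prod.ext h1.symm rfl
    rw [h3, h2]
  · filter_upwards [hgl] with y hy hy0
    rw [hy0] at hy
    rw [hy]

end SmoothNear

/-! ### Superposition operators on C(K, E) -/

section Superposition

/-- The superposition operator `f ↦ G ∘ f`. -/
def superposition (K : Type*) [TopologicalSpace K] {E F : Type*} [TopologicalSpace E]
    [TopologicalSpace F] {G : E → F} (hG : Continuous G) (f : C(K, E)) : C(K, F) :=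
  (⟨G, hG⟩ : C(E, F)).comp f

@[simp] theorem superposition_apply {K : Type*} [TopologicalSpace K] {E F : Type*}
    [TopologicalSpace E] [TopologicalSpace F] {G : E → F} (hG : Continuous G) (f : C(K, E))
    (s : K) : superposition K hG f s = G (f s) := rfl

theorem continuous_superposition {K : Type*} [TopologicalSpace K] {E F : Type*}
    [TopologicalSpace E] [TopologicalSpace F] {G : E → F} (hG : Continuous G) :
    Continuous (superposition K hG) :=
  ContinuousMap.continuous_postcomp _

universe u

variable {K : Type*} [TopologicalSpace K] [CompactSpace K]
  {A E F : Type u} [NormedAddCommGroup E] [NormedSpace ℝ E] [NormedAddCommGroup F]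
  [NormedSpace ℝ F] [NormedAddCommGroup A] [NormedSpace ℝ A]

/-- The continuous bilinear map `C(K, A) × C(K, E) → C(K, F)` induced by a continuous bilinear map
`A × E → F`. -/
noncomputable def pointwiseBilin (K : Type*) [TopologicalSpace K] [CompactSpace K]
    (b : A →L[ℝ] E →L[ℝ] F) : C(K, A) →L[ℝ] C(K, E) →L[ℝ] C(K, F) :=
  LinearMap.mkContinuous₂
    (LinearMap.mk₂ ℝ (fun (a : C(K, A)) (h : C(K, E)) =>
        (⟨fun s => b (a s) (h s), by fun_prop⟩ : C(K, F)))
      (fun a b h => by ext s; simp) (fun c a h => by ext s; simp)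
      (fun a h k => by ext s; simp) (fun c a h => by ext s; simp))
    ‖b‖ (fun a h => by
      rw [ContinuousMap.norm_le _ (by positivity)]
      intro s
      refine (b.le_opNorm₂ (a s) (h s)).trans ?_
      gcongr
      · exact a.norm_coe_le_norm s
      · exact h.norm_coe_le_norm s)

@[simp] theorem pointwiseBilin_apply (b : A →L[ℝ] E →L[ℝ] F) (a : C(K, A)) (h : C(K, E)) (s : K) :
    pointwiseBilin K b a h s = b (a s) (h s) := rfl

/-- At each `s` the mean value inequality bounds the remainder by the oscillation of G' near `f s`.
The bound is uniform in `s` because g ↦ G' ∘ g is continuous for the sup norm. -/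
theorem hasFDerivAt_superposition {G : E → F} (hc : Continuous G) (b : A →L[ℝ] E →L[ℝ] F)
    {G' : E → A} (hc' : Continuous G') (hG : ∀ v, HasFDerivAt G (b (G' v)) v) (f : C(K, E)) :
    HasFDerivAt (superposition K hc) (pointwiseBilin K b (superposition K hc' f)) f := by
  have hcb : Continuous fun v => b (G' v) := b.continuous.comp hc'
  rw [hasFDerivAt_iff_isLittleO_nhds_zero, Asymptotics.isLittleO_iff]
  intro ε hε
  have hpos : 0 < ‖b‖ + 1 := by positivity
  have hcont : ContinuousAt (superposition K hc') f := (continuous_superposition hc').continuousAt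
  have hev : ∀ᶠ g in 𝓝 f, dist (superposition K hc' g) (superposition K hc' f) < ε / (‖b‖ + 1) :=
    hcont (Metric.ball_mem_nhds _ (div_pos hε hpos))
  obtain ⟨δ, hδ, h⟩ := Metric.eventually_nhds_iff.1 hev
  filter_upwards [Metric.ball_mem_nhds (0 : C(K, E)) hδ] with k hk
  rw [ContinuousMap.norm_le _ (by positivity)]
  intro s
  have hball : ∀ v ∈ Metric.closedBall (f s) ‖k s‖, ‖b (G' v) - b (G' (f s))‖ ≤ ε := by
    intro v hv
    have hkδ : ‖k s‖ < δ := (k.norm_coe_le_norm s).trans_lt (by simpa using hk)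
    -- Shifting `f` by the constant v - f(s) makes the value G'(v) at the single point `s` an
    -- instance of the uniform estimate.
    have hd : dist (f + ContinuousMap.const K (v - f s)) f < δ := by
      rw [dist_eq_norm, add_sub_cancel_left, ContinuousMap.norm_lt_iff _ hδ]
      intro _
      exact lt_of_le_of_lt (by simpa [dist_eq_norm] using hv) hkδ
    have h1 := h hd
    rw [dist_eq_norm] at h1
    have h2 := (ContinuousMap.norm_coe_le_norm _ s).trans h1.le
    have h3 : ‖G' v - G' (f s)‖ ≤ ε / (‖b‖ + 1) := by simpa using h2
    rw [← map_sub]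
    calc ‖b (G' v - G' (f s))‖ ≤ ‖b‖ * ‖G' v - G' (f s)‖ := b.le_opNorm _
      _ ≤ (‖b‖ + 1) * (ε / (‖b‖ + 1)) := by gcongr; linarith
      _ = ε := by field_simp
  have hmv := (convex_closedBall (f s) ‖k s‖).norm_image_sub_le_of_norm_hasFDerivWithin_le
    (𝕜 := ℝ) (f := fun v => G v - b (G' (f s)) v) (C := ε)
    (f' := fun v => b (G' v) - b (G' (f s)))
    (x := f s) (y := f s + k s)
    (fun v _ => ((hG v).sub (b (G' (f s))).hasFDerivAt).hasFDerivWithinAt)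
    hball
    (Metric.mem_closedBall_self (norm_nonneg _)) (by simp)
  have he : ‖k s‖ ≤ ‖k‖ := k.norm_coe_le_norm s
  calc ‖_‖ = ‖G (f s + k s) - b (G' (f s)) (f s + k s) - (G (f s) - b (G' (f s)) (f s))‖ := by
        congr 1
        simp only [ContinuousMap.sub_apply, superposition_apply, ContinuousMap.add_apply,
          pointwiseBilin_apply, map_add]
        abel
    _ ≤ ε * ‖k s‖ := by simpa using hmv
    _ ≤ ε * ‖k‖ := by gcongr

/-- Induction on the order: the derivative is a fixed linear operator applied to the superposition
operator of `fderiv ℝ G`. The target changes to `E →L[ℝ] F` in each step, whence the common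
universe. -/
theorem contDiff_superposition_nat (m : ℕ) {F : Type u} [NormedAddCommGroup F] [NormedSpace ℝ F]
    {G : E → F} (hc : Continuous G) (hG : ContDiff ℝ m G) :
    ContDiff ℝ m (superposition K hc) := by
  induction m generalizing F with
  | zero => exact contDiff_zero.2 (continuous_superposition _)
  | succ m ih =>
    have hD : ContDiff ℝ m (fderiv ℝ G) := hG.fderiv_right (by norm_cast)
    rw [show ((m + 1 : ℕ) : WithTop ℕ∞) = (m : WithTop ℕ∞) + 1 by norm_cast,
      contDiff_succ_iff_hasFDerivAt]
    refine ⟨_, (pointwiseBilin K (ContinuousLinearMap.id ℝ (E →L[ℝ] F))).contDiff.comp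
      (ih hD.continuous hD), fun f => ?_⟩
    exact hasFDerivAt_superposition hc (ContinuousLinearMap.id ℝ (E →L[ℝ] F)) hD.continuous
      (fun v => (hG.differentiable (by simp) v).hasFDerivAt) f

/-- The superposition operator of a smooth map is smooth. -/
theorem contDiff_superposition {G : E → F} (hG : ContDiff ℝ ∞ G) :
    ContDiff ℝ ∞ (superposition K hG.continuous) :=
  contDiff_infty.2 fun m =>
    contDiff_superposition_nat m hG.continuous (hG.of_le (by exact_mod_cast le_top))

end Superposition

/-! ### Flow lines as a smooth family in C([0, 1], Z) -/

section Flow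

open unitInterval

universe u

variable {Z : Type u} [NormedAddCommGroup Z] [NormedSpace ℝ Z]

/-- The path in `C([0, 1], Z)` extended to the real line by constants. -/
theorem continuous_comp_projIcc (g : C(I, Z)) :
    Continuous fun τ : ℝ => g (Set.projIcc 0 1 zero_le_one τ) :=
  g.continuous.comp continuous_projIcc

variable [CompleteSpace Z]

variable (Z) in
/-- Integration from `0`, as an operator on `C([0, 1], Z)`. -/
noncomputable def integralCLM : C(I, Z) →L[ℝ] C(I, Z) :=
  LinearMap.mkContinuous
    { toFun := fun g => ⟨fun s : I => ∫ τ in (0 : ℝ)..s, g (Set.projIcc 0 1 zero_le_one τ),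
        (intervalIntegral.continuous_primitive
          (fun a b => (continuous_comp_projIcc g).intervalIntegrable a b) 0).comp
          continuous_subtype_val⟩
      map_add' := fun g h => by
        ext s
        exact intervalIntegral.integral_add ((continuous_comp_projIcc g).intervalIntegrable _ _)
          ((continuous_comp_projIcc h).intervalIntegrable _ _)
      map_smul' := fun c g => by
        ext s
        exact intervalIntegral.integral_smul c _ }
    1 (fun g => by
      rw [one_mul, ContinuousMap.norm_le _ (norm_nonneg _)]
      intro s
      refine (intervalIntegral.norm_integral_le_of_norm_le_const
        (fun τ _ => g.norm_coe_le_norm _)).trans ?_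
      rw [sub_zero, abs_of_nonneg s.2.1]
      exact mul_le_of_le_one_right (norm_nonneg _) s.2.2)

theorem integralCLM_apply (g : C(I, Z)) (s : I) :
    integralCLM Z g s = ∫ τ in (0 : ℝ)..s, g (Set.projIcc 0 1 zero_le_one τ) := rfl

variable (Z) in
/-- The constant paths. -/
noncomputable def constCLM : Z →L[ℝ] C(I, Z) where
  toFun := ContinuousMap.const I
  map_add' _ _ := rfl
  map_smul' _ _ := rfl
  cont := ContinuousMap.continuous_const'

@[simp] theorem constCLM_apply (z : Z) (s : I) : constCLM Z z s = z := rfl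

variable (Z) in
/-- Pairs of a constant and a path, as paths in the product. -/
noncomputable def pairCLM : Z × C(I, Z) →L[ℝ] C(I, Z × Z) :=
  ((ContinuousLinearMap.inl ℝ Z Z).compLeftContinuous ℝ I).comp
      (ContinuousLinearMap.snd ℝ Z C(I, Z)) +
    ((ContinuousLinearMap.inr ℝ Z Z).compLeftContinuous ℝ I).comp
      ((constCLM Z).comp (ContinuousLinearMap.fst ℝ Z C(I, Z)))

@[simp] theorem pairCLM_apply (p : Z × C(I, Z)) (s : I) : pairCLM Z p s = (p.2 s, p.1) := by
  simp [pairCLM]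

/-- A path that is given by an integral is differentiable. -/
theorem hasDerivAt_of_eq_integral (g : C(I, Z)) (z : Z) (s : ℝ) :
    HasDerivAt (fun s : ℝ => z + ∫ τ in (0 : ℝ)..s, g (Set.projIcc 0 1 zero_le_one τ))
      (g (Set.projIcc 0 1 zero_le_one s)) s :=
  ((continuous_comp_projIcc g).integral_hasStrictDerivAt 0 s).hasDerivAt.const_add z

/-- The family of paths `φ z` from `z` with velocity `-P(φ) P(z₀)(z - z₀)`, together with the
linearised equation. -/
theorem exists_flow {P : Z → Z →L[ℝ] Z} (hP : ContDiff ℝ ∞ P) (z₀ : Z) :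
    ∃ φ : Z → C(I, Z), SmoothNear φ z₀ ∧ φ z₀ = constCLM Z z₀ ∧
      ∀ᶠ z in 𝓝 z₀,
        (∃ g : C(I, Z), (∀ s, g s = -(P (φ z s) (P z₀ (z - z₀)))) ∧
          φ z = constCLM Z z + integralCLM Z g) ∧
        ∀ w, ∃ g : C(I, Z),
          (∀ s, g s = -(fderiv ℝ P (φ z s) (fderiv ℝ φ z w s) (P z₀ (z - z₀)) +
            P (φ z s) (P z₀ w))) ∧
          fderiv ℝ φ z w = constCLM Z w + integralCLM Z g := by
  -- The integral equation for φ is Φ(z, φ) = 0 on Z × C([0, 1], Z). For z = z₀ the velocity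
  -- vanishes whatever the path is, so the partial derivative of Φ in the path is the identity
  -- there, and the implicit function theorem applies.
  let G : Z × Z → Z := fun p => P p.1 p.2
  have hG : ContDiff ℝ ∞ G := (hP.comp contDiff_fst).clm_apply contDiff_snd
  have hG' : ∀ u x h k, fderiv ℝ G (u, x) (h, k) = fderiv ℝ P u h x + P u k := by
    intro u x h k
    have h1 : HasFDerivAt (fun p : Z × Z => P p.1)
        ((fderiv ℝ P u).comp (ContinuousLinearMap.fst ℝ Z Z)) (u, x) :=
      HasFDerivAt.comp (u, x) (hP.differentiable (by simp) u).hasFDerivAt hasFDerivAt_fst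
    have h2 := h1.clm_apply (hasFDerivAt_snd (𝕜 := ℝ) (E := Z) (F := Z) (p := (u, x)))
    rw [show fderiv ℝ G (u, x) = _ from h2.fderiv]
    simp [add_comm]
  let N := superposition I hG.continuous
  have hN : ContDiff ℝ ∞ N := contDiff_superposition hG
  have hcG' : Continuous (fderiv ℝ G) := hG.continuous_fderiv (by simp)
  let N' : C(I, Z × Z) → C(I, Z × Z) →L[ℝ] C(I, Z) := fun f =>
    pointwiseBilin I (ContinuousLinearMap.id ℝ (Z × Z →L[ℝ] Z)) (superposition I hcG' f)
  have hN' : ∀ f, HasFDerivAt N (N' f) f := fun f =>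
    hasFDerivAt_superposition hG.continuous (ContinuousLinearMap.id ℝ (Z × Z →L[ℝ] Z)) hcG'
      (fun v => (hG.differentiable (by simp) v).hasFDerivAt) f
  let ι : Z × C(I, Z) →L[ℝ] C(I, Z × Z) := (pairCLM Z).comp
    (((P z₀).comp (ContinuousLinearMap.fst ℝ Z C(I, Z))).prod (ContinuousLinearMap.snd ℝ Z C(I, Z)))
  -- `ι` takes (z, f) to the path (f, P z₀ z); subtracting `c₀` turns the second component into P z₀
  -- (z - z₀).
  let c₀ : C(I, Z × Z) := pairCLM Z (P z₀ z₀, 0)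
  let Φ : Z × C(I, Z) → C(I, Z) := fun p =>
    p.2 - constCLM Z p.1 + integralCLM Z (N (ι p - c₀))
  let Φ' : Z × C(I, Z) → Z × C(I, Z) →L[ℝ] C(I, Z) := fun p =>
    ContinuousLinearMap.snd ℝ Z C(I, Z) - (constCLM Z).comp (ContinuousLinearMap.fst ℝ Z C(I, Z)) +
      (integralCLM Z).comp ((N' (ι p - c₀)).comp ι)
  have hΦ' : ∀ p, HasFDerivAt Φ (Φ' p) p := fun p => by
    have h1 : HasFDerivAt (fun p => N (ι p - c₀)) ((N' (ι p - c₀)).comp ι) p :=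
      HasFDerivAt.comp p (hN' _) (ι.hasFDerivAt.sub_const c₀)
    exact (hasFDerivAt_snd.sub (HasFDerivAt.comp p (constCLM Z).hasFDerivAt hasFDerivAt_fst)).add
      (HasFDerivAt.comp p (integralCLM Z).hasFDerivAt h1)
  have hΦ : ContDiff ℝ ∞ Φ :=
    (contDiff_snd.sub ((constCLM Z).contDiff.comp contDiff_fst)).add
      ((integralCLM Z).contDiff.comp (hN.comp (ι.contDiff.sub contDiff_const)))
  have hNval : ∀ p s, N (ι p - c₀) s = P (p.2 s) (P z₀ (p.1 - z₀)) := fun p s => by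
    simp [N, ι, c₀, G, superposition_apply]
  have hN'val : ∀ p q s, N' (ι p - c₀) (ι q) s =
      fderiv ℝ P (p.2 s) (q.2 s) (P z₀ (p.1 - z₀)) + P (p.2 s) (P z₀ q.1) := fun p q s => by
    rw [← hG']; simp [N', ι, c₀, superposition_apply]
  have h0 : Φ (z₀, constCLM Z z₀) = 0 := by
    have : N (ι (z₀, constCLM Z z₀) - c₀) = 0 := by
      ext s; rw [hNval]; simp
    simp [Φ, this]
  have hA : ∀ v, fderiv ℝ Φ (z₀, constCLM Z z₀) (0, v) = ContinuousLinearEquiv.refl ℝ C(I, Z) v := by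
    intro v
    rw [(hΦ' _).fderiv]
    have : N' (ι (z₀, constCLM Z z₀) - c₀) (ι (0, v)) = 0 := by
      ext s; rw [hN'val]; simp
    simp [Φ', this]
  obtain ⟨φ, hφ, hφ0, hφe, -⟩ :=
    (smoothNear_of_contDiff hΦ _).exists_implicit h0 (ContinuousLinearEquiv.refl ℝ C(I, Z)) hA
  refine ⟨φ, hφ, hφ0, ?_⟩
  filter_upwards [hφe.eventually_nhds, hφ.eventually_nhds] with z hz hzs
  constructor
  · refine ⟨-N (ι (z, φ z) - c₀), fun s => by simp [hNval], ?_⟩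
    have := hz.self_of_nhds
    simp only [Φ] at this
    rw [map_neg, ← sub_eq_add_neg, eq_sub_iff_add_eq, ← sub_eq_zero, ← this]
    abel
  · intro w
    refine ⟨-N' (ι (z, φ z) - c₀) (ι (w, fderiv ℝ φ z w)), fun s => by
      rw [ContinuousMap.neg_apply, hN'val], ?_⟩
    have hd : HasFDerivAt (fun z => Φ (z, φ z))
        ((Φ' (z, φ z)).comp ((ContinuousLinearMap.id ℝ Z).prod (fderiv ℝ φ z))) z :=
      HasFDerivAt.comp z (hΦ' (z, φ z)) ((hasFDerivAt_id z).prodMk hzs.differentiableAt.hasFDerivAt)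
    have hzero : (Φ' (z, φ z)).comp ((ContinuousLinearMap.id ℝ Z).prod (fderiv ℝ φ z)) = 0 := by
      rw [← hd.fderiv, (EventuallyEq.fderiv_eq (f := fun _ => (0 : C(I, Z))) hz)]
      simp
    have := DFunLike.congr_fun hzero w
    simp only [Φ', ContinuousLinearMap.comp_apply, add_apply,
      sub_apply, ContinuousLinearMap.prod_apply, ContinuousLinearMap.id_apply,
      ContinuousLinearMap.coe_snd', ContinuousLinearMap.coe_fst',
      zero_apply] at this
    rw [map_neg, ← sub_eq_add_neg, eq_sub_iff_add_eq, ← sub_eq_zero, ← this]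
    abel

end Flow

/-! ### Retraction to a slice along Cauchy characteristics -/

section Retraction

open unitInterval

/-- A map that is smooth near a point agrees near the point with a smooth map. -/
theorem SmoothNear.exists_contDiff {E F : Type*} [NormedAddCommGroup E] [NormedSpace ℝ E]
    [FiniteDimensional ℝ E] [NormedAddCommGroup F] [NormedSpace ℝ F] {f : E → F} {z : E}
    (hf : SmoothNear f z) : ∃ g : E → F, ContDiff ℝ ∞ g ∧ g =ᶠ[𝓝 z] f := by
  obtain ⟨ε, hε, hb⟩ := Metric.eventually_nhds_iff_ball.1 hf
  let χ : ContDiffBump z := ⟨ε / 4, ε / 2, by positivity, by linarith⟩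
  refine ⟨fun y => χ y • f y, contDiff_iff_contDiffAt.2 fun y => ?_, ?_⟩
  · by_cases hy : y ∈ Metric.ball z ε
    · exact χ.contDiff.contDiffAt.smul (hb y hy)
    · have hy' : y ∈ (Metric.closedBall z (ε / 2))ᶜ := by
        simp only [Metric.mem_ball, not_lt] at hy
        simp only [Set.mem_compl_iff, Metric.mem_closedBall, not_le]
        linarith
      refine (contDiffAt_const (c := (0 : F))).congr_of_eventuallyEq ?_
      filter_upwards [Metric.isClosed_closedBall.isOpen_compl.mem_nhds hy'] with u hu
      rw [χ.zero_of_le_dist, zero_smul]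
      simp only [Set.mem_compl_iff, Metric.mem_closedBall, not_le] at hu
      exact hu.le
  · filter_upwards [χ.eventuallyEq_one] with y hy
    simp [hy]

/-- A smooth family of linear maps has a smooth family of right inverses, if it has a right inverse
at one point. -/
theorem SmoothNear.exists_rightInverse {Z V : Type*} [NormedAddCommGroup Z] [NormedSpace ℝ Z]
    [NormedAddCommGroup V] [NormedSpace ℝ V] [CompleteSpace V] {A : Z → Z →L[ℝ] V} {z₀ : Z}
    (hA : SmoothNear A z₀) {ι : V →L[ℝ] Z} (hι : ∀ v, A z₀ (ι v) = v) :
    ∃ ν : Z → V →L[ℝ] Z, SmoothNear ν z₀ ∧ ν z₀ = ι ∧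
      (∀ᶠ z in 𝓝 z₀, ∀ v, A z (ν z v) = v) ∧ ∀ z v, ∃ u, ν z v = ι u := by
  have hB : SmoothNear (fun z => (A z).comp ι) z₀ := hA.clm_comp (smoothNear_const ι _)
  have h0 : (A z₀).comp ι = ((ContinuousLinearEquiv.refl ℝ V : V ≃L[ℝ] V) : V →L[ℝ] V) := by
    ext v; simp [hι]
  have hinv : ∀ᶠ z in 𝓝 z₀, ∃ e : V ≃L[ℝ] V, (e : V →L[ℝ] V) = (A z).comp ι := by
    have := hB.continuousAt.tendsto
    rw [h0] at this
    exact this.eventually (ContinuousLinearEquiv.nhds (ContinuousLinearEquiv.refl ℝ V))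
  -- A z ∘ ι is the identity at z₀, hence invertible nearby. With `ι` on the left the image of ν z
  -- stays in the fixed space im ι.
  refine ⟨fun z => ι.comp ((A z).comp ι).inverse, ?_, ?_, ?_, fun z v => ⟨_, rfl⟩⟩
  · refine (smoothNear_const ι _).clm_comp ?_
    filter_upwards [hB, hinv] with z hz ⟨e, he⟩
    have h1 := contDiffAt_map_inverse (𝕜 := ℝ) (n := ∞) e
    rw [he] at h1
    exact h1.comp z hz
  · change ι.comp ((A z₀).comp ι).inverse = ι
    rw [h0, ContinuousLinearMap.inverse_equiv]; ext v; simp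
  · filter_upwards [hinv] with z ⟨e, he⟩ v
    change ((A z).comp ι) (((A z).comp ι).inverse v) = v
    rw [← he, ContinuousLinearMap.inverse_equiv]
    simp

/-- Gronwall's inequality, forwards and, after s ↦ 1 - s, backwards. -/
theorem eq_zero_iff_of_norm_deriv_le {V : Type*} [NormedAddCommGroup V] [NormedSpace ℝ V]
    {q q' : ℝ → V} {K : ℝ} (hq : ∀ s ∈ Set.Icc (0 : ℝ) 1, HasDerivAt q (q' s) s)
    (hK : ∀ s ∈ Set.Icc (0 : ℝ) 1, ‖q' s‖ ≤ K * ‖q s‖) : q 1 = 0 ↔ q 0 = 0 := by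
  constructor
  · intro h
    have h2 : ∀ s ∈ Set.Icc (0 : ℝ) 1, HasDerivAt (fun s => q (1 - s)) (-q' (1 - s)) s := by
      intro s hs
      have := (hq (1 - s) ⟨by linarith [hs.2], by linarith [hs.1]⟩).scomp s
        ((hasDerivAt_id s).const_sub 1)
      simpa [Function.comp_def] using this
    have := eq_zero_of_abs_deriv_le_mul_abs_self_of_eq_zero_right (K := K)
      (fun s hs => (h2 s hs).continuousAt.continuousWithinAt)
      (fun s hs => (h2 s ⟨hs.1, hs.2.le⟩).hasDerivWithinAt) (by simpa using h)
      (fun s hs => by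
        rw [norm_neg]
        exact hK (1 - s) ⟨by linarith [hs.2], by linarith [hs.1]⟩)
      1 (by simp)
    simpa using this
  · intro h
    exact eq_zero_of_abs_deriv_le_mul_abs_self_of_eq_zero_right (K := K)
      (fun s hs => (hq s hs).continuousAt.continuousWithinAt)
      (fun s hs => (hq s ⟨hs.1, hs.2.le⟩).hasDerivWithinAt) h
      (fun s hs => hK s ⟨hs.1, hs.2.le⟩) 1 (by simp)

variable {Z V : Type} [NormedAddCommGroup Z] [NormedSpace ℝ Z] [FiniteDimensional ℝ Z]
  [NormedAddCommGroup V] [NormedSpace ℝ V] [FiniteDimensional ℝ V]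

/-- If `dA(P v, w)` vanishes for `w` in the kernel of `A`, then it is bounded by `A w`. -/
theorem exists_bound_curl {P : Z → Z →L[ℝ] Z} {A : Z → Z →L[ℝ] V} {z₀ : Z} (hP : SmoothNear P z₀)
    (hA : SmoothNear A z₀) (hsurj : Function.Surjective (A z₀))
    (hd : ∀ᶠ z in 𝓝 z₀, ∀ v w, A z w = 0 →
      fderiv ℝ A z (P z v) w = fderiv ℝ A z w (P z v)) :
    ∃ K, ∀ᶠ z in 𝓝 z₀, ∀ v w,
      ‖fderiv ℝ A z (P z v) w - fderiv ℝ A z w (P z v)‖ ≤ K * ‖v‖ * ‖A z w‖ := by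
  obtain ⟨ι, hι⟩ := (A z₀).exists_rightInverse_of_surjective (LinearMap.range_eq_top.2 hsurj)
  obtain ⟨ν, hν, -, hAν, -⟩ := hA.exists_rightInverse (ι := ι) (fun v => DFunLike.congr_fun hι v)
  have hc : ContinuousAt (fun z => 2 * ‖fderiv ℝ A z‖ * ‖P z‖ * ‖ν z‖) z₀ :=
    ((continuousAt_const.mul hA.fderiv_right.continuousAt.norm).mul hP.continuousAt.norm).mul
      hν.continuousAt.norm
  refine ⟨2 * ‖fderiv ℝ A z₀‖ * ‖P z₀‖ * ‖ν z₀‖ + 1, ?_⟩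
  filter_upwards [hd, hAν, hc.eventually (gt_mem_nhds (lt_add_one _))] with z h1 h2 h3 v w
  -- `w - w'` lies in the kernel of A z and does not contribute; the size of `w'` is controlled by A
  -- z w.
  set w' := ν z (A z w) with hw'
  have h4 : fderiv ℝ A z (P z v) w - fderiv ℝ A z w (P z v) =
      fderiv ℝ A z (P z v) w' - fderiv ℝ A z w' (P z v) := by
    have := h1 v (w - w') (by rw [map_sub, hw', h2, sub_self])
    simp only [map_sub, sub_apply] at this
    rw [sub_eq_sub_iff_add_eq_add]
    rw [sub_eq_sub_iff_add_eq_add] at this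
    rw [this]; abel
  have hw'le : ‖w'‖ ≤ ‖ν z‖ * ‖A z w‖ := (ν z).le_opNorm _
  have hPle : ‖P z v‖ ≤ ‖P z‖ * ‖v‖ := (P z).le_opNorm _
  have h5 : ‖fderiv ℝ A z (P z v) w'‖ ≤ ‖fderiv ℝ A z‖ * (‖P z‖ * ‖v‖) * (‖ν z‖ * ‖A z w‖) :=
    ((fderiv ℝ A z).le_opNorm₂ _ _).trans (by gcongr)
  have h6 : ‖fderiv ℝ A z w' (P z v)‖ ≤ ‖fderiv ℝ A z‖ * (‖ν z‖ * ‖A z w‖) * (‖P z‖ * ‖v‖) :=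
    ((fderiv ℝ A z).le_opNorm₂ _ _).trans (by gcongr)
  rw [h4]
  calc _ ≤ ‖fderiv ℝ A z (P z v) w'‖ + ‖fderiv ℝ A z w' (P z v)‖ := norm_sub_le _ _
    _ ≤ (2 * ‖fderiv ℝ A z‖ * ‖P z‖ * ‖ν z‖) * ‖v‖ * ‖A z w‖ := by linarith
    _ ≤ _ := by gcongr

/-- Flowing along the distribution `im P` gives a retraction of `Z` to the slice `ker (P z₀)`. If
`im P` consists of Cauchy characteristics of `A`, then the retraction preserves the kernel of
`A`. -/
theorem exists_retraction {P : Z → Z →L[ℝ] Z} {A : Z → Z →L[ℝ] V} {z₀ : Z} (hP : SmoothNear P z₀)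
    (hPP : ∀ᶠ z in 𝓝 z₀, ∀ v, P z₀ (P z v) = P z₀ v) (hA : SmoothNear A z₀)
    (hsurj : Function.Surjective (A z₀)) (hAP : ∀ᶠ z in 𝓝 z₀, ∀ v, A z (P z v) = 0)
    (hd : ∀ᶠ z in 𝓝 z₀, ∀ v w, A z w = 0 →
      fderiv ℝ A z (P z v) w = fderiv ℝ A z w (P z v)) :
    ∃ r : Z → Z, SmoothNear r z₀ ∧ r z₀ = z₀ ∧ (∀ w, fderiv ℝ r z₀ w = w - P z₀ w) ∧
      (∀ᶠ z in 𝓝 z₀, P z₀ (r z - z₀) = 0) ∧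
      ∀ᶠ z in 𝓝 z₀, ∀ w, A (r z) (fderiv ℝ r z w) = 0 ↔ A z w = 0 := by
  have : CompleteSpace Z := FiniteDimensional.complete ℝ Z
  -- The flow is built for a globally smooth `Q` that agrees with `P` near z₀, where the paths stay.
  obtain ⟨Q, hQ, hQP⟩ := hP.exists_contDiff
  have hQ0 : Q z₀ = P z₀ := hQP.self_of_nhds
  have hidem : ∀ v, P z₀ (P z₀ v) = P z₀ v := hPP.self_of_nhds
  obtain ⟨φ, hφ, hφ0, hφe⟩ := exists_flow hQ z₀
  obtain ⟨K, hK⟩ := exists_bound_curl hP hA hsurj hd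
  -- The path of z₀ is constant, so whole paths that start near z₀ remain near z₀.
  have hstay : ∀ {p : Z → Prop}, (∀ᶠ z in 𝓝 z₀, p z) → ∀ᶠ z in 𝓝 z₀, ∀ s, p (φ z s) := by
    intro p hp
    obtain ⟨ε, hε, hb⟩ := Metric.eventually_nhds_iff.1 hp
    filter_upwards [hφ.continuousAt (Metric.ball_mem_nhds _ hε)] with z hz s
    refine hb (lt_of_le_of_lt ?_ hz)
    have := ContinuousMap.dist_apply_le_dist (f := φ z) (g := φ z₀) s
    rwa [hφ0, constCLM_apply, ← hφ0] at this
  let ev : C(I, Z) →L[ℝ] Z := ContinuousMap.evalCLM ℝ (1 : I)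
  have hr' : ∀ᶠ z in 𝓝 z₀, ∀ w, fderiv ℝ (fun z => ev (φ z)) z w = fderiv ℝ φ z w 1 := by
    filter_upwards [hφ] with z hz w
    have := (ev.hasFDerivAt.comp z (hz.differentiableAt (by simp)).hasFDerivAt).fderiv
    exact DFunLike.congr_fun this w
  refine ⟨fun z => ev (φ z), (smoothNear_of_contDiff ev.contDiff _).comp hφ, ?_, ?_, ?_, ?_⟩
  · simp [hφ0, ev]
  · intro w
    obtain ⟨g, hg, hgw⟩ := hφe.self_of_nhds.2 w
    have hg' : ∀ s, g s = -(P z₀ w) := fun s => by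
      rw [hg, hφ0]; simp [hQ0, hidem]
    rw [hr'.self_of_nhds, hgw]
    simp [integralCLM_apply, hg', sub_eq_add_neg]
  · filter_upwards [hφe, hstay hPP, hstay hQP] with z h1 h2 h3
    obtain ⟨⟨g, hg, hgφ⟩, -⟩ := h1
    -- By P z₀ P z = P z₀ the P z₀-component of the velocity is the constant -P z₀ (z - z₀); at time
    -- 1 this component of φ - z₀ has become zero.
    have hPg : ∀ s, P z₀ (g s) = -(P z₀ (z - z₀)) := fun s => by
      rw [hg, h3, map_neg, h2, hQ0, hidem]
    have hval : ev (φ z) = z + integralCLM Z g 1 := by rw [hgφ]; rfl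
    rw [hval, add_sub_right_comm, map_add, integralCLM_apply,
      ← ContinuousLinearMap.intervalIntegral_comp_comm _
        ((continuous_comp_projIcc g).intervalIntegrable _ _)]
    simp [hPg]
  · have hAP' : ∀ᶠ z in 𝓝 z₀, ∀ u v, fderiv ℝ A z u (P z v) = -(A z (fderiv ℝ P z u v)) := by
      filter_upwards [hAP.eventually_nhds, hA, hP] with z h1 h2 h3 u v
      have h4 : HasFDerivAt (fun z => P z v) ((fderiv ℝ P z).flip v) z := by
        have := (h3.differentiableAt (by simp)).hasFDerivAt.clm_apply (hasFDerivAt_const v z)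
        simpa [Function.comp_def] using this
      have h5 := (h2.differentiableAt (by simp)).hasFDerivAt.clm_apply h4
      have h6 : HasFDerivAt (fun z => A z (P z v)) (0 : Z →L[ℝ] V) z :=
        (hasFDerivAt_const (0 : V) z).congr_of_eventuallyEq (h1.mono fun y hy => hy v)
      have h7 := DFunLike.congr_fun (h5.unique h6) u
      simp only [add_apply, ContinuousLinearMap.comp_apply,
        ContinuousLinearMap.flip_apply, zero_apply] at h7
      rw [eq_neg_iff_add_eq_zero, add_comm]
      exact h7
    have hQ' : ∀ᶠ z in 𝓝 z₀, fderiv ℝ Q z = fderiv ℝ P z :=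
      hQP.eventuallyEq_nhds.mono fun z hz => hz.fderiv_eq
    filter_upwards [hφe, hstay hK, hstay hAP, hstay hAP', hstay hQP, hstay hQ', hstay hA, hr']
      with z h1 h2 h3 h4 h5 h6 h7 h8 w
    obtain ⟨⟨g, hg, hgφ⟩, hw⟩ := h1
    obtain ⟨k, hk, hkφ⟩ := hw w
    rw [h8]
    set x := P z₀ (z - z₀) with hx
    let f : ℝ → Z := fun s => z + ∫ τ in (0 : ℝ)..s, g (Set.projIcc 0 1 zero_le_one τ)
    let d : ℝ → Z := fun s => w + ∫ τ in (0 : ℝ)..s, k (Set.projIcc 0 1 zero_le_one τ)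
    have hf : ∀ s : I, f s = φ z s := fun s => by rw [hgφ]; rfl
    have hd' : ∀ s : I, d s = fderiv ℝ φ z w s := fun s => by rw [hkφ]; rfl
    have hproj : ∀ (s : ℝ) (hs : s ∈ I), Set.projIcc 0 1 zero_le_one s = ⟨s, hs⟩ := fun s hs =>
      Set.projIcc_of_mem _ hs
    -- Let q(s) = A(φ(s))(dφ(s) w) and d = dφ(s) w. By the linearised equation and the derivative of
    -- A P = 0, q' is minus the curl dA(P x, d) - dA(d, P x), hence bounded by a multiple of |q|.
    have key := eq_zero_iff_of_norm_deriv_le (K := K * ‖x‖) (q := fun s => A (f s) (d s))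
      (q' := fun s => fderiv ℝ A (f s) (g (Set.projIcc 0 1 zero_le_one s)) (d s) +
        A (f s) (k (Set.projIcc 0 1 zero_le_one s)))
      (fun s hs => by
        have e1 : HasFDerivAt A (fderiv ℝ A (f s)) (f s) := by
          rw [hf ⟨s, hs⟩]
          exact ((h7 ⟨s, hs⟩).differentiableAt (by simp)).hasFDerivAt
        exact (e1.comp_hasDerivAt s (hasDerivAt_of_eq_integral g z s)).clm_apply
          (hasDerivAt_of_eq_integral k w s))
      (fun s hs => by
        rw [hproj s hs, hf ⟨s, hs⟩]
        have e1 : g ⟨s, hs⟩ = -(P (φ z ⟨s, hs⟩) x) := by rw [hg, hQ0, h5]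
        have e2 : k ⟨s, hs⟩ = -(fderiv ℝ P (φ z ⟨s, hs⟩) (d s) x +
            P (φ z ⟨s, hs⟩) (P z₀ w)) := by
          rw [hk, hQ0, h5, h6, hd' ⟨s, hs⟩]
        have e3 := h4 ⟨s, hs⟩ (d s) x
        have e4 : fderiv ℝ A (φ z ⟨s, hs⟩) (g ⟨s, hs⟩) (d s) + A (φ z ⟨s, hs⟩) (k ⟨s, hs⟩) =
            -(fderiv ℝ A (φ z ⟨s, hs⟩) (P (φ z ⟨s, hs⟩) x) (d s) -
              fderiv ℝ A (φ z ⟨s, hs⟩) (d s) (P (φ z ⟨s, hs⟩) x)) := by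
          rw [e3, e1, e2]
          simp only [map_neg, neg_apply, map_add, h3, add_zero]
          abel
        rw [e4, norm_neg]
        exact h2 ⟨s, hs⟩ x (d s))
    have k0 : f 0 = z := by simp [f]
    have k1 : d 0 = w := by simp [d]
    have k2 : f 1 = ev (φ z) := hf 1
    have k3 : d 1 = fderiv ℝ φ z w 1 := hd' 1
    simp only [k0, k1, k2, k3] at key
    exact key

end Retraction

/-! ### Leaf spaces of characteristics and Darboux's theorem -/

section Darboux

theorem SmoothNear.fderiv_fderiv_comm {E F : Type*} [NormedAddCommGroup E] [NormedSpace ℝ E]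
    [NormedAddCommGroup F] [NormedSpace ℝ F] {f : E → F} {z : E} (hf : SmoothNear f z) (u v : E) :
    fderiv ℝ (fderiv ℝ f) z u v = fderiv ℝ (fderiv ℝ f) z v u := by
  have h : minSmoothness ℝ 2 ≤ (∞ : WithTop ℕ∞) := by
    rw [minSmoothness_of_isRCLikeNormedField]
    exact WithTop.coe_le_coe.2 (le_top : (2 : ℕ∞) ≤ ⊤)
  exact (hf.contDiffAt.isSymmSndFDerivAt h).eq u v

theorem exists_eq_mul_of_ker_eq {E : Type*} [AddCommGroup E] [Module ℝ E] [TopologicalSpace E]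
    {f g : E →L[ℝ] ℝ} (h : ∀ w, f w = 0 ↔ g w = 0) : ∃ c : ℝ, c ≠ 0 ∧ ∀ w, f w = c * g w := by
  by_cases hg : ∃ w, g w ≠ 0
  · obtain ⟨w₀, h0⟩ := hg
    have hf0 : f w₀ ≠ 0 := fun h1 => h0 ((h w₀).1 h1)
    refine ⟨f w₀ / g w₀, div_ne_zero hf0 h0, fun w => ?_⟩
    have h1 := (h (w - (g w / g w₀) • w₀)).2 (by simp [h0])
    rw [map_sub, map_smul, smul_eq_mul, sub_eq_zero] at h1
    rw [h1]; ring
  · push Not at hg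
    exact ⟨1, one_ne_zero, fun w => by rw [one_mul, hg w, h w, hg w]⟩

variable {Z V V' : Type} [NormedAddCommGroup Z] [NormedSpace ℝ Z] [FiniteDimensional ℝ Z]
  [NormedAddCommGroup V] [NormedSpace ℝ V] [FiniteDimensional ℝ V]
  [NormedAddCommGroup V'] [NormedSpace ℝ V'] [FiniteDimensional ℝ V']

/-- If the distribution `ker B` consists of Cauchy characteristics of `A`, then `A` is, up to its
kernel, the pull-back of its restriction to a slice complementary to `ker B`. -/
theorem exists_slice_map {B : Z → Z →L[ℝ] V'} {A : Z → Z →L[ℝ] V} {z₀ : Z} (hB : SmoothNear B z₀)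
    {j : V' →L[ℝ] Z} (hj : ∀ v, B z₀ (j v) = v) (hA : SmoothNear A z₀)
    (hsurj : Function.Surjective (A z₀)) (hAB : ∀ᶠ z in 𝓝 z₀, ∀ w, B z w = 0 → A z w = 0)
    (hd : ∀ᶠ z in 𝓝 z₀, ∀ k w, B z k = 0 → A z w = 0 → fderiv ℝ A z k w = fderiv ℝ A z w k) :
    ∃ h : Z → V', SmoothNear h z₀ ∧ h z₀ = 0 ∧ fderiv ℝ h z₀ = B z₀ ∧
      ∀ᶠ z in 𝓝 z₀, ∀ w, A (z₀ + j (h z)) (j (fderiv ℝ h z w)) = 0 ↔ A z w = 0 := by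
  have : CompleteSpace V' := FiniteDimensional.complete ℝ V'
  obtain ⟨ν, hν, hν0, hBν, hνj⟩ := hB.exists_rightInverse hj
  -- Near z₀, P z projects to ker (B z) along the fixed space im j. These projections share their
  -- kernel, which is why P z₀ P z = P z₀.
  let P : Z → Z →L[ℝ] Z := fun z => ContinuousLinearMap.id ℝ Z - (ν z).comp (B z)
  have hPval : ∀ z w, P z w = w - ν z (B z w) := fun z w => by simp [P]
  have hP : SmoothNear P z₀ := (smoothNear_const _ _).sub (hν.clm_comp hB)
  have hBP : ∀ᶠ z in 𝓝 z₀, ∀ w, B z (P z w) = 0 := by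
    filter_upwards [hBν] with z hz w
    rw [hPval, map_sub, hz, sub_self]
  have hPP : ∀ᶠ z in 𝓝 z₀, ∀ v, P z₀ (P z v) = P z₀ v := Eventually.of_forall fun z v => by
    obtain ⟨u, hu⟩ := hνj z (B z v)
    rw [hPval z, map_sub, hu, hPval z₀ (j u), hj, hν0, sub_self, sub_zero]
  obtain ⟨r, hr, hr0, hdr, hPr, hker⟩ := exists_retraction hP hPP hA hsurj
    (by filter_upwards [hBP, hAB] with z h1 h2 v using h2 _ (h1 v))
    (by filter_upwards [hBP, hd] with z h1 h2 v w hw using h2 _ _ (h1 v) hw)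
  have hh : SmoothNear (fun z => B z₀ (r z - z₀)) z₀ :=
    (smoothNear_const (B z₀) _).clm_apply (hr.sub (smoothNear_const z₀ _))
  have hrh : ∀ᶠ z in 𝓝 z₀, r z = z₀ + j (B z₀ (r z - z₀)) := by
    filter_upwards [hPr] with z hz
    rw [hPval, hν0, sub_eq_zero] at hz
    rw [← hz]; abel
  have hderiv : ∀ᶠ z in 𝓝 z₀, ∀ w, fderiv ℝ (fun z => B z₀ (r z - z₀)) z w =
      B z₀ (fderiv ℝ r z w) := by
    filter_upwards [hr] with z hz w
    have := ((B z₀).hasFDerivAt.comp z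
      ((hz.differentiableAt (by simp)).hasFDerivAt.sub_const z₀)).fderiv
    exact DFunLike.congr_fun this w
  refine ⟨fun z => B z₀ (r z - z₀), hh, by simp [hr0], ?_, ?_⟩
  · ext w
    rw [hderiv.self_of_nhds, hdr, map_sub, hPval, map_sub, hν0, hj]; simp
  · filter_upwards [hker, hrh.eventually_nhds, hh] with z h1 h2 h3 w
    have h4 : fderiv ℝ r z w = j (fderiv ℝ (fun z => B z₀ (r z - z₀)) z w) := by
      have := (HasFDerivAt.congr_of_eventuallyEq ((j.hasFDerivAt.comp z
        (h3.differentiableAt (by simp)).hasFDerivAt).const_add z₀) h2).fderiv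
      rw [this]; rfl
    rw [← h2.self_of_nhds, ← h4]
    exact h1 w

/-- Darboux's theorem for contact forms in dimension three. -/
theorem exists_darboux_chart {Θ : J1 → J1 →L[ℝ] ℝ} (hΘ : SmoothNear Θ 0)
    (h0 : ∀ v, Θ 0 v = v.1)
    (hc : fderiv ℝ Θ 0 (0, 1, 0) (0, 0, 1) ≠ fderiv ℝ Θ 0 (0, 0, 1) (0, 1, 0)) :
    ∃ ρ : J1 → J1, SmoothNear ρ 0 ∧ ρ 0 = 0 ∧ Function.Surjective (fderiv ℝ ρ 0) ∧
      (∀ w, (fderiv ℝ ρ 0 w).1 = w.2.1) ∧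
      ∀ᶠ z in 𝓝 0, ∃ a : ℝ, a ≠ 0 ∧ ∀ w, contactForm (ρ z) (fderiv ℝ ρ z w) = a * Θ z w := by
  let e₁ : J1 := (1, 0, 0)
  let e₂ : J1 := (0, 1, 0)
  let e₃ : J1 := (0, 0, 1)
  let t : J1 →L[ℝ] ℝ := (ContinuousLinearMap.fst ℝ ℝ ℝ).comp (ContinuousLinearMap.snd ℝ ℝ (ℝ × ℝ))
  have ht : ∀ w, t w = w.2.1 := fun _ => rfl
  -- The kernel of (Θ, dt) is a line field, for which the curl condition is trivial. A first
  -- integral ζ of it has dζ = a Θ + b dt, so Θ is proportional to dζ - b dt, and (t, ζ, b) are the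
  -- required coordinates.
  let A : J1 → J1 →L[ℝ] ℝ × ℝ := fun z => (Θ z).prod t
  have hAval : ∀ z w, A z w = (Θ z w, w.2.1) := fun _ _ => rfl
  have hA : SmoothNear A 0 := by
    refine (((smoothNear_const (ContinuousLinearMap.inl ℝ ℝ ℝ) 0).clm_comp hΘ).add
      (smoothNear_const ((ContinuousLinearMap.inr ℝ ℝ ℝ).comp t) 0)).congr
      (Eventually.of_forall fun z => ?_)
    ext <;> simp [A]
  have hA' : ∀ᶠ z in 𝓝 (0 : J1), ∀ u w, fderiv ℝ A z u w = (fderiv ℝ Θ z u w, 0) := by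
    filter_upwards [hΘ, hA] with z hz hAz u w
    have h1 := (hAz.differentiableAt (by simp)).hasFDerivAt.clm_apply (hasFDerivAt_const w z)
    have h2 := ((hz.differentiableAt (by simp)).hasFDerivAt.clm_apply (hasFDerivAt_const w z)).prodMk
      (hasFDerivAt_const (t w) z)
    have := DFunLike.congr_fun (h1.unique h2) u
    simpa using this
  have hne : ∀ᶠ z in 𝓝 (0 : J1), Θ z e₁ ≠ 0 := by
    have : ContinuousAt (fun z => Θ z e₁) 0 := (hΘ.clm_apply (smoothNear_const e₁ 0)).continuousAt
    exact this.eventually_ne (by simp [h0, e₁])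
  have hΘval : ∀ z (w : J1), Θ z w = w.1 * Θ z e₁ + w.2.1 * Θ z e₂ + w.2.2 * Θ z e₃ := by
    intro z w
    have : w = w.1 • e₁ + w.2.1 • e₂ + w.2.2 • e₃ := by
      ext <;> simp [e₁, e₂, e₃]
    conv_lhs => rw [this]
    simp only [map_add, map_smul, smul_eq_mul]
  let j : ℝ × ℝ →L[ℝ] J1 := (ContinuousLinearMap.fst ℝ ℝ ℝ).prod
    ((ContinuousLinearMap.snd ℝ ℝ ℝ).prod 0)
  have hj : ∀ v, A 0 (j v) = v := fun v => by rw [hAval, h0]; rfl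
  obtain ⟨h, hh, hh0, hdh, hker⟩ := exists_slice_map hA hj hA (fun v => ⟨j v, hj v⟩)
    (Eventually.of_forall fun _ _ => id) (by
      filter_upwards [hA', hne] with z h1 h2 k w hk hw
      rw [h1, h1]
      have key : ∀ w, A z w = 0 → w = w.2.2 • (-(Θ z e₃ / Θ z e₁), 0, 1) := by
        intro w hw
        rw [hAval, Prod.mk_eq_zero, hΘval] at hw
        have h3 : w.1 = w.2.2 * -(Θ z e₃ / Θ z e₁) := by
          field_simp; linarith [hw.1, congrArg (· * Θ z e₂) hw.2]
        ext
        · simpa using h3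
        · simpa using hw.2
        · simp
      rw [key w hw, key k hk]
      simp only [map_smul, smul_apply, smul_smul, mul_comm])
  let ζ : J1 → ℝ := fun z => (h z).1
  have hζ : SmoothNear ζ 0 := by
    filter_upwards [hh] with z hz using contDiff_fst.contDiffAt.comp z hz
  have hζ' : ∀ᶠ z in 𝓝 (0 : J1), ∀ w, fderiv ℝ ζ z w = (fderiv ℝ h z w).1 := by
    filter_upwards [hh] with z hz w
    have := (hasFDerivAt_fst.comp z (hz.differentiableAt (by simp)).hasFDerivAt).fderiv
    exact DFunLike.congr_fun this w
  have hΘe : ∀ e : J1, SmoothNear (fun z => Θ z e) 0 := fun e => hΘ.clm_apply (smoothNear_const e 0)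
  have hζe : ∀ e : J1, SmoothNear (fun z => fderiv ℝ ζ z e) 0 := fun e =>
    hζ.fderiv_right.clm_apply (smoothNear_const e 0)
  let a : J1 → ℝ := fun z => fderiv ℝ ζ z e₁ / Θ z e₁
  let b : J1 → ℝ := fun z => fderiv ℝ ζ z e₂ - a z * Θ z e₂
  have ha : SmoothNear a 0 := (hζe e₁).div (hΘe e₁) hne.self_of_nhds
  have hb : SmoothNear b 0 := (hζe e₂).sub (ha.mul (hΘe e₂))
  have hζ0 : ∀ w, fderiv ℝ ζ 0 w = w.1 := fun w => by
    rw [hζ'.self_of_nhds, hdh, hAval, h0]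
  have ha0 : a 0 = 1 := by simp [a, hζ0, h0, e₁]
  have hb0 : b 0 = 0 := by simp [b, hζ0, h0, e₂]
  have hdec : ∀ᶠ z in 𝓝 (0 : J1), ∀ w, fderiv ℝ ζ z w = a z * Θ z w + b z * w.2.1 := by
    have hy : Tendsto (fun z => 0 + j (h z)) (𝓝 0) (𝓝 0) := by
      have := (j.continuous.continuousAt.comp hh.continuousAt).const_add (0 : J1)
      simpa [ContinuousAt, hh0] using this
    filter_upwards [hζ', hne, hker, hy.eventually hne] with z h1 h2 h3 hyz w
    -- Multiples of e₂ and e₁ are subtracted to bring `w` into the kernel of A z, on which dζ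
    -- vanishes.
    have h4 : A z (w - w.2.1 • e₂ - ((Θ z w - w.2.1 * Θ z e₂) / Θ z e₁) • e₁) = 0 := by
      rw [hAval, Prod.mk_eq_zero]
      constructor
      · simp only [map_sub, map_smul, smul_eq_mul]
        field_simp; ring
      · simp [e₁, e₂]
    have h5 := (h3 _).2 h4
    rw [hAval, Prod.mk_eq_zero] at h5
    have h6 : (fderiv ℝ h z (w - w.2.1 • e₂ - ((Θ z w - w.2.1 * Θ z e₂) / Θ z e₁) • e₁)).2 = 0 :=
      h5.2
    have h7 : (fderiv ℝ h z (w - w.2.1 • e₂ - ((Θ z w - w.2.1 * Θ z e₂) / Θ z e₁) • e₁)).1 = 0 := by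
      have h8 := h5.1
      generalize fderiv ℝ h z (w - w.2.1 • e₂ - ((Θ z w - w.2.1 * Θ z e₂) / Θ z e₁) • e₁) = v
        at h6 h8
      rw [hΘval] at h8
      simp only [j, ContinuousLinearMap.prod_apply, ContinuousLinearMap.coe_fst',
        ContinuousLinearMap.coe_snd', zero_apply, h6, zero_mul, add_zero, mul_eq_zero] at h8
      exact h8.resolve_right hyz
    rw [← h1] at h7
    simp only [map_sub, map_smul, smul_eq_mul] at h7
    simp only [b, a]
    field_simp
    field_simp at h7
    linarith
  let ρ : J1 → J1 := fun z => (z.2.1, ζ z, b z)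
  have hρ : SmoothNear ρ 0 :=
    (smoothNear_of_contDiff t.contDiff 0).prodMk (hζ.prodMk hb)
  have hρ' : ∀ᶠ z in 𝓝 (0 : J1), ∀ w, fderiv ℝ ρ z w = (w.2.1, fderiv ℝ ζ z w, fderiv ℝ b z w) := by
    filter_upwards [hζ, hb] with z h1 h2 w
    have := (t.hasFDerivAt.prodMk ((h1.differentiableAt (by simp)).hasFDerivAt.prodMk
      (h2.differentiableAt (by simp)).hasFDerivAt) : HasFDerivAt ρ _ z).fderiv
    exact DFunLike.congr_fun this w
  -- Symmetry of D²ζ on e₂ and e₃, computed from dζ = a Θ + b dt with a(0) = 1, says that ∂₃b =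
  -- dΘ(e₂, e₃) at 0.
  have hb3 : fderiv ℝ b 0 e₃ ≠ 0 := by
    have hsymm : fderiv ℝ (fderiv ℝ ζ) 0 e₃ e₂ = fderiv ℝ (fderiv ℝ ζ) 0 e₂ e₃ :=
      hζ.fderiv_fderiv_comm e₃ e₂
    have hdd : ∀ u w : J1, fderiv ℝ (fderiv ℝ ζ) 0 u w = a 0 * fderiv ℝ Θ 0 u w +
        Θ 0 w * fderiv ℝ a 0 u + w.2.1 * fderiv ℝ b 0 u := by
      intro u w
      have h1 := (hζ.fderiv_right.differentiableAt.hasFDerivAt).clm_apply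
        (hasFDerivAt_const w (0 : J1))
      have h2 := (ha.differentiableAt.hasFDerivAt.mul (hΘ.differentiableAt.hasFDerivAt.clm_apply
        (hasFDerivAt_const w (0 : J1)))).add (hb.differentiableAt.hasFDerivAt.mul_const w.2.1)
      have h3 := h2.congr_of_eventuallyEq (hdec.mono fun z hz => hz w)
      have := DFunLike.congr_fun (h1.unique h3) u
      simpa using this
    rw [hdd, hdd, ha0, h0, h0] at hsymm
    simp only [e₂, e₃] at hsymm ⊢
    intro hcon
    apply hc
    rw [hcon] at hsymm
    simpa using hsymm.symm
  refine ⟨ρ, hρ, ?_, ?_, ?_, ?_⟩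
  · have : ζ 0 = 0 := by simp [ζ, hh0]
    simp [ρ, this, hb0]
  · rintro ⟨y₁, y₂, y₃⟩
    refine ⟨(y₂, y₁, 0) + ((y₃ - fderiv ℝ b 0 (y₂, y₁, 0)) / fderiv ℝ b 0 e₃) • e₃, ?_⟩
    rw [hρ'.self_of_nhds, hζ0, map_add, map_smul]
    simp [hb3]
    simp [e₃]
  · intro w
    rw [hρ'.self_of_nhds]
  · have ha1 : ∀ᶠ z in 𝓝 (0 : J1), a z ≠ 0 := ha.continuousAt.eventually_ne (by simp [ha0])
    filter_upwards [hρ', hdec, ha1] with z h1 h2 h3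
    refine ⟨a z, h3, fun w => ?_⟩
    simp only [contactForm, h1, h2, ρ]
    ring

/-- A one-form of class three is, up to a factor, the pull-back of the contact form. -/
theorem exists_contact_map {Θ : Z → Z →L[ℝ] ℝ} {B : Z → Z →L[ℝ] J1} {z₀ : Z} (hB : SmoothNear B z₀)
    {j : J1 →L[ℝ] Z} (hj : ∀ v, B z₀ (j v) = v) (hΘ : SmoothNear Θ z₀)
    (hBΘ : ∀ᶠ z in 𝓝 z₀, ∀ w, (B z w).1 = Θ z w)
    (hd : ∀ᶠ z in 𝓝 z₀, ∀ k w, B z k = 0 → Θ z w = 0 → fderiv ℝ Θ z k w = fderiv ℝ Θ z w k)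
    (hc : fderiv ℝ Θ z₀ (j (0, 1, 0)) (j (0, 0, 1)) ≠ fderiv ℝ Θ z₀ (j (0, 0, 1)) (j (0, 1, 0))) :
    ∃ ρ : Z → J1, SmoothNear ρ z₀ ∧ ρ z₀ = 0 ∧ Function.Surjective (fderiv ℝ ρ z₀) ∧
      (∀ w, (fderiv ℝ ρ z₀ w).1 = (B z₀ w).2.1) ∧
      ∀ᶠ z in 𝓝 z₀, ∃ a : ℝ, a ≠ 0 ∧ ∀ w, contactForm (ρ z) (fderiv ℝ ρ z w) = a * Θ z w := by
  have hΘj : ∀ v, Θ z₀ (j v) = v.1 := fun v => by rw [← hBΘ.self_of_nhds, hj]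
  obtain ⟨h, hh, hh0, hdh, hker⟩ := exists_slice_map hB hj hΘ
    (fun s => ⟨j (s, 0, 0), hΘj _⟩)
    (by filter_upwards [hBΘ] with z hz w hw; rw [← hz, hw]; rfl) hd
  -- The restriction of Θ to the slice z₀ + im j. Its pull-back by `h` has the kernel of Θ, so a
  -- Darboux chart for `Θ₃`, composed with `h`, serves for Θ.
  let Θ₃ : J1 → J1 →L[ℝ] ℝ := fun v => (Θ (z₀ + j v)).comp j
  have hι : SmoothNear (fun v => z₀ + j v) 0 := smoothNear_of_contDiff (by fun_prop) 0
  have hΘι : SmoothNear (fun v => Θ (z₀ + j v)) 0 := hΘ.comp_of_eq hι (by simp)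
  have hΘ₃ : SmoothNear Θ₃ 0 := hΘι.clm_comp (smoothNear_const j 0)
  have hΘ₃' : ∀ u v, fderiv ℝ Θ₃ 0 u v = fderiv ℝ Θ z₀ (j u) (j v) := by
    intro u v
    have h1 : HasFDerivAt (fun v => z₀ + j v) j 0 := j.hasFDerivAt.const_add z₀
    have h2 : HasFDerivAt Θ (fderiv ℝ Θ z₀) (z₀ + j 0) := by
      simpa using hΘ.differentiableAt.hasFDerivAt
    have h3 := (h2.comp (0 : J1) h1).clm_apply (hasFDerivAt_const (j v) (0 : J1))
    have h4 := hΘ₃.differentiableAt.hasFDerivAt.clm_apply (hasFDerivAt_const v (0 : J1))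
    have := DFunLike.congr_fun (h4.unique h3) u
    simpa using this
  obtain ⟨ρ, hρ, hρ0, hρs, hρ1, hρc⟩ := exists_darboux_chart hΘ₃ (fun v => by simp [Θ₃, hΘj])
    (by rw [hΘ₃', hΘ₃']; exact hc)
  have hρh : ∀ᶠ z in 𝓝 z₀, ∀ w, fderiv ℝ (fun z => ρ (h z)) z w = fderiv ℝ ρ (h z) (fderiv ℝ h z w) := by
    have h1 := hh.continuousAt
    rw [ContinuousAt, hh0] at h1
    filter_upwards [hh, h1.eventually hρ] with z h2 h3 w
    have := ((h3.differentiableAt (by simp)).hasFDerivAt.comp z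
      (h2.differentiableAt (by simp)).hasFDerivAt).fderiv
    exact DFunLike.congr_fun this w
  refine ⟨fun z => ρ (h z), hρ.comp_of_eq hh hh0, by simp [hh0, hρ0], ?_, ?_, ?_⟩
  · intro y
    obtain ⟨v, hv⟩ := hρs y
    refine ⟨j v, ?_⟩
    rw [hρh.self_of_nhds, hdh, hj, hh0, hv]
  · intro w
    rw [hρh.self_of_nhds, hh0, hρ1, hdh]
  · have h1 := hh.continuousAt
    rw [ContinuousAt, hh0] at h1
    filter_upwards [hker, hρh, h1.eventually hρc] with z h2 h3 ⟨a, ha, h4⟩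
    obtain ⟨c, hc0, h5⟩ := exists_eq_mul_of_ker_eq (f := (Θ₃ (h z)).comp (fderiv ℝ h z)) (g := Θ z) h2
    refine ⟨a * c, mul_ne_zero ha hc0, fun w => ?_⟩
    rw [h3, h4, mul_assoc, ← h5]
    rfl

end Darboux

/-! ### Regular hypersurfaces in vector spaces -/

section ZeroSets

theorem hasFDerivAt_comp_of_eq {E F G : Type*} [NormedAddCommGroup E] [NormedSpace ℝ E]
    [NormedAddCommGroup F] [NormedSpace ℝ F] [NormedAddCommGroup G] [NormedSpace ℝ G] {g : F → G}
    {f : E → F} {g' : F →L[ℝ] G} {f' : E →L[ℝ] F} {x : E} {y : F} (hg : HasFDerivAt g g' y)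
    (hf : HasFDerivAt f f' x) (h : f x = y) : HasFDerivAt (fun u => g (f u)) (g'.comp f') x := by
  subst h; exact hg.comp x hf

theorem hasDerivAt_comp_smul {E F : Type*} [NormedAddCommGroup E] [NormedSpace ℝ E]
    [NormedAddCommGroup F] [NormedSpace ℝ F] {f : E → F} {f' : E →L[ℝ] F} {v : E} {s : ℝ}
    (hf : HasFDerivAt f f' (s • v)) : HasDerivAt (fun s : ℝ => f (s • v)) (f' v) s := by
  have h1 : HasDerivAt (fun s : ℝ => s • v) v s := by
    simpa using (hasDerivAt_id s).smul_const v
  exact hf.comp_hasDerivAt s h1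

variable {E F : Type*} [NormedAddCommGroup E] [NormedSpace ℝ E] [CompleteSpace E]
  [NormedAddCommGroup F] [NormedSpace ℝ F]

/-- Coordinates in which a submersion is linear. -/
theorem SmoothNear.exists_straightening {f : E → F} {u₀ : E} (hf : SmoothNear f u₀)
    (h0 : f u₀ = 0) {j : F →L[ℝ] E} (hj : ∀ y, fderiv ℝ f u₀ (j y) = y) :
    ∃ χ ψ : E → E, SmoothNear χ u₀ ∧ χ u₀ = 0 ∧ SmoothNear ψ 0 ∧ ψ 0 = u₀ ∧
      (∀ v, fderiv ℝ ψ 0 v = v) ∧ (∀ᶠ w in 𝓝 0, f (ψ w) = fderiv ℝ f u₀ w) ∧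
      ∀ᶠ u in 𝓝 u₀, ψ (χ u) = u := by
  set L := fderiv ℝ f u₀ with hL
  -- L χ = f because L j = id, and dχ = id at u₀; so the inverse ψ satisfies f ψ = L.
  let χ : E → E := fun u => (u - u₀) - j (L (u - u₀)) + j (f u)
  have hLχ : ∀ u, L (χ u) = f u := fun u => by simp [χ, hj]
  have hid : SmoothNear (fun u => u - u₀) u₀ := smoothNear_of_contDiff (by fun_prop) _
  have hχ : SmoothNear χ u₀ :=
    (hid.sub (((smoothNear_const (j.comp L) u₀)).clm_apply hid)).add
      ((smoothNear_const j u₀).clm_apply hf)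
  have hd : HasFDerivAt χ ((ContinuousLinearEquiv.refl ℝ E : E ≃L[ℝ] E) : E →L[ℝ] E) u₀ := by
    have h1 : HasFDerivAt (fun u => u - u₀) (ContinuousLinearMap.id ℝ E) u₀ :=
      (hasFDerivAt_id u₀).sub_const u₀
    have h2 := (h1.sub ((j.comp L).hasFDerivAt.comp u₀ h1)).add
      (j.hasFDerivAt.comp u₀ hf.differentiableAt.hasFDerivAt)
    refine h2.congr_fderiv ?_
    ext v; simp [← hL]
  have hχ0 : χ u₀ = 0 := by simp [χ, h0]
  obtain ⟨ψ, hψ, hψ0, hl, hr⟩ := hχ.exists_inverse hd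
  rw [hχ0] at hψ hψ0 hr
  refine ⟨χ, ψ, hχ, hχ0, hψ, hψ0, ?_, ?_, hl⟩
  · intro v
    have h1 : HasFDerivAt (fun w => χ (ψ w)) ((ContinuousLinearMap.id ℝ E).comp (fderiv ℝ ψ 0)) 0 :=
      hasFDerivAt_comp_of_eq hd hψ.differentiableAt.hasFDerivAt hψ0
    have h2 := (hasFDerivAt_id (𝕜 := ℝ) (0 : E)).congr_of_eventuallyEq hr
    exact DFunLike.congr_fun (h1.unique h2) v
  · filter_upwards [hr] with w hw
    rw [← hLχ, hw]

theorem exists_apply_eq_one {g : E →L[ℝ] ℝ} (hg : g ≠ 0) : ∃ e, g e = 1 := by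
  obtain ⟨v, hv⟩ : ∃ v, g v ≠ 0 := by
    by_contra! h
    exact hg (ContinuousLinearMap.ext h)
  exact ⟨(g v)⁻¹ • v, by simp [hv]⟩

/-- A map that vanishes on a regular hypersurface has a derivative that vanishes on its tangent
spaces. -/
theorem fderiv_eq_zero_of_zeroSet {g : E → ℝ} {f : E → F} {u₀ : E} (hg : SmoothNear g u₀)
    (hf : DifferentiableAt ℝ f u₀) (h0 : g u₀ = 0) (hg0 : fderiv ℝ g u₀ ≠ 0)
    (h : ∀ᶠ u in 𝓝 u₀, g u = 0 → f u = 0) {v : E} (hv : fderiv ℝ g u₀ v = 0) :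
    fderiv ℝ f u₀ v = 0 := by
  obtain ⟨e, he⟩ := exists_apply_eq_one hg0
  obtain ⟨χ, ψ, -, -, hψ, hψ0, hdψ, hgψ, -⟩ := hg.exists_straightening h0
    (j := ContinuousLinearMap.toSpanSingleton ℝ e) (fun y => by simp [he])
  -- A curve in the hypersurface with velocity `v`, along which `f` vanishes.
  have hline : HasDerivAt (fun s : ℝ => ψ (s • v)) v 0 := by
    have h2 : HasFDerivAt ψ (fderiv ℝ ψ 0) ((0 : ℝ) • v) := by
      simpa using hψ.differentiableAt.hasFDerivAt
    simpa [hdψ] using hasDerivAt_comp_smul h2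
  have hf' : HasFDerivAt f (fderiv ℝ f u₀) (ψ ((0 : ℝ) • v)) := by
    simpa [hψ0] using hf.hasFDerivAt
  have h3 := hf'.comp_hasDerivAt (0 : ℝ) hline
  have ht : Tendsto (fun s : ℝ => s • v) (𝓝 0) (𝓝 0) := by
    have : Continuous fun s : ℝ => s • v := by fun_prop
    simpa using this.tendsto 0
  have hψt : Tendsto ψ (𝓝 0) (𝓝 u₀) := by
    have := hψ.continuousAt.tendsto; rwa [hψ0] at this
  have h4 : (f ∘ fun s : ℝ => ψ (s • v)) =ᶠ[𝓝 0] fun _ => 0 := by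
    filter_upwards [ht.eventually hgψ, (hψt.comp ht).eventually h] with s h5 h6
    exact h6 (by rw [Function.comp_apply, h5]; simp [hv])
  exact h3.unique ((hasDerivAt_const (0 : ℝ) (0 : F)).congr_of_eventuallyEq h4)

/-- Two regular hypersurfaces through a point coincide near the point, if they have the same tangent
space there and one of them is contained in the other. -/
theorem eventually_eq_zero_of_zeroSet_subset {g g' : E → ℝ} {u₀ : E} (hg : SmoothNear g u₀)
    (hg' : SmoothNear g' u₀) (h0 : g u₀ = 0) (hg0 : fderiv ℝ g u₀ ≠ 0)
    (hg0' : fderiv ℝ g' u₀ ≠ 0) (h : ∀ᶠ u in 𝓝 u₀, g u = 0 → g' u = 0) :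
    ∀ᶠ u in 𝓝 u₀, g' u = 0 → g u = 0 := by
  obtain ⟨e, he⟩ := exists_apply_eq_one hg0
  obtain ⟨χ, ψ, hχ, hχ0, hψ, hψ0, hdψ, hgψ, hψχ⟩ := hg.exists_straightening h0
    (j := ContinuousLinearMap.toSpanSingleton ℝ e) (fun y => by simp [he])
  set L := fderiv ℝ g u₀ with hL
  have hker : ∀ v, L v = 0 → fderiv ℝ g' u₀ v = 0 := fun v hv =>
    fderiv_eq_zero_of_zeroSet hg hg'.differentiableAt h0 hg0 h hv
  have hk : fderiv ℝ g' u₀ e ≠ 0 := by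
    intro hk
    apply hg0'
    ext v
    have := hker (v - L v • e) (by simp [he])
    rw [map_sub, map_smul, hk, smul_zero, sub_zero] at this
    simpa using this
  have hψt : Tendsto ψ (𝓝 0) (𝓝 u₀) := by
    have := hψ.continuousAt.tendsto; rwa [hψ0] at this
  have hcomp : SmoothNear (fun w => g' (ψ w)) 0 := hg'.comp_of_eq hψ hψ0
  have hstrict : HasStrictFDerivAt (fun w => g' (ψ w)) (fderiv ℝ g' u₀) 0 := by
    have h1 := hcomp.contDiffAt.hasStrictFDerivAt (by simp)
    have h2 : fderiv ℝ (fun w => g' (ψ w)) 0 = fderiv ℝ g' u₀ := by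
      rw [(hasFDerivAt_comp_of_eq hg'.differentiableAt.hasFDerivAt
        hψ.differentiableAt.hasFDerivAt hψ0).fderiv]
      ext v; simp [hdψ]
    rwa [h2] at h1
  -- `pr w` is the point of ker L on the line through `w` in the direction `e`. There g' ∘ ψ
  -- vanishes, and its derivative along `e` is not zero; strict differentiability, with an error of
  -- at most half that slope, excludes a second zero on the line.
  let pr : E → E := fun w => w - L w • e
  have hpr : Tendsto (fun w : E => (w, pr w)) (𝓝 0) (𝓝 (0, 0)) := by
    have : Continuous fun w : E => (w, pr w) := by fun_prop
    simpa [pr] using this.tendsto 0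
  have hLpr : ∀ w, L (pr w) = 0 := fun w => by simp [pr, he]
  have hb := (Asymptotics.isLittleO_iff.1 hstrict.isLittleO)
    (c := |fderiv ℝ g' u₀ e| / (2 * (‖e‖ + 1))) (by positivity)
  have hpr2 : Tendsto pr (𝓝 0) (𝓝 0) := by
    have : Continuous pr := by fun_prop
    simpa [pr] using this.tendsto 0
  have main : ∀ᶠ w in 𝓝 (0 : E), g' (ψ w) = 0 → L w = 0 := by
    filter_upwards [hpr.eventually hb, hpr2.eventually (hgψ.and (hψt.eventually h))] with w h1 h2 h3
    have h4 : g' (ψ (pr w)) = 0 := h2.2 (by rw [h2.1, hLpr])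
    have h5 : w - pr w = L w • e := by simp [pr]
    simp only [h3, h4, h5, map_smul, smul_eq_mul, sub_zero, zero_sub, norm_neg, norm_mul,
      norm_smul, Real.norm_eq_abs] at h1
    by_contra hne
    have h6 : 0 < |L w| := abs_pos.2 hne
    have h7 : 0 < |fderiv ℝ g' u₀ e| := abs_pos.2 hk
    have h8 : |fderiv ℝ g' u₀ e| / (2 * (‖e‖ + 1)) * (|L w| * ‖e‖) ≤
        |L w| * |fderiv ℝ g' u₀ e| / 2 := by
      rw [div_mul_eq_mul_div, div_le_div_iff₀ (by positivity) (by positivity)]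
      nlinarith [mul_pos h6 h7, norm_nonneg e]
    nlinarith [mul_pos h6 h7]
  have hχt : Tendsto χ (𝓝 u₀) (𝓝 0) := by
    have := hχ.continuousAt.tendsto; rwa [hχ0] at this
  filter_upwards [hψχ, hχt.eventually main, hχt.eventually hgψ] with u h1 h2 h3 h4
  rw [h1] at h2 h3
  rw [h3, h2 h4]

end ZeroSets

/-! ### From Legendrian curves to hypersurfaces; rank of integral maps -/

section Curves

variable {E F : Type*} [NormedAddCommGroup E] [NormedSpace ℝ E] [NormedAddCommGroup F]
  [NormedSpace ℝ F]

theorem smoothNear_iff {f : E → F} {z : E} :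
    SmoothNear f z ↔ ∃ I : Set E, IsOpen I ∧ z ∈ I ∧ ContDiffOn ℝ ∞ f I := by
  constructor
  · intro h
    obtain ⟨I, h1, h2, h3⟩ := eventually_nhds_iff.1 h
    exact ⟨I, h2, h3, fun y hy => (h1 y hy).contDiffWithinAt⟩
  · rintro ⟨I, h1, h2, h3⟩
    filter_upwards [h1.mem_nhds h2] with y hy using h3.contDiffAt (h1.mem_nhds hy)

theorem isLegendrianAt_iff {γ : ℝ → J1} {s₀ : ℝ} : IsLegendrianAt γ s₀ ↔ SmoothNear γ s₀ ∧
    ∀ᶠ s in 𝓝 s₀, deriv γ s ≠ 0 ∧ contactForm (γ s) (deriv γ s) = 0 := by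
  constructor
  · rintro ⟨I, h1, h2, h3, h4⟩
    exact ⟨smoothNear_iff.2 ⟨I, h1, h2, h3⟩, by filter_upwards [h1.mem_nhds h2] using h4⟩
  · rintro ⟨h1, h2⟩
    obtain ⟨I, h3, h4, h5⟩ := eventually_nhds_iff.1 (h1.and h2)
    exact ⟨I, h4, h5, fun s hs => (h3 s hs).1.contDiffWithinAt, fun s hs => (h3 s hs).2⟩

theorem contactForm_add (s v w : J1) :
    contactForm s (v + w) = contactForm s v + contactForm s w := by
  simp only [contactForm, Prod.snd_add, Prod.fst_add]; ring

theorem contactForm_smul (s : J1) (c : ℝ) (v : J1) :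
    contactForm s (c • v) = c * contactForm s v := by
  simp only [contactForm, Prod.smul_snd, Prod.smul_fst, smul_eq_mul]; ring

theorem linearIndependent_pair_iff {v w : F} : LinearIndependent ℝ ![v, w] ↔
    ∀ s t : ℝ, s • v + t • w = 0 → s = 0 ∧ t = 0 :=
  LinearIndependent.pair_iff

variable [FiniteDimensional ℝ E]

/-- The points that lie under the preimage of a transverse Legendrian curve form a hypersurface, on
which the parameter is a smooth function. -/
theorem exists_equation_of_legendrian {ρ : E × ℝ → J1} {Θ : E × ℝ → E →L[ℝ] ℝ} {u₀ : E} {l₀ : ℝ}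
    (hρ : SmoothNear ρ (u₀, l₀))
    (hcon : ∀ᶠ z in 𝓝 (u₀, l₀), ∃ r : ℝ, r ≠ 0 ∧ ∀ v τ,
      contactForm (ρ z) (fderiv ℝ ρ z (v, τ)) = r * Θ z v)
    {γ : ℝ → J1} (hγ : IsLegendrianAt γ 0) (hγ0 : γ 0 = ρ (u₀, l₀))
    (hind : LinearIndependent ℝ ![deriv γ 0, fderiv ℝ ρ (u₀, l₀) (0, 1)]) :
    ∃ g Λ S : E → ℝ, SmoothNear g u₀ ∧ g u₀ = 0 ∧ SmoothNear Λ u₀ ∧ Λ u₀ = l₀ ∧ SmoothNear S u₀ ∧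
      S u₀ = 0 ∧
      (∀ᶠ u in 𝓝 u₀, g u = 0 → ρ (u, Λ u) = γ (S u)) ∧
      (∀ᶠ u in 𝓝 u₀, g u = 0 → ∃ r : ℝ, r ≠ 0 ∧ ∀ v, fderiv ℝ g u v = r * Θ (u, Λ u) v) ∧
      ∀ᶠ p : (E × ℝ) × ℝ in 𝓝 ((u₀, l₀), 0), ρ p.1 = γ p.2 → g p.1.1 = 0 ∧ p.1.2 = Λ p.1.1 := by
  have : CompleteSpace E := FiniteDimensional.complete ℝ E
  obtain ⟨hγs, hγl⟩ := isLegendrianAt_iff.1 hγ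
  -- The equation ρ(u, λ) = γ(s) + g ∂_z is solved for (λ, s, g) as functions of u. It is regular
  -- because γ' and ρ_*∂_λ span the contact plane and ∂_z is transverse to it. The hypersurface is g
  -- = 0.
  let e : J1 := (0, 1, 0)
  have he : ∀ s, contactForm s e = 1 := fun s => by simp [contactForm, e]
  set e₁ := deriv γ 0 with he₁
  set e₂ := fderiv ℝ ρ (u₀, l₀) (0, 1) with he₂
  have hc1 : contactForm (ρ (u₀, l₀)) e₁ = 0 := hγ0 ▸ hγl.self_of_nhds.2
  have hc2 : contactForm (ρ (u₀, l₀)) e₂ = 0 := by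
    obtain ⟨r, -, hr⟩ := hcon.self_of_nhds
    rw [he₂, hr, map_zero, mul_zero]
  let A₀ : J1 →ₗ[ℝ] J1 :=
    { toFun := fun p => p.1 • e₂ - p.2.1 • e₁ - p.2.2 • e
      map_add' := fun p q => by
        simp only [Prod.fst_add, Prod.snd_add, add_smul]; abel
      map_smul' := fun c p => by
        simp only [Prod.smul_fst, Prod.smul_snd, smul_eq_mul, mul_smul, smul_sub,
          RingHom.id_apply] }
  have hA₀ : ∀ p, A₀ p = p.1 • e₂ - p.2.1 • e₁ - p.2.2 • e := fun _ => rfl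
  have hinj : Function.Injective A₀ := by
    rw [← LinearMap.ker_eq_bot, LinearMap.ker_eq_bot']
    rintro ⟨a, b, c⟩ h
    have h' : a • e₂ + (-b) • e₁ + (-c) • e = 0 := by
      rw [hA₀] at h; rw [← h]; simp only [neg_smul]; abel
    have hcc : c = 0 := by
      have := congrArg (contactForm (ρ (u₀, l₀))) h'
      simp only [contactForm_add, contactForm_smul, hc1, hc2, he] at this
      simp only [contactForm, Prod.snd_zero, Prod.fst_zero] at this
      linarith
    have h2 := (linearIndependent_pair_iff.1 hind) (-b) a (by
      rw [← h', hcc]; simp only [neg_zero, zero_smul]; abel)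
    simp [h2.2, neg_eq_zero.1 h2.1, hcc]
  let A : J1 ≃L[ℝ] J1 := (LinearEquiv.ofInjectiveEndo A₀ hinj).toContinuousLinearEquiv
  have hA : ∀ p, A p = p.1 • e₂ - p.2.1 • e₁ - p.2.2 • e := fun _ => rfl
  let Φ : E × J1 → J1 := fun p => ρ (p.1, p.2.1) - γ p.2.2.1 - p.2.2.2 • e
  let q₀ : J1 := (l₀, 0, 0)
  let i₁ : E × J1 →L[ℝ] E × ℝ := (ContinuousLinearMap.fst ℝ E J1).prod
    ((ContinuousLinearMap.fst ℝ ℝ (ℝ × ℝ)).comp (ContinuousLinearMap.snd ℝ E J1))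
  let i₂ : E × J1 →L[ℝ] ℝ := (ContinuousLinearMap.fst ℝ ℝ ℝ).comp
    ((ContinuousLinearMap.snd ℝ ℝ (ℝ × ℝ)).comp (ContinuousLinearMap.snd ℝ E J1))
  let i₃ : E × J1 →L[ℝ] ℝ := (ContinuousLinearMap.snd ℝ ℝ ℝ).comp
    ((ContinuousLinearMap.snd ℝ ℝ (ℝ × ℝ)).comp (ContinuousLinearMap.snd ℝ E J1))
  have hΦ : SmoothNear Φ (u₀, q₀) := by
    refine ((hρ.comp_of_eq (smoothNear_of_contDiff i₁.contDiff (u₀, q₀)) rfl).sub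
      (hγs.comp_of_eq (smoothNear_of_contDiff i₂.contDiff (u₀, q₀)) rfl)).sub ?_
    exact (smoothNear_of_contDiff i₃.contDiff _).smul (smoothNear_const e _)
  have hΦ0 : Φ (u₀, q₀) = 0 := by simp [Φ, q₀, hγ0]
  have hΦ' : ∀ v, fderiv ℝ Φ (u₀, q₀) (0, v) = A v := by
    intro v
    have h1 : HasFDerivAt (fun p => ρ (i₁ p)) _ (u₀, q₀) :=
      hasFDerivAt_comp_of_eq hρ.differentiableAt.hasFDerivAt i₁.hasFDerivAt rfl
    have h2 : HasFDerivAt (fun p => γ (i₂ p)) _ (u₀, q₀) :=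
      hasFDerivAt_comp_of_eq hγs.differentiableAt.hasFDerivAt i₂.hasFDerivAt rfl
    have h3 := (h1.sub h2).sub (i₃.hasFDerivAt.smul_const e)
    have h6 : HasFDerivAt Φ _ (u₀, q₀) := h3
    rw [h6.fderiv, hA]
    have h4 : fderiv ℝ ρ (u₀, l₀) (0, v.1) = v.1 • e₂ := by
      rw [he₂, ← map_smul]; simp
    have h5 : fderiv ℝ γ 0 v.2.1 = v.2.1 • e₁ := by
      rw [he₁, ← fderiv_apply_one_eq_deriv, ← map_smul]; simp
    simp [i₁, i₂, i₃, h4, h5]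
  obtain ⟨ψ, hψ, hψ0, hψz, hψu⟩ := hΦ.exists_implicit hΦ0 A hΦ'
  have hg : SmoothNear (fun u => (ψ u).2.2) u₀ := by
    filter_upwards [hψ] with u hu using (contDiff_snd.comp contDiff_snd).contDiffAt.comp u hu
  have hΛ : SmoothNear (fun u => (ψ u).1) u₀ := by
    filter_upwards [hψ] with u hu using contDiff_fst.contDiffAt.comp u hu
  have hS : SmoothNear (fun u => (ψ u).2.1) u₀ := by
    filter_upwards [hψ] with u hu using (contDiff_fst.comp contDiff_snd).contDiffAt.comp u hu
  have hlift : Tendsto (fun u => (u, (ψ u).1)) (𝓝 u₀) (𝓝 (u₀, l₀)) := by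
    have := continuousAt_id.prodMk hΛ.continuousAt
    simpa [ContinuousAt, hψ0, q₀] using this
  have hSt : Tendsto (fun u => (ψ u).2.1) (𝓝 u₀) (𝓝 0) := by
    have := hS.continuousAt
    simpa [ContinuousAt, hψ0, q₀] using this
  have hval : ∀ᶠ u in 𝓝 u₀, ρ (u, (ψ u).1) = γ (ψ u).2.1 + (ψ u).2.2 • e := by
    filter_upwards [hψz] with u hu
    simp only [Φ] at hu
    rw [← sub_eq_zero, ← hu]; abel
  refine ⟨fun u => (ψ u).2.2, fun u => (ψ u).1, fun u => (ψ u).2.1, hg, by simp [hψ0, q₀], hΛ,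
    by simp [hψ0, q₀], hS, by simp [hψ0, q₀], ?_, ?_, ?_⟩
  · filter_upwards [hval] with u hu h0
    simpa [h0] using hu
  · filter_upwards [hval.eventually_nhds, hlift.eventually hcon, hlift.eventually hρ,
      hSt.eventually hγs, hSt.eventually hγl, hg, hΛ, hS] with u h1 ⟨r, hr, hrv⟩ h3 h4 h5 h6 h7 h8 h0
    refine ⟨r, hr, fun v => ?_⟩
    have d6 := (h6.differentiableAt (by simp)).hasFDerivAt
    have d7 := (h7.differentiableAt (by simp)).hasFDerivAt
    have d8 := (h8.differentiableAt (by simp)).hasFDerivAt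
    have l1 : HasFDerivAt (fun u => ρ (u, (ψ u).1)) _ u :=
      hasFDerivAt_comp_of_eq (h3.differentiableAt (by simp)).hasFDerivAt
        ((hasFDerivAt_id u).prodMk d7) rfl
    have l2 : HasFDerivAt (fun u => γ (ψ u).2.1) _ u :=
      hasFDerivAt_comp_of_eq (h4.differentiableAt (by simp)).hasFDerivAt d8 rfl
    have l3 := (l2.add (d6.smul_const e)).congr_of_eventuallyEq h1
    have l4 := DFunLike.congr_fun (l1.unique l3) v
    -- The contact form is applied to the derivative of ρ(u, λ) = γ(s) + g ∂_z. Where g = 0, the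
    -- term with γ' drops out and r Θ = dg remains.
    have l5 := congrArg (contactForm (ρ (u, (ψ u).1))) l4
    have l6 : ρ (u, (ψ u).1) = γ (ψ u).2.1 := by
      have := h1.self_of_nhds
      simpa [h0] using this
    have l7 : fderiv ℝ γ (ψ u).2.1 (fderiv ℝ (fun u => (ψ u).2.1) u v) =
        (fderiv ℝ (fun u => (ψ u).2.1) u v) • deriv γ (ψ u).2.1 := by
      rw [← fderiv_apply_one_eq_deriv, ← map_smul]; simp
    simp only [ContinuousLinearMap.comp_apply, add_apply, ContinuousLinearMap.prod_apply,
      ContinuousLinearMap.id_apply, ContinuousLinearMap.smulRight_apply, contactForm_add,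
      contactForm_smul, he, l7] at l5
    rw [hrv] at l5
    rw [l6, h5.2, mul_zero, zero_add, mul_one] at l5
    exact l5.symm
  · have ht : Tendsto (fun p : (E × ℝ) × ℝ => (p.1.1, ((p.1.2, p.2, 0) : J1)))
        (𝓝 ((u₀, l₀), 0)) (𝓝 (u₀, q₀)) := by
      have : Continuous fun p : (E × ℝ) × ℝ => (p.1.1, ((p.1.2, p.2, 0) : J1)) := by fun_prop
      exact this.tendsto ((u₀, l₀), 0)
    filter_upwards [ht.eventually hψu] with p hp h
    have := hp (by simp [Φ, h])
    exact ⟨(congrArg (fun q : J1 => q.2.2) this).symm, congrArg (fun q : J1 => q.1) this⟩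

/-- A map to `J¹` that is tangent to the contact distribution has rank at most one: if a linear
combination of the coordinates `t` and `p` of the map is an affine function `c + L`, then the map
factors through `L`. -/
theorem eventually_eq_of_contact {q : E → J1} {L : E →L[ℝ] ℝ} {k : E} {α β c : ℝ}
    (hq : SmoothNear q 0) (hcon : ∀ᶠ w in 𝓝 0, ∀ v, contactForm (q w) (fderiv ℝ q w v) = 0)
    (hL : ∀ᶠ w in 𝓝 0, α * (q w).1 + β * (q w).2.2 = c + L w) (hk : L k = 1) :
    (∀ᶠ w in 𝓝 0, ∀ v, L v = 0 → fderiv ℝ q w v = 0) ∧ ∀ᶠ w in 𝓝 0, q w = q (L w • k) := by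
  let T : E → ℝ := fun w => (q w).1
  let X : E → ℝ := fun w => (q w).2.1
  let P : E → ℝ := fun w => (q w).2.2
  have hT : SmoothNear T 0 := by
    filter_upwards [hq] with w hw using contDiff_fst.contDiffAt.comp w hw
  have hX : SmoothNear X 0 := by
    filter_upwards [hq] with w hw using (contDiff_fst.comp contDiff_snd).contDiffAt.comp w hw
  have hP : SmoothNear P 0 := by
    filter_upwards [hq] with w hw using (contDiff_snd.comp contDiff_snd).contDiffAt.comp w hw
  have hqd : ∀ᶠ w in 𝓝 0, ∀ v, fderiv ℝ q w v =
      (fderiv ℝ T w v, fderiv ℝ X w v, fderiv ℝ P w v) := by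
    filter_upwards [hT, hX, hP] with w h1 h2 h3 v
    have := ((h1.differentiableAt (by simp)).hasFDerivAt.prodMk
      ((h2.differentiableAt (by simp)).hasFDerivAt.prodMk
        (h3.differentiableAt (by simp)).hasFDerivAt)).fderiv
    exact DFunLike.congr_fun this v
  have hX' : ∀ᶠ w in 𝓝 0, ∀ v, fderiv ℝ X w v = P w * fderiv ℝ T w v := by
    filter_upwards [hqd, hcon] with w h1 h2 v
    have := h2 v
    rw [h1] at this
    exact sub_eq_zero.1 this
  -- dX = P dT and the symmetry of D²X give dP ∧ dT = 0.
  have hsymm : ∀ᶠ w in 𝓝 0, ∀ u v, fderiv ℝ P w u * fderiv ℝ T w v =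
      fderiv ℝ P w v * fderiv ℝ T w u := by
    filter_upwards [hX'.eventually_nhds, hX.eventually_nhds, hT.eventually_nhds, hP]
      with w h1 h2 h3 h4 u v
    have hdd : ∀ u v, fderiv ℝ (fderiv ℝ X) w u v =
        P w * fderiv ℝ (fderiv ℝ T) w u v + fderiv ℝ T w v * fderiv ℝ P w u := by
      intro u v
      have e1 := h2.fderiv_right.differentiableAt.hasFDerivAt.clm_apply (hasFDerivAt_const v w)
      have e2 := (h4.differentiableAt (by simp)).hasFDerivAt.mul
        (h3.fderiv_right.differentiableAt.hasFDerivAt.clm_apply (hasFDerivAt_const v w))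
      have e3 := e2.congr_of_eventuallyEq (h1.mono fun y hy => hy v)
      have := DFunLike.congr_fun (e1.unique e3) u
      simpa using this
    have e4 := h2.fderiv_fderiv_comm u v
    rw [hdd, hdd, h3.fderiv_fderiv_comm u v] at e4
    linarith
  have hLd : ∀ᶠ w in 𝓝 0, ∀ v, α * fderiv ℝ T w v + β * fderiv ℝ P w v = L v := by
    filter_upwards [hL.eventually_nhds, hT, hP] with w h1 h2 h3 v
    have e1 := ((h2.differentiableAt (by simp)).hasFDerivAt.const_mul α).add
      ((h3.differentiableAt (by simp)).hasFDerivAt.const_mul β)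
    have e2 := (L.hasFDerivAt (x := w)).const_add c |>.congr_of_eventuallyEq h1
    have := DFunLike.congr_fun (e1.unique e2) v
    simpa using this
  -- As dT and dP are dependent and α dT + β dP = L ≠ 0, both are multiples of L.
  have hzero : ∀ᶠ w in 𝓝 0, ∀ v, L v = 0 → fderiv ℝ q w v = 0 := by
    filter_upwards [hqd, hX', hsymm, hLd] with w h1 h2 h3 h4 v hv
    have e1 := h4 v
    have e2 := h4 k
    have e3 := h3 v k
    rw [hv] at e1
    rw [hk] at e2
    have e4 : fderiv ℝ T w v = 0 := by
      linear_combination (-(fderiv ℝ T w v)) * e2 + β * (-e3) + fderiv ℝ T w k * e1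
    have e5 : fderiv ℝ P w v = 0 := by
      linear_combination (-(fderiv ℝ P w v)) * e2 + α * e3 + fderiv ℝ P w k * e1
    rw [h1, h2, e4, e5, mul_zero]
    rfl
  refine ⟨hzero, ?_⟩
  obtain ⟨ε, hε, hb⟩ := Metric.eventually_nhds_iff_ball.1 (hzero.and hq)
  have hc : Tendsto (fun w : E => L w • k) (𝓝 0) (𝓝 0) := by
    have : Continuous fun w : E => L w • k := by fun_prop
    simpa using this.tendsto 0
  filter_upwards [Metric.ball_mem_nhds 0 hε, hc (Metric.ball_mem_nhds 0 hε)] with w h1 h2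
  -- The segment from `w` to L(w) k has its direction in ker L, so `q` is constant on it.
  have hseg : ∀ s ∈ Set.Icc (0 : ℝ) 1, w + s • (L w • k - w) ∈ Metric.ball (0 : E) ε := fun s hs =>
    (convex_ball (0 : E) ε).add_smul_sub_mem h1 h2 hs
  have hder : ∀ s ∈ Set.Icc (0 : ℝ) 1,
      HasDerivAt (fun s : ℝ => q (w + s • (L w • k - w))) 0 s := by
    intro s hs
    have e1 : HasDerivAt (fun s : ℝ => w + s • (L w • k - w)) (L w • k - w) s := by
      simpa using ((hasDerivAt_id s).smul_const (L w • k - w)).const_add w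
    obtain ⟨e2, e3⟩ := hb _ (hseg s hs)
    have e4 := (e3.differentiableAt (by simp)).hasFDerivAt.comp_hasDerivAt s e1
    rwa [e2 _ (by simp [hk])] at e4
  have := constant_of_has_deriv_right_zero (fun s hs => (hder s hs).continuousAt.continuousWithinAt)
    (fun s hs => (hder s ⟨hs.1, hs.2.le⟩).hasDerivWithinAt) 1 (by simp)
  simpa using this.symm

end Curves

/-! ### From hypersurfaces to Legendrian curves -/

section Curves

variable {E : Type*} [NormedAddCommGroup E] [NormedSpace ℝ E] [FiniteDimensional ℝ E]

/-- A hypersurface whose tangent spaces are the kernels of `Θ(u, l u)` lies over a transverse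
Legendrian curve. -/
theorem exists_legendrian_of_equation {ρ : E × ℝ → J1} {Θ : E × ℝ → E →L[ℝ] ℝ} {u₀ : E} {l₀ : ℝ}
    (hρ : SmoothNear ρ (u₀, l₀)) (hsurj : Function.Surjective (fderiv ℝ ρ (u₀, l₀)))
    (hcon : ∀ᶠ z in 𝓝 (u₀, l₀), ∃ r : ℝ, r ≠ 0 ∧ ∀ v τ,
      contactForm (ρ z) (fderiv ℝ ρ z (v, τ)) = r * Θ z v)
    {g l : E → ℝ} (hg : SmoothNear g u₀) (hg0 : g u₀ = 0) (hdg : fderiv ℝ g u₀ ≠ 0)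
    (hl : SmoothNear l u₀) (hl0 : l u₀ = l₀)
    (hgl : ∀ᶠ u in 𝓝 u₀, g u = 0 → ∃ k : ℝ, k ≠ 0 ∧ ∀ v, fderiv ℝ g u v = k * Θ (u, l u) v) :
    ∃ γ : ℝ → J1, IsLegendrianAt γ 0 ∧ γ 0 = ρ (u₀, l₀) ∧
      LinearIndependent ℝ ![deriv γ 0, fderiv ℝ ρ (u₀, l₀) (0, 1)] ∧
      ∃ S : E → ℝ, ContinuousAt S u₀ ∧ S u₀ = 0 ∧
        ∀ᶠ u in 𝓝 u₀, g u = 0 → ρ (u, l u) = γ (S u) := by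
  have : CompleteSpace E := FiniteDimensional.complete ℝ E
  obtain ⟨e, he⟩ := exists_apply_eq_one hdg
  let R : E → J1 := fun u => ρ (u, l u)
  have hlift : SmoothNear (fun u => (u, l u)) u₀ :=
    (smoothNear_of_contDiff contDiff_id u₀).prodMk hl
  have hlift0 : (u₀, l u₀) = (u₀, l₀) := by rw [hl0]
  have hR : SmoothNear R u₀ := hρ.comp_of_eq hlift hlift0
  have hlt : Tendsto (fun u => (u, l u)) (𝓝 u₀) (𝓝 (u₀, l₀)) := by
    have := hlift.continuousAt.tendsto
    rwa [hlift0] at this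
  have hR' : ∀ᶠ u in 𝓝 u₀, ∀ v, fderiv ℝ R u v = fderiv ℝ ρ (u, l u) (v, fderiv ℝ l u v) := by
    filter_upwards [hlt.eventually hρ, hl] with u h1 h2 v
    have : HasFDerivAt R _ u := hasFDerivAt_comp_of_eq (h1.differentiableAt (by simp)).hasFDerivAt
      ((hasFDerivAt_id u).prodMk (h2.differentiableAt (by simp)).hasFDerivAt) rfl
    rw [this.fderiv]; rfl
  have hRc : ∀ᶠ u in 𝓝 u₀, g u = 0 → ∀ v, fderiv ℝ g u v = 0 →
      contactForm (R u) (fderiv ℝ R u v) = 0 := by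
    filter_upwards [hR', hgl, hlt.eventually hcon] with u h1 h2 ⟨r, _, h3⟩ h4 v h5
    obtain ⟨k, hk, h6⟩ := h2 h4
    rw [h1, h3]
    rw [h6] at h5
    rw [(mul_eq_zero.1 h5).resolve_left hk, mul_zero]
  -- The tangent space of the lift, ∂_λ and (e, 0) span E × ℝ, and dρ is onto. With a = 0 this shows
  -- that R does not have rank zero on the hypersurface; with a = γ'(0) it shows that γ is
  -- transverse.
  have hind : ∀ a : J1, (∀ v, fderiv ℝ g u₀ v = 0 → ∃ s : ℝ, fderiv ℝ R u₀ v = s • a) →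
      LinearIndependent ℝ ![a, fderiv ℝ ρ (u₀, l₀) (0, 1), fderiv ℝ ρ (u₀, l₀) (e, 0)] := by
    intro a ha
    refine linearIndependent_of_top_le_span_of_card_eq_finrank ?_ (by simp)
    intro y _
    obtain ⟨⟨v, τ⟩, rfl⟩ := hsurj y
    set v' := v - fderiv ℝ g u₀ v • e with hv'
    obtain ⟨s, hs⟩ := ha v' (by simp [hv', he])
    rw [hR'.self_of_nhds, hl0] at hs
    have hdec : fderiv ℝ ρ (u₀, l₀) (v, τ) = s • a +
        (τ - fderiv ℝ l u₀ v') • fderiv ℝ ρ (u₀, l₀) (0, 1) +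
        fderiv ℝ g u₀ v • fderiv ℝ ρ (u₀, l₀) (e, 0) := by
      rw [← hs, ← map_smul, ← map_smul, ← map_add, ← map_add]
      congr 1
      ext1 <;> simp [hv']
    rw [hdec]
    refine Submodule.add_mem _ (Submodule.add_mem _ ?_ ?_) ?_ <;>
      refine Submodule.smul_mem _ _ (Submodule.subset_span ?_)
    · exact ⟨0, rfl⟩
    · exact ⟨1, rfl⟩
    · exact ⟨2, rfl⟩
  obtain ⟨v, hv, α, β, hαβ⟩ : ∃ v, fderiv ℝ g u₀ v = 0 ∧ ∃ α β : ℝ,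
      α * (fderiv ℝ R u₀ v).1 + β * (fderiv ℝ R u₀ v).2.2 = 1 := by
    by_contra! hno
    refine (hind 0 fun v hv => ⟨0, ?_⟩).ne_zero 0 rfl
    have h1 : (fderiv ℝ R u₀ v).1 = 0 := by
      by_contra h
      exact hno v hv (fderiv ℝ R u₀ v).1⁻¹ 0 (by field_simp; simp)
    have h2 : (fderiv ℝ R u₀ v).2.2 = 0 := by
      by_contra h
      exact hno v hv 0 (fderiv ℝ R u₀ v).2.2⁻¹ (by field_simp; simp)
    have h3 := hRc.self_of_nhds hg0 v hv
    simp only [contactForm, h1, mul_zero, sub_zero] at h3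
    rw [smul_zero]
    exact Prod.ext h1 (Prod.ext h3 h2)
  let ℓ : J1 →L[ℝ] ℝ := α • ContinuousLinearMap.fst ℝ ℝ (ℝ × ℝ) +
    β • (ContinuousLinearMap.snd ℝ ℝ ℝ).comp (ContinuousLinearMap.snd ℝ ℝ (ℝ × ℝ))
  have hℓ : ∀ y, ℓ y = α * y.1 + β * y.2.2 := fun y => rfl
  set L : E →L[ℝ] ℝ := ℓ.comp (fderiv ℝ R u₀) with hLdef
  have hLv : L v = 1 := hαβ
  -- Coordinates are chosen that make both the hypersurface and the curve parameter ℓ ∘ R linear.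
  let f : E → ℝ × ℝ := fun u => (g u, ℓ (R u) - ℓ (R u₀))
  have hf : SmoothNear f u₀ :=
    hg.prodMk (((smoothNear_const ℓ u₀).clm_apply hR).sub (smoothNear_const _ u₀))
  have hf0 : f u₀ = 0 := by simp [f, hg0]
  have hf' : ∀ w, fderiv ℝ f u₀ w = (fderiv ℝ g u₀ w, L w) := by
    intro w
    have : HasFDerivAt f _ u₀ := hg.differentiableAt.hasFDerivAt.prodMk
      ((hasFDerivAt_comp_of_eq ℓ.hasFDerivAt hR.differentiableAt.hasFDerivAt rfl).sub_const _)
    rw [this.fderiv]; rfl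
  let e₁ : E := e - L e • v
  have hge₁ : fderiv ℝ g u₀ e₁ = 1 := by simp [e₁, he, hv]
  have hLe₁ : L e₁ = 0 := by simp [e₁, hLv]
  let j : ℝ × ℝ →L[ℝ] E := (ContinuousLinearMap.fst ℝ ℝ ℝ).smulRight e₁ +
    (ContinuousLinearMap.snd ℝ ℝ ℝ).smulRight v
  have hj : ∀ y, fderiv ℝ f u₀ (j y) = y := by
    intro y
    rw [hf']
    simp [j, hge₁, hLe₁, hv, hLv]
  obtain ⟨χ, ψ, hχ, hχ0, hψ, hψ0, hdψ, hfψ, hψχ⟩ := hf.exists_straightening hf0 hj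
  -- Projecting along `e₁` extends R from the straightened hypersurface to a map `q` that is tangent
  -- to the contact distribution near 0 in all of `E`. Since e₁ ∈ ker L, the parameter is
  -- unaffected.
  let pr : E →L[ℝ] E := ContinuousLinearMap.id ℝ E - (fderiv ℝ g u₀).smulRight e₁
  have hpr : ∀ w, pr w = w - fderiv ℝ g u₀ w • e₁ := fun w => rfl
  have hgpr : ∀ w, fderiv ℝ g u₀ (pr w) = 0 := fun w => by simp [hpr, hge₁]
  have hLpr : ∀ w, L (pr w) = L w := fun w => by simp [hpr, hLe₁]
  let q : E → J1 := fun w => R (ψ (pr w))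
  have hprs : SmoothNear (fun w => pr w) 0 := smoothNear_of_contDiff pr.contDiff 0
  have hψpr : SmoothNear (fun w => ψ (pr w)) 0 := hψ.comp_of_eq hprs (map_zero pr)
  have hψpr0 : ψ (pr 0) = u₀ := by rw [map_zero, hψ0]
  have hq : SmoothNear q 0 := hR.comp_of_eq hψpr hψpr0
  have hprt : Tendsto pr (𝓝 0) (𝓝 0) := by
    have := pr.continuous.tendsto 0; rwa [map_zero] at this
  have hψt : Tendsto (fun w => ψ (pr w)) (𝓝 0) (𝓝 u₀) := by
    have := hψpr.continuousAt.tendsto; rwa [hψpr0] at this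
  have hq' : ∀ᶠ w in 𝓝 0, ∀ x, fderiv ℝ q w x =
      fderiv ℝ R (ψ (pr w)) (fderiv ℝ ψ (pr w) (pr x)) := by
    filter_upwards [hψt.eventually hR, hprt.eventually hψ] with w h1 h2 x
    have h3 : HasFDerivAt (fun w => ψ (pr w)) _ w :=
      hasFDerivAt_comp_of_eq (h2.differentiableAt (by simp)).hasFDerivAt pr.hasFDerivAt rfl
    have h4 : HasFDerivAt q _ w :=
      hasFDerivAt_comp_of_eq (h1.differentiableAt (by simp)).hasFDerivAt h3 rfl
    rw [h4.fderiv]; rfl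
  have hgψ : ∀ᶠ w in 𝓝 0, g (ψ w) = fderiv ℝ g u₀ w := by
    filter_upwards [hfψ] with w hw
    rw [hf'] at hw
    exact congrArg Prod.fst hw
  have hqc : ∀ᶠ w in 𝓝 0, ∀ x, contactForm (q w) (fderiv ℝ q w x) = 0 := by
    filter_upwards [hq', hψt.eventually hRc, hprt.eventually hgψ.eventually_nhds,
      hψt.eventually hg, hprt.eventually hψ] with w h1 h2 h3 h4 h5 x
    rw [h1]
    refine h2 (by rw [h3.self_of_nhds, hgpr]) _ ?_
    have h6 := hasFDerivAt_comp_of_eq (h4.differentiableAt (by simp)).hasFDerivAt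
      (h5.differentiableAt (by simp)).hasFDerivAt rfl
    have h7 := (fderiv ℝ g u₀).hasFDerivAt (x := pr w) |>.congr_of_eventuallyEq h3
    rw [← hgpr x]
    exact DFunLike.congr_fun (h6.unique h7) (pr x)
  have hqL : ∀ᶠ w in 𝓝 0, α * (q w).1 + β * (q w).2.2 = ℓ (R u₀) + L w := by
    filter_upwards [hprt.eventually hfψ] with w hw
    rw [hf'] at hw
    have : ℓ (q w) - ℓ (R u₀) = L (pr w) := congrArg Prod.snd hw
    rw [hLpr] at this
    rw [← this, ← hℓ]; ring
  obtain ⟨hq0, hqk⟩ := eventually_eq_of_contact hq hqc hqL hLv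
  have hst : Tendsto (fun s : ℝ => s • v) (𝓝 0) (𝓝 0) := by
    have : Continuous fun s : ℝ => s • v := by fun_prop
    simpa using this.tendsto 0
  have hγd : ∀ᶠ s : ℝ in 𝓝 0, HasDerivAt (fun s : ℝ => q (s • v)) (fderiv ℝ q (s • v) v) s := by
    filter_upwards [hst.eventually hq] with s hs
    exact hasDerivAt_comp_smul (hs.differentiableAt (by simp)).hasFDerivAt
  have hprv : pr v = v := by simp [hpr, hv]
  have hγ0 : deriv (fun s : ℝ => q (s • v)) 0 = fderiv ℝ R u₀ v := by
    rw [hγd.self_of_nhds.deriv, zero_smul, hq'.self_of_nhds, hψpr0, map_zero, hdψ, hprv]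
  have hu₀ : R u₀ = ρ (u₀, l₀) := by simp only [R, hl0]
  refine ⟨fun s => q (s • v), isLegendrianAt_iff.2 ⟨?_, ?_⟩, ?_, ?_,
    fun u => ℓ (R u) - ℓ (R u₀), ?_, sub_self _, ?_⟩
  · exact hq.comp_of_eq (smoothNear_of_contDiff (by fun_prop) 0) (zero_smul ℝ v)
  · have hc : ContinuousAt (fun s : ℝ => fderiv ℝ q (s • v) v) 0 :=
      ((hq.fderiv_right.clm_apply (smoothNear_const v 0)).comp_of_eq
        (smoothNear_of_contDiff (by fun_prop : ContDiff ℝ ∞ fun s : ℝ => s • v) 0)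
        (zero_smul ℝ v)).continuousAt
    have hne : fderiv ℝ q ((0 : ℝ) • v) v ≠ 0 := by
      rw [← hγd.self_of_nhds.deriv, hγ0]
      intro h
      rw [h] at hαβ
      simp at hαβ
    filter_upwards [hγd, hst.eventually hqc, hc.eventually_ne hne] with s h1 h2 h3
    rw [h1.deriv]
    exact ⟨h3, h2 v⟩
  · simp only [zero_smul, q, hψpr0, hu₀]
  · have h3 := hind (deriv (fun s : ℝ => q (s • v)) 0) fun w hw => ⟨L w, by
      have h1 := hq0.self_of_nhds (w - L w • v) (by simp [hLv])
      rw [map_sub, map_smul, sub_eq_zero, hq'.self_of_nhds, hq'.self_of_nhds, hψpr0, map_zero, hdψ,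
        hdψ, hprv, ← hγ0] at h1
      rw [← h1, hpr, hw]; simp⟩
    rw [linearIndependent_pair_iff]
    intro s t hst0
    have h4 := Fintype.linearIndependent_iff.1 h3 ![s, t, 0]
      (by simpa [Fin.sum_univ_succ] using hst0)
    exact ⟨h4 0, h4 1⟩
  · exact (ℓ.continuous.continuousAt.comp hR.continuousAt).sub continuousAt_const
  · have hχt : Tendsto χ (𝓝 u₀) (𝓝 0) := by
      have := hχ.continuousAt.tendsto; rwa [hχ0] at this
    filter_upwards [hψχ, hχt.eventually hqk, hχt.eventually hfψ] with u h1 h2 h3 h4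
    rw [h1, hf'] at h3
    have h5 : fderiv ℝ g u₀ (χ u) = 0 := by
      rw [← h4]; exact (congrArg Prod.fst h3).symm
    have h6 : L (χ u) = ℓ (R u) - ℓ (R u₀) := (congrArg Prod.snd h3).symm
    rw [h6] at h2
    rw [← h2]
    simp only [q, hpr, h5, zero_smul, sub_zero, h1, R]

end Curves

/-! ### One-forms and derivatives in a chart -/

section Charts

variable {n : ℕ} {M : Type*} [TopologicalSpace M] [ChartedSpace (Model n) M]
  [IsManifold (𝓡 n) ∞ M]

/-- The chart at `x₀`, as a map to the model space. -/
noncomputable abbrev chartMap (n : ℕ) {M : Type*} [TopologicalSpace M]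
    [ChartedSpace (Model n) M] (x₀ : M) : PartialEquiv M (Model n) := extChartAt (𝓡 n) x₀

/-- The differential of the chart at `x₀`. -/
noncomputable def chartDeriv (n : ℕ) {M : Type*} [TopologicalSpace M]
    [ChartedSpace (Model n) M] (x₀ y : M) : TangentSpace (𝓡 n) y →L[ℝ] Model n :=
  mfderiv (𝓡 n) 𝓘(ℝ, Model n) (chartMap n x₀) y

/-- The expression of a one-form in the chart at `x₀`. -/
noncomputable def localForm (n : ℕ) {M : Type*} [TopologicalSpace M]
    [ChartedSpace (Model n) M] [IsManifold (𝓡 n) ∞ M] (x₀ : M) (ξ : (x : M) → Cotangent n x) (u : Model n) :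
    Model n →L[ℝ] ℝ :=
  ContinuousLinearMap.inCoordinates (Model n) (TangentSpace (𝓡 n) : M → Type _) ℝ
    (Bundle.Trivial M ℝ) x₀ ((chartMap n x₀).symm u) x₀ ((chartMap n x₀).symm u)
    (ξ ((chartMap n x₀).symm u))

variable {x₀ y : M}

theorem chartMap_source_mem_nhds (hy : y ∈ (chartMap n x₀).source) :
    (chartMap n x₀).source ∈ 𝓝 y :=
  (isOpen_extChartAt_source x₀).mem_nhds hy

theorem continuousAt_chartMap (hy : y ∈ (chartMap n x₀).source) :
    ContinuousAt (chartMap n x₀) y :=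
  continuousAt_extChartAt' hy

theorem continuousAt_chartMap_symm (hy : y ∈ (chartMap n x₀).source) :
    Tendsto (chartMap n x₀).symm (𝓝 (chartMap n x₀ y)) (𝓝 y) := by
  have := continuousAt_extChartAt_symm' (I := 𝓡 n) hy
  rw [ContinuousAt, (chartMap n x₀).left_inv hy] at this
  exact this

theorem eventually_mem_target (hy : y ∈ (chartMap n x₀).source) :
    ∀ᶠ u in 𝓝 (chartMap n x₀ y), u ∈ (chartMap n x₀).target :=
  (isOpen_extChartAt_target x₀).mem_nhds ((chartMap n x₀).map_source hy)

theorem contMDiffAt_chartMap (hy : y ∈ (chartMap n x₀).source) :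
    ContMDiffAt (𝓡 n) 𝓘(ℝ, Model n) ∞ (chartMap n x₀) y :=
  contMDiffAt_extChartAt' (by rwa [extChartAt_source] at hy)

theorem hasMFDerivAt_chartMap (hy : y ∈ (chartMap n x₀).source) :
    HasMFDerivAt (𝓡 n) 𝓘(ℝ, Model n) (chartMap n x₀) y (chartDeriv n x₀ y) :=
  ((contMDiffAt_chartMap hy).mdifferentiableAt (by simp)).hasMFDerivAt

theorem chartDeriv_bijective (hy : y ∈ (chartMap n x₀).source) :
    Function.Bijective (chartDeriv n x₀ y) := by
  obtain ⟨e, he⟩ := isInvertible_mfderiv_extChartAt (I := 𝓡 n) hy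
  have : ⇑(chartDeriv n x₀ y) = e := by
    rw [chartDeriv, ← he]; rfl
  rw [this]
  exact e.bijective

/-- Over the chart domain the trivialisation of the tangent bundle is the differential of the chart,
which cancels against the inverse trivialisation in `inCoordinates`. -/
theorem localForm_apply (hy : y ∈ (chartMap n x₀).source)
    (ξ : (x : M) → Cotangent n x) (v : TangentSpace (𝓡 n) y) :
    localForm n x₀ ξ (chartMap n x₀ y) (chartDeriv n x₀ y v) = ξ y v := by
  have hy' : y ∈ (chartAt (Model n) x₀).source := by rwa [extChartAt_source] at hy
  have hb : y ∈ (trivializationAt (Model n) (TangentSpace (𝓡 n) : M → Type _) x₀).baseSet := hy'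
  rw [localForm, (chartMap n x₀).left_inv hy, chartDeriv,
    ← TangentBundle.continuousLinearMapAt_trivializationAt hy']
  simp only [ContinuousLinearMap.inCoordinates, ContinuousLinearMap.comp_apply]
  rw [Bundle.Trivialization.symmL_continuousLinearMapAt _ hb]
  simp

theorem smoothNear_localForm {ξ : (x : M) → Cotangent n x} {U : Set M} (hU : IsOpen U)
    (hξ : ContMDiffOn (𝓡 n) ((𝓡 n).prod 𝓘(ℝ, Model n →L[ℝ] ℝ)) ∞
      (fun x => Bundle.TotalSpace.mk' (Model n →L[ℝ] ℝ)
        (E := fun x : M => TangentSpace (𝓡 n) x →L[ℝ] Bundle.Trivial M ℝ x) x (ξ x)) U)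
    (hyU : y ∈ U) (hy : y ∈ (chartMap n x₀).source) :
    SmoothNear (localForm n x₀ ξ) (chartMap n x₀ y) := by
  filter_upwards [eventually_mem_target hy, continuousAt_chartMap_symm hy (hU.mem_nhds hyU)]
    with u hu huU
  have hs : (chartMap n x₀).symm u ∈ (chartMap n x₀).source := (chartMap n x₀).map_target hu
  have h1 := hξ.contMDiffAt (hU.mem_nhds huU)
  let e := trivializationAt (Model n →L[ℝ] ℝ)
    (fun x : M => TangentSpace (𝓡 n) x →L[ℝ] Bundle.Trivial M ℝ x) x₀
  have h2 := ((e.contMDiffAt_iff (IB := 𝓡 n) (by simpa [e] using hs)).1 h1).2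
  have h3 : ContMDiffAt 𝓘(ℝ, Model n) (𝓡 n) ∞ (chartMap n x₀).symm u :=
    (contMDiffOn_extChartAt_symm x₀).contMDiffAt ((isOpen_extChartAt_target x₀).mem_nhds hu)
  exact (ContMDiffAt.comp u h2 h3).contDiffAt

theorem smoothNear_comp_chartMap_symm {F : Type*} [NormedAddCommGroup F] [NormedSpace ℝ F]
    {g : M → F} {U : Set M} (hU : IsOpen U) (hg : ContMDiffOn (𝓡 n) 𝓘(ℝ, F) ∞ g U)
    (hyU : y ∈ U) (hy : y ∈ (chartMap n x₀).source) :
    SmoothNear (fun u => g ((chartMap n x₀).symm u)) (chartMap n x₀ y) := by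
  filter_upwards [eventually_mem_target hy, continuousAt_chartMap_symm hy (hU.mem_nhds hyU)]
    with u hu huU
  have h3 : ContMDiffAt 𝓘(ℝ, Model n) (𝓡 n) ∞ (chartMap n x₀).symm u :=
    (contMDiffOn_extChartAt_symm x₀).contMDiffAt ((isOpen_extChartAt_target x₀).mem_nhds hu)
  exact (ContMDiffAt.comp u (hg.contMDiffAt (hU.mem_nhds huU)) h3).contDiffAt

theorem mfderiv_comp_chartMap {F : Type*} [NormedAddCommGroup F] [NormedSpace ℝ F]
    {g : Model n → F} (hy : y ∈ (chartMap n x₀).source)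
    (hg : DifferentiableAt ℝ g (chartMap n x₀ y)) (v : TangentSpace (𝓡 n) y) :
    mfderiv (𝓡 n) 𝓘(ℝ, F) (fun y => g (chartMap n x₀ y)) y v =
      fderiv ℝ g (chartMap n x₀ y) (chartDeriv n x₀ y v) := by
  have := (HasMFDerivAt.comp y hg.hasFDerivAt.hasMFDerivAt (hasMFDerivAt_chartMap hy)).mfderiv
  exact DFunLike.congr_fun this v

theorem mfderiv_eq_fderiv {F : Type*} [NormedAddCommGroup F] [NormedSpace ℝ F]
    {g : M → F} (hy : y ∈ (chartMap n x₀).source)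
    (hg : DifferentiableAt ℝ (fun u => g ((chartMap n x₀).symm u)) (chartMap n x₀ y))
    (v : TangentSpace (𝓡 n) y) :
    mfderiv (𝓡 n) 𝓘(ℝ, F) g y v =
      fderiv ℝ (fun u => g ((chartMap n x₀).symm u)) (chartMap n x₀ y) (chartDeriv n x₀ y v) := by
  rw [← mfderiv_comp_chartMap hy hg]
  have : g =ᶠ[𝓝 y] fun y => g ((chartMap n x₀).symm (chartMap n x₀ y)) := by
    filter_upwards [chartMap_source_mem_nhds hy] with z hz
    rw [(chartMap n x₀).left_inv hz]
  exact DFunLike.congr_fun this.mfderiv_eq v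

theorem contMDiffAt_comp_chartMap {F : Type*} [NormedAddCommGroup F] [NormedSpace ℝ F]
    {g : Model n → F} (hy : y ∈ (chartMap n x₀).source)
    (hg : ContDiffAt ℝ ∞ g (chartMap n x₀ y)) :
    ContMDiffAt (𝓡 n) 𝓘(ℝ, F) ∞ (fun y => g (chartMap n x₀ y)) y :=
  ContMDiffAt.comp y hg.contMDiffAt (contMDiffAt_chartMap hy)

theorem contMDiffAt_comp_chartMap_prod {ρ : Model n × ℝ → J1} {c : M × ℝ}
    (hc : c.1 ∈ (chartMap n x₀).source) (hρ : ContDiffAt ℝ ∞ ρ (chartMap n x₀ c.1, c.2)) :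
    ContMDiffAt ((𝓡 n).prod 𝓘(ℝ, ℝ)) 𝓘(ℝ, J1) ∞ (fun c : M × ℝ => ρ (chartMap n x₀ c.1, c.2)) c := by
  have h1 : ContMDiffAt ((𝓡 n).prod 𝓘(ℝ, ℝ)) 𝓘(ℝ, Model n × ℝ) ∞
      (fun c : M × ℝ => (chartMap n x₀ c.1, c.2)) c :=
    ((contMDiffAt_chartMap hc).comp c contMDiffAt_fst).prodMk_space contMDiffAt_snd
  exact ContMDiffAt.comp c hρ.contMDiffAt h1

theorem diff_comp_chartMap {ρ : Model n × ℝ → J1} {c : M × ℝ}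
    (hc : c.1 ∈ (chartMap n x₀).source) (hρ : DifferentiableAt ℝ ρ (chartMap n x₀ c.1, c.2))
    (v : TangentSpace (𝓡 n) c.1) (τ : ℝ) :
    diff (fun c : M × ℝ => ρ (chartMap n x₀ c.1, c.2)) c v τ =
      fderiv ℝ ρ (chartMap n x₀ c.1, c.2) (chartDeriv n x₀ c.1 v, τ) := by
  have h0 : HasMFDerivAt ((𝓡 n).prod 𝓘(ℝ, ℝ)) 𝓘(ℝ, Model n)
      (fun c : M × ℝ => chartMap n x₀ c.1) c
      ((chartDeriv n x₀ c.1).comp (ContinuousLinearMap.fst ℝ (TangentSpace (𝓡 n) c.1) ℝ)) :=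
    HasMFDerivAt.comp c (hasMFDerivAt_chartMap hc) (hasMFDerivAt_fst c)
  have h0' : HasMFDerivAt ((𝓡 n).prod 𝓘(ℝ, ℝ)) 𝓘(ℝ, ℝ) (fun c : M × ℝ => c.2) c
      (ContinuousLinearMap.snd ℝ (TangentSpace (𝓡 n) c.1) ℝ) := hasMFDerivAt_snd c
  have h1 : HasMFDerivAt ((𝓡 n).prod 𝓘(ℝ, ℝ)) 𝓘(ℝ, Model n × ℝ)
      (fun c : M × ℝ => (chartMap n x₀ c.1, c.2)) c
      (((chartDeriv n x₀ c.1).comp (ContinuousLinearMap.fst ℝ (TangentSpace (𝓡 n) c.1) ℝ)).prod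
        (ContinuousLinearMap.snd ℝ (TangentSpace (𝓡 n) c.1) ℝ)) :=
    ⟨h0.1.prodMk h0'.1, h0.2.prodMk h0'.2⟩
  have h2 := (HasMFDerivAt.comp c hρ.hasFDerivAt.hasMFDerivAt h1).mfderiv
  exact DFunLike.congr_fun h2 (v, τ)

end Charts

/-! ### The action of parameter changes on adapted coframes -/

section Coframes

variable {n : ℕ} {M : Type*} [TopologicalSpace M] [ChartedSpace (Model n) M]
  [IsManifold (𝓡 n) ∞ M]

/-- A change of the coframe by constants that amounts to a change of the parameter `(a : b)`. -/
theorem IsAdaptedCoframe.change {cone : (x : M) → Set (Cotangent n x)} {U : Set M}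
    {θ : Fin n → (x : M) → Cotangent n x} (h : IsAdaptedCoframe cone U θ) (C : Fin n → Fin n → ℝ)
    (hC : ∀ c : Fin n → ℝ, (∀ j, ∑ i, c i * C i j = 0) → ∀ j, c j = 0) (f : ℝ × ℝ → ℝ × ℝ)
    (hf : ∀ p, f p = (0, 0) ↔ p = (0, 0)) (hs : Function.Surjective f)
    (hCf : ∀ (a b : ℝ) (j : Fin n), ∑ i : Fin n, a ^ (n - 1 - (i : ℕ)) * b ^ (i : ℕ) * C i j =
      (f (a, b)).1 ^ (n - 1 - (j : ℕ)) * (f (a, b)).2 ^ (j : ℕ)) :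
    IsAdaptedCoframe cone U (fun i x => ∑ j, C i j • θ j x) ∧
      ∀ a b x, homForm (fun i x => ∑ j, C i j • θ j x) a b x =
        homForm θ (f (a, b)).1 (f (a, b)).2 x := by
  have hhom : ∀ a b x, homForm (fun i x => ∑ j, C i j • θ j x) a b x =
      homForm θ (f (a, b)).1 (f (a, b)).2 x := by
    intro a b x
    simp only [homForm, Finset.smul_sum, smul_smul]
    rw [Finset.sum_comm]
    simp only [← Finset.sum_smul, hCf]
  refine ⟨⟨h.isOpen, fun i => ?_, fun x hx => ?_, fun x hx => ?_⟩, hhom⟩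
  · exact ContMDiffOn.sum_section fun j _ => ContMDiffOn.const_smul_section (h.smooth j)
  · rw [Fintype.linearIndependent_iff]
    intro c hc
    refine hC c fun j => ?_
    simp only [Finset.smul_sum, smul_smul] at hc
    rw [Finset.sum_comm] at hc
    simp only [← Finset.sum_smul] at hc
    exact Fintype.linearIndependent_iff.1 (h.linearIndependent x hx) _ hc j
  · rw [h.cone_eq x hx]
    ext ξ
    constructor
    · rintro ⟨r, a, b, hr, hab, rfl⟩
      obtain ⟨p, hp⟩ := hs (a, b)
      refine ⟨r, p.1, p.2, hr, fun h0 => hab ?_, ?_⟩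
      · rw [← hp]; exact (hf p).2 h0
      · rw [hhom, hp]
    · rintro ⟨r, a, b, hr, hab, rfl⟩
      refine ⟨r, _, _, hr, fun h0 => hab ?_, by rw [hhom]⟩
      exact (hf (a, b)).1 h0

/-- Reversing the coframe exchanges the parameters 0 and ∞. -/
theorem IsAdaptedCoframe.flip {cone : (x : M) → Set (Cotangent n x)} {U : Set M}
    {θ : Fin n → (x : M) → Cotangent n x} (h : IsAdaptedCoframe cone U θ) :
    ∃ θ', IsAdaptedCoframe cone U θ' ∧ ∀ a b x, homForm θ' a b x = homForm θ b a x := by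
  have := h.change (fun i j => if i = Fin.rev j then 1 else 0)
    (fun c hc j => by simpa using hc (Fin.rev j)) Prod.swap (fun p => by
      constructor
      · intro h; rw [← Prod.swap_swap p, h]; rfl
      · rintro rfl; rfl) Prod.swap_surjective (fun a b j => by
      simp only [mul_ite, mul_one, mul_zero, Finset.sum_ite_eq', Finset.mem_univ, if_true,
        Prod.fst_swap, Prod.snd_swap, Fin.val_rev]
      have h1 : n - 1 - (n - (j + 1)) = j := by omega
      have h2 : n - (j + 1) = n - 1 - (j : ℕ) := by omega
      rw [h1, h2, mul_comm])
  exact ⟨_, this.1, this.2⟩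

/-- The binomial expansion of (b + l a)^j. The matrix is triangular with ones on the diagonal; where
the subtraction j - i truncates, the binomial coefficient is zero. -/
theorem IsAdaptedCoframe.shift {cone : (x : M) → Set (Cotangent n x)} {U : Set M}
    {θ : Fin n → (x : M) → Cotangent n x} (h : IsAdaptedCoframe cone U θ) (l : ℝ) :
    ∃ θ', IsAdaptedCoframe cone U θ' ∧ ∀ a b x, homForm θ' a b x = homForm θ a (b + l * a) x := by
  have := h.change (fun i j => ((j : ℕ).choose i : ℝ) * l ^ ((j : ℕ) - i))
    (fun c hc j => by
      induction j using WellFoundedLT.induction with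
      | ind j ih =>
        have h1 := hc j
        rw [Finset.sum_eq_single j] at h1
        · simpa using h1
        · intro i _ hij
          rcases lt_or_gt_of_ne hij with hlt | hgt
          · rw [ih i hlt, zero_mul]
          · rw [Nat.choose_eq_zero_of_lt (Fin.lt_def.1 hgt)]; simp
        · simp) (fun p => (p.1, p.2 + l * p.1)) (fun p => by
      constructor
      · intro h
        have h1 : p.1 = 0 := congrArg Prod.fst h
        have h2 : p.2 + l * p.1 = 0 := congrArg Prod.snd h
        rw [h1, mul_zero, add_zero] at h2
        exact Prod.ext h1 h2
      · rintro rfl; simp) (fun p => ⟨(p.1, p.2 - l * p.1), by simp⟩) (fun a b j => by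
      rw [Fin.sum_univ_eq_sum_range
        (fun i => a ^ (n - 1 - i) * b ^ i * (((j : ℕ).choose i : ℝ) * l ^ ((j : ℕ) - i))) n,
        add_pow, Finset.mul_sum]
      have hsub : Finset.range ((j : ℕ) + 1) ⊆ Finset.range n := by
        intro i hi
        simp only [Finset.mem_range] at hi ⊢
        omega
      rw [← Finset.sum_subset hsub]
      · refine Finset.sum_congr rfl fun i hi => ?_
        simp only [Finset.mem_range] at hi
        have h1 : n - 1 - i = (n - 1 - j) + (j - i) := by omega
        rw [h1, pow_add, mul_pow]; ring
      · intro i _ hi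
        simp only [Finset.mem_range, not_lt] at hi
        rw [Nat.choose_eq_zero_of_lt (by omega)]; simp)
  exact ⟨_, this.1, this.2⟩

theorem homForm_eq_smul_form (θ : Fin n → (x : M) → Cotangent n x) {a : ℝ} (ha : a ≠ 0) (b : ℝ)
    (x : M) : homForm θ a b x = a ^ (n - 1) • form θ (b / a) x := by
  simp only [homForm, form, Finset.smul_sum, smul_smul]
  refine Finset.sum_congr rfl fun i _ => ?_
  congr 1
  have h1 : n - 1 = (n - 1 - i) + i := by omega
  conv_rhs => rw [h1, pow_add, div_pow]
  field_simp

theorem form_eq_homForm (θ : Fin n → (x : M) → Cotangent n x) (l : ℝ) (x : M) :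
    form θ l x = homForm θ 1 l x := by
  simp [homForm_eq_smul_form]

/-- Around every point there is an adapted coframe for which a given `α`-hyperplane has the
parameter `0`. -/
theorem GL2Structure.exists_adapted_coframe (G : GL2Structure n M) {x : M}
    {H : Submodule ℝ (TangentSpace (𝓡 n) x)} (hH : G.IsAlphaHyperplane x H) :
    ∃ U θ, x ∈ U ∧ IsAdaptedCoframe G.cone U θ ∧ H = LinearMap.ker (form θ 0 x).toLinearMap := by
  obtain ⟨ξ, hξ, rfl⟩ := hH
  obtain ⟨U, θ, hxU, hθ⟩ := G.exists_coframe x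
  -- If the parameter is ∞, that is a = 0, a flip makes it finite. A shift by b / a then moves it to
  -- 0.
  have key : ∃ θ₁, IsAdaptedCoframe G.cone U θ₁ ∧ ∃ r a b : ℝ, r ≠ 0 ∧ a ≠ 0 ∧
      ξ = r • homForm θ₁ a b x := by
    rw [hθ.cone_eq x hxU] at hξ
    obtain ⟨r, a, b, hr, hab, rfl⟩ := hξ
    by_cases ha : a = 0
    · obtain ⟨θ₁, h1, h2⟩ := hθ.flip
      refine ⟨θ₁, h1, r, b, a, hr, fun hb => hab (by rw [ha, hb]), by rw [h2]⟩
    · exact ⟨θ, hθ, r, a, b, hr, ha, rfl⟩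
  obtain ⟨θ₁, h1, r, a, b, hr, ha, rfl⟩ := key
  obtain ⟨θ₂, h2, h3⟩ := h1.shift (b / a)
  refine ⟨U, θ₂, hxU, h2, ?_⟩
  rw [form_eq_homForm, h3, homForm_eq_smul_form θ₁ ha, zero_add, mul_one, ← form_eq_homForm]
  ext v
  simp [hr, ha]

end Coframes

/-! ### Dual frames -/

section Frames

variable {E : Type*} [NormedAddCommGroup E] [NormedSpace ℝ E]

/-- A smooth family of linearly independent covectors has a smooth dual family of vectors. -/
theorem SmoothNear.exists_dual_frame {ι : Type*} [Fintype ι] [DecidableEq ι]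
    {α : ι → E → E →L[ℝ] ℝ} {u₀ : E} (hα : ∀ i, SmoothNear (α i) u₀)
    (hli : LinearIndependent ℝ fun i => α i u₀) :
    ∃ e : ι → E → E, (∀ j, SmoothNear (e j) u₀) ∧
      ∀ᶠ u in 𝓝 u₀, ∀ i j, α i u (e j u) = if i = j then 1 else 0 := by
  let A : E → E →L[ℝ] (ι → ℝ) := fun u =>
    ∑ i, (ContinuousLinearMap.toSpanSingleton ℝ (Pi.single i (1 : ℝ) : ι → ℝ)).comp (α i u)
  have hA : SmoothNear A u₀ :=
    SmoothNear.sum fun i _ => (smoothNear_const _ _).clm_comp (hα i)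
  have hAv : ∀ u v i, A u v i = α i u v := by
    intro u v i
    simp [A, Finset.sum_apply, Pi.single_apply]
  -- A nonzero functional that kills the range would be a linear relation among the αᵢ.
  have hsurj : LinearMap.range (A u₀ : E →ₗ[ℝ] (ι → ℝ)) = ⊤ := by
    by_contra hne
    obtain ⟨f, hf, hle⟩ := Submodule.exists_le_ker_of_lt_top _ (lt_top_iff_ne_top.2 hne)
    refine hf ?_
    have hfs : ∀ y : ι → ℝ, f y = ∑ i, y i * f (Pi.single i 1) := by
      intro y
      conv_lhs => rw [pi_eq_sum_univ' y]
      rw [map_sum]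
      refine Finset.sum_congr rfl fun i _ => ?_
      rw [map_smul, smul_eq_mul]
    have h0 : ∀ i, f (Pi.single i 1) = 0 := by
      refine Fintype.linearIndependent_iff.1 hli (fun i => f (Pi.single i 1)) ?_
      ext v
      have h1 : f (A u₀ v) = 0 := hle ⟨v, rfl⟩
      rw [hfs] at h1
      simp only [hAv] at h1
      simpa [sum_apply, mul_comm] using h1
    ext i
    simp [h0]
  obtain ⟨s, hs⟩ := (A u₀ : E →ₗ[ℝ] (ι → ℝ)).exists_rightInverse_of_surjective hsurj
  obtain ⟨ν, hν, -, hνA, -⟩ := hA.exists_rightInverse (ι := LinearMap.toContinuousLinearMap s)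
    (fun v => by simpa using LinearMap.congr_fun hs v)
  refine ⟨fun j u => ν u (Pi.single j 1), fun j => hν.clm_apply (smoothNear_const _ _), ?_⟩
  filter_upwards [hνA] with u hu i j
  rw [← hAv, hu, Pi.single_apply]

end Frames

/-! ### The integrability condition -/

section Equations

variable {E : Type*} [NormedAddCommGroup E] [NormedSpace ℝ E] {Θ : E × ℝ → E →L[ℝ] ℝ} {u₀ : E}
  {l₀ : ℝ}

/-- `g = 0` is near `u₀` a regular hypersurface with the tangent spaces `Θ(u, λ(u)) = 0`. -/
structure IsAlphaEquation (Θ : E × ℝ → E →L[ℝ] ℝ) (u₀ : E) (l₀ : ℝ) (g lam : E → ℝ) :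
    Prop where
  smooth : SmoothNear g u₀
  eq_zero : g u₀ = 0
  smooth_param : SmoothNear lam u₀
  param_eq : lam u₀ = l₀
  fderiv_ne_zero : fderiv ℝ g u₀ ≠ 0
  tangent : ∀ᶠ u in 𝓝 u₀, g u = 0 → ∃ k : ℝ, k ≠ 0 ∧ ∀ v, fderiv ℝ g u v = k * Θ (u, lam u) v

/-- The integrability condition that a hypersurface tangent to `Θ = 0` imposes. -/
theorem IsAlphaEquation.exists_symmetric [CompleteSpace E] {g lam : E → ℝ}
    (h : IsAlphaEquation Θ u₀ l₀ g lam) (hΘ : SmoothNear Θ (u₀, l₀)) :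
    ∃ ℓ : E →L[ℝ] ℝ, ∀ v w, Θ (u₀, l₀) v = 0 → Θ (u₀, l₀) w = 0 →
      fderiv ℝ Θ (u₀, l₀) (v, ℓ v) w = fderiv ℝ Θ (u₀, l₀) (w, ℓ w) v := by
  obtain ⟨k₀, hk₀, hk⟩ := h.tangent.self_of_nhds h.eq_zero
  rw [h.param_eq] at hk
  obtain ⟨e, he⟩ := exists_apply_eq_one h.fderiv_ne_zero
  have hΘe : Θ (u₀, l₀) e ≠ 0 := fun h0 => by rw [hk, h0, mul_zero] at he; exact zero_ne_one he
  -- The graph of dλ over ker Θ is the tangent space of the lift; the symmetry says that dΘ vanishes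
  -- on it.
  refine ⟨fderiv ℝ lam u₀, fun v w hv hw => ?_⟩
  have hlam := h.smooth_param.differentiableAt.hasFDerivAt
  have hΘl : HasFDerivAt (fun u => Θ (u, lam u)) ((fderiv ℝ Θ (u₀, l₀)).comp
      ((ContinuousLinearMap.id ℝ E).prod (fderiv ℝ lam u₀))) u₀ :=
    hasFDerivAt_comp_of_eq hΘ.differentiableAt.hasFDerivAt
      ((hasFDerivAt_id u₀).prodMk hlam) (by simp [h.param_eq])
  have hD := h.smooth.fderiv_right.differentiableAt.hasFDerivAt
  -- Θ(e) dg(w) - dg(e) Θ(w) vanishes on the hypersurface and is differentiated along `v`. This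
  -- eliminates the factor `k`, of which no smoothness is known; the result is symmetric because D²g
  -- is.
  have key : ∀ v w, Θ (u₀, l₀) v = 0 → Θ (u₀, l₀) w = 0 →
      Θ (u₀, l₀) e * fderiv ℝ (fderiv ℝ g) u₀ v w =
        fderiv ℝ Θ (u₀, l₀) (v, fderiv ℝ lam u₀ v) w := by
    intro v w hv hw
    have hF : HasFDerivAt (fun u => Θ (u, lam u) e * fderiv ℝ g u w -
        fderiv ℝ g u e * Θ (u, lam u) w) _ u₀ :=
      ((hΘl.clm_apply (hasFDerivAt_const e u₀)).mul (hD.clm_apply (hasFDerivAt_const w u₀))).sub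
        ((hD.clm_apply (hasFDerivAt_const e u₀)).mul (hΘl.clm_apply (hasFDerivAt_const w u₀)))
    have h0 := fderiv_eq_zero_of_zeroSet h.smooth hF.differentiableAt h.eq_zero h.fderiv_ne_zero
      (by
        filter_upwards [h.tangent] with u hu hgu
        obtain ⟨k, -, hk⟩ := hu hgu
        rw [hk, hk]; ring) (v := v) (by rw [hk, hv, mul_zero])
    rw [hF.fderiv] at h0
    simp [h.param_eq, he, hk w, hw] at h0
    linarith
  rw [← key v w hv hw, ← key w v hw hv, h.smooth.fderiv_fderiv_comm]

end Equations

/-! ### Cauchy characteristics and the map to J¹ -/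

section Reduction

variable {E : Type} [NormedAddCommGroup E] [NormedSpace ℝ E]
  {Θ : E × ℝ → E →L[ℝ] ℝ} {z₀ : E × ℝ}

theorem SmoothNear.clm_prod {Z F G H : Type*} [NormedAddCommGroup Z] [NormedSpace ℝ Z]
    [NormedAddCommGroup F] [NormedSpace ℝ F] [NormedAddCommGroup G] [NormedSpace ℝ G]
    [NormedAddCommGroup H] [NormedSpace ℝ H] {f : Z → F →L[ℝ] G} {g : Z → F →L[ℝ] H} {z : Z}
    (hf : SmoothNear f z) (hg : SmoothNear g z) : SmoothNear (fun y => (f y).prod (g y)) z := by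
  have h := ((smoothNear_const (ContinuousLinearMap.inl ℝ G H) z).clm_comp hf).add
    ((smoothNear_const (ContinuousLinearMap.inr ℝ G H) z).clm_comp hg)
  refine h.congr (Eventually.of_forall fun y => ?_)
  ext v <;> simp

/-- The contraction of `e` with the part of dΘ along `E`. The term DΘ(v)(e) is written as the
derivative of Θ(e) minus Θ ∘ De, which is visibly a smooth family of covectors. -/
theorem exists_antisymmetrization (hΘ : SmoothNear Θ z₀) {e : E × ℝ → E} (he : SmoothNear e z₀) :
    ∃ β : E × ℝ → E →L[ℝ] ℝ, SmoothNear β z₀ ∧ ∀ᶠ z in 𝓝 z₀, ∀ v, β z v =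
      fderiv ℝ Θ z (v, 0) (e z) - fderiv ℝ Θ z (e z, 0) v := by
  have hi := smoothNear_const (ContinuousLinearMap.inl ℝ E ℝ) z₀
  refine ⟨fun z => (fderiv ℝ (fun z => Θ z (e z)) z).comp (ContinuousLinearMap.inl ℝ E ℝ) -
    (Θ z).comp ((fderiv ℝ e z).comp (ContinuousLinearMap.inl ℝ E ℝ)) -
    (fderiv ℝ Θ z).comp (ContinuousLinearMap.inl ℝ E ℝ) (e z),
    (((hΘ.clm_apply he).fderiv_right.clm_comp hi).sub
      (hΘ.clm_comp (he.fderiv_right.clm_comp hi))).sub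
      ((hΘ.fderiv_right.clm_comp hi).clm_apply he), ?_⟩
  filter_upwards [hΘ.eventually_nhds, he.eventually_nhds] with z h1 h2 v
  rw [(h1.differentiableAt.hasFDerivAt.clm_apply h2.differentiableAt.hasFDerivAt).fderiv]
  simp

/-- The one-form on `E × ℝ` and two further covectors that cut out its Cauchy characteristics. -/
theorem exists_characteristic_map (hΘ : SmoothNear Θ z₀) {e : E × ℝ → E} (he : SmoothNear e z₀) :
    ∃ B : E × ℝ → E × ℝ →L[ℝ] J1, SmoothNear B z₀ ∧ ∀ᶠ z in 𝓝 z₀, ∀ v τ, B z (v, τ) =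
      (Θ z v, fderiv ℝ Θ z (0, 1) v,
        τ + (fderiv ℝ Θ z (v, 0) (e z) - fderiv ℝ Θ z (e z, 0) v)) := by
  obtain ⟨β, hβ, hβv⟩ := exists_antisymmetrization hΘ he
  have hp := smoothNear_const (ContinuousLinearMap.fst ℝ E ℝ) z₀
  -- The covectors are Θ and, once ∂_λΘ(e) = 1, the pairings of dΘ with ∂_λ and with (e, 0), up to
  -- sign.
  refine ⟨_, (hΘ.clm_comp hp).clm_prod
    (((hΘ.fderiv_right.clm_apply (smoothNear_const (0, 1) _)).clm_comp hp).clm_prod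
      ((smoothNear_const (ContinuousLinearMap.snd ℝ E ℝ) _).add (hβ.clm_comp hp))), ?_⟩
  filter_upwards [hβv] with z hz v τ
  rw [← hz]
  rfl

theorem fderiv_apply_eq_add (z : E × ℝ) (v : E) (τ : ℝ) (w : E) :
    fderiv ℝ Θ z (v, τ) w = fderiv ℝ Θ z (v, 0) w + τ * fderiv ℝ Θ z (0, 1) w := by
  have : ((v, τ) : E × ℝ) = (v, 0) + τ • (0, 1) := by simp
  rw [this, map_add, map_smul]
  rfl

/-- For the right inverse of the characteristic map at one point: e₀ and e₁ are dual to Θ and ∂_λΘ,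
and -b y₁ offsets the value of the third covector on e₀. -/
theorem exists_linear_frame (e₀ e₁ : E) (b : ℝ) : ∃ j : J1 →L[ℝ] E × ℝ,
    ∀ y : J1, j y = (y.1 • e₀ + y.2.1 • e₁, y.2.2 - b * y.1) := by
  refine ⟨((ContinuousLinearMap.fst ℝ ℝ (ℝ × ℝ)).smulRight e₀ +
      ((ContinuousLinearMap.fst ℝ ℝ ℝ).comp (ContinuousLinearMap.snd ℝ ℝ (ℝ × ℝ))).smulRight
        e₁).prod
    ((ContinuousLinearMap.snd ℝ ℝ ℝ).comp (ContinuousLinearMap.snd ℝ ℝ (ℝ × ℝ)) -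
      b • ContinuousLinearMap.fst ℝ ℝ (ℝ × ℝ)), fun y => ?_⟩
  simp

theorem fderiv_comp_fst (hΘ : SmoothNear Θ z₀) (v : E) (τ : ℝ) (w : E) (σ : ℝ) :
    fderiv ℝ (fun z => (Θ z).comp (ContinuousLinearMap.fst ℝ E ℝ)) z₀ (v, τ) (w, σ) =
      fderiv ℝ Θ z₀ (v, τ) w := by
  have h1 : HasFDerivAt (fun z => (Θ z).comp (ContinuousLinearMap.fst ℝ E ℝ)) _ z₀ :=
    hΘ.differentiableAt.hasFDerivAt.clm_comp (hasFDerivAt_const _ z₀)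
  rw [h1.fderiv]
  simp

/-- If hyperplanes of all parameters satisfy the integrability condition, then `Θ = 0` is near
`z₀` the preimage of the contact distribution of `J¹`. -/
theorem exists_contact_map_of_symmetric [FiniteDimensional ℝ E] (hΘ : SmoothNear Θ z₀)
    {e : E × ℝ → E} (he : SmoothNear e z₀) (heΘ : ∀ᶠ z in 𝓝 z₀, Θ z (e z) = 0)
    (heΘ' : ∀ᶠ z in 𝓝 z₀, fderiv ℝ Θ z (0, 1) (e z) = 1)
    {e₀ : E} (he₀ : Θ z₀ e₀ = 1) (he₀' : fderiv ℝ Θ z₀ (0, 1) e₀ = 0)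
    (hsym : ∀ᶠ z in 𝓝 z₀, ∃ ℓ : E →L[ℝ] ℝ, ∀ v w, Θ z v = 0 → Θ z w = 0 →
      fderiv ℝ Θ z (v, ℓ v) w = fderiv ℝ Θ z (w, ℓ w) v) :
    ∃ ρ : E × ℝ → J1, SmoothNear ρ z₀ ∧ ρ z₀ = 0 ∧ Function.Surjective (fderiv ℝ ρ z₀) ∧
      (fderiv ℝ ρ z₀ (0, 1)).1 = 0 ∧
      ∀ᶠ z in 𝓝 z₀, ∃ a : ℝ, a ≠ 0 ∧ ∀ v τ,
        contactForm (ρ z) (fderiv ℝ ρ z (v, τ)) = a * Θ z v := by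
  obtain ⟨B, hB, hBv⟩ := exists_characteristic_map hΘ he
  obtain ⟨j, hj⟩ := exists_linear_frame e₀ (e z₀)
    (fderiv ℝ Θ z₀ (e₀, 0) (e z₀) - fderiv ℝ Θ z₀ (e z₀, 0) e₀)
  have he1 := heΘ.self_of_nhds
  have he1' := heΘ'.self_of_nhds
  have hBj : ∀ y, B z₀ (j y) = y := by
    intro y
    have h1 : ((y.1 • e₀ + y.2.1 • e z₀, 0) : E × ℝ) = y.1 • (e₀, 0) + y.2.1 • (e z₀, 0) := by
      simp
    rw [hj, hBv.self_of_nhds, h1]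
    simp only [map_add, map_smul, he₀, he₀', he1, he1', smul_eq_mul, add_apply, smul_apply]
    refine Prod.ext (by simp) (Prod.ext (by simp) ?_)
    ring
  have hΨ : SmoothNear (fun z => (Θ z).comp (ContinuousLinearMap.fst ℝ E ℝ)) z₀ :=
    hΘ.clm_comp (smoothNear_const _ z₀)
  have hd : ∀ᶠ z in 𝓝 z₀, ∀ k w : E × ℝ, B z k = 0 →
      (Θ z).comp (ContinuousLinearMap.fst ℝ E ℝ) w = 0 →
      fderiv ℝ (fun z => (Θ z).comp (ContinuousLinearMap.fst ℝ E ℝ)) z k w =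
        fderiv ℝ (fun z => (Θ z).comp (ContinuousLinearMap.fst ℝ E ℝ)) z w k := by
    filter_upwards [hΘ.eventually_nhds, hBv, heΘ, heΘ', hsym] with z hz hBz h0 h1 hs
    rintro ⟨v, τ⟩ ⟨w, σ⟩ hk hw
    obtain ⟨ℓ, hℓ⟩ := hs
    rw [hBz] at hk
    simp only [Prod.mk_eq_zero] at hk
    obtain ⟨hv, hv', hτ⟩ := hk
    have h2 := hℓ v w hv hw
    -- The pair (v, e) forces ℓ v = τ, so k = (v, τ) lies in the isotropic hyperplane. The
    -- λ-component of `w` is irrelevant, as ∂_λΘ(v) = 0.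
    have h3 := hℓ v (e z) hv h0
    rw [fderiv_apply_eq_add z v, fderiv_apply_eq_add z (e z), hv', h1] at h3
    rw [fderiv_apply_eq_add z v, fderiv_apply_eq_add z w, hv'] at h2
    rw [fderiv_comp_fst hz, fderiv_comp_fst hz, fderiv_apply_eq_add z v, fderiv_apply_eq_add z w,
      hv']
    have h5 : τ = ℓ v := by linarith
    rw [h5]; linarith
  obtain ⟨ρ, h1, h2, h3, h4, h5⟩ := exists_contact_map hB hBj hΨ
    (by filter_upwards [hBv] with z hz w; rw [← Prod.mk.eta (p := w), hz]; rfl) hd (by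
    -- The last two slice directions are (e, 0) and ∂_λ, on which dΘ takes the value ±∂_λΘ(e) = ±1.
    rw [hj, hj]
    simp only [zero_smul, one_smul, zero_add, mul_zero, sub_zero]
    rw [fderiv_comp_fst hΘ, fderiv_comp_fst hΘ, he1', map_zero]
    exact zero_ne_one)
  refine ⟨ρ, h1, h2, h3, ?_, ?_⟩
  -- At z₀ the pull-back of dt is the second covector, ∂_λΘ, which kills ∂_λ.
  · rw [h4, hBv.self_of_nhds]; simp
  · filter_upwards [h5] with z hz
    obtain ⟨a, ha, h6⟩ := hz
    exact ⟨a, ha, fun v τ => h6 (v, τ)⟩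

end Reduction

/-! ### The form θ(λ) in a chart -/

section Symbol

variable {n : ℕ} {M : Type*} [TopologicalSpace M] [ChartedSpace (Model n) M]
  [IsManifold (𝓡 n) ∞ M] {x₀ y : M} {θ : Fin n → (x : M) → Cotangent n x}

/-- The form `θ(λ)` in the chart at `x₀`. -/
noncomputable def localSymbol (n : ℕ) {M : Type*} [TopologicalSpace M] [ChartedSpace (Model n) M]
    [IsManifold (𝓡 n) ∞ M] (x₀ : M) (θ : Fin n → (x : M) → Cotangent n x) (z : Model n × ℝ) :
    Model n →L[ℝ] ℝ :=
  ∑ i : Fin n, z.2 ^ (i : ℕ) • localForm n x₀ (θ i) z.1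

theorem localSymbol_apply (hy : y ∈ (chartMap n x₀).source) (l : ℝ) (v : TangentSpace (𝓡 n) y) :
    localSymbol n x₀ θ (chartMap n x₀ y, l) (chartDeriv n x₀ y v) = form θ l y v := by
  simp only [localSymbol, form, sum_apply, smul_apply]
  refine Finset.sum_congr rfl fun i _ => ?_
  rw [localForm_apply hy]

theorem homForm_apply (hy : y ∈ (chartMap n x₀).source) (a b : ℝ) (v : TangentSpace (𝓡 n) y) :
    homForm θ a b y v = ∑ i : Fin n, (a ^ (n - 1 - (i : ℕ)) * b ^ (i : ℕ)) *
      localForm n x₀ (θ i) (chartMap n x₀ y) (chartDeriv n x₀ y v) := by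
  simp only [homForm, sum_apply, smul_apply]
  refine Finset.sum_congr rfl fun i _ => ?_
  rw [localForm_apply hy]
  rfl

variable {cone : (x : M) → Set (Cotangent n x)} {U : Set M}

theorem IsAdaptedCoframe.smoothNear_localForm (h : IsAdaptedCoframe cone U θ) (hyU : y ∈ U)
    (hy : y ∈ (chartMap n x₀).source) (i : Fin n) :
    SmoothNear (localForm n x₀ (θ i)) (chartMap n x₀ y) :=
  GL2.smoothNear_localForm h.isOpen (h.smooth i) hyU hy

theorem hasFDerivAt_localSymbol {u : Model n}
    (h : ∀ i, SmoothNear (localForm n x₀ (θ i)) u) (l : ℝ) :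
    SmoothNear (localSymbol n x₀ θ) (u, l) ∧
      fderiv ℝ (localSymbol n x₀ θ) (u, l) (0, 1) =
        ∑ i : Fin n, ((i : ℕ) * l ^ ((i : ℕ) - 1)) • localForm n x₀ (θ i) u := by
  have hp : ∀ i : ℕ, SmoothNear (fun z : Model n × ℝ => z.2 ^ i) (u, l) := fun i =>
    smoothNear_of_contDiff (by fun_prop) _
  have hθ : ∀ i, SmoothNear (fun z : Model n × ℝ => localForm n x₀ (θ i) z.1) (u, l) := fun i =>
    (h i).comp_of_eq (smoothNear_of_contDiff contDiff_fst _) rfl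
  have hs : SmoothNear (localSymbol n x₀ θ) (u, l) :=
    SmoothNear.sum fun i _ => (hp i).smul (hθ i)
  refine ⟨hs, ?_⟩
  have h1 : HasDerivAt (fun t => localSymbol n x₀ θ (u, t))
      (fderiv ℝ (localSymbol n x₀ θ) (u, l) (0, 1)) l := by
    have h2 : HasDerivAt (fun t : ℝ => (u, t)) (0, 1) l :=
      (hasDerivAt_const l u).prodMk (hasDerivAt_id l)
    exact hs.differentiableAt.hasFDerivAt.comp_hasDerivAt l h2
  refine h1.unique ?_
  exact HasDerivAt.fun_sum fun i _ => (hasDerivAt_pow (i : ℕ) l).smul_const (localForm n x₀ (θ i) u)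

theorem IsAdaptedCoframe.exists_frame (h : IsAdaptedCoframe cone U θ) (hyU : y ∈ U)
    (hy : y ∈ (chartMap n x₀).source) :
    ∃ e : Fin n → Model n → Model n, (∀ j, SmoothNear (e j) (chartMap n x₀ y)) ∧
      ∀ᶠ u in 𝓝 (chartMap n x₀ y), ∀ i j,
        localForm n x₀ (θ i) u (e j u) = if i = j then 1 else 0 := by
  refine SmoothNear.exists_dual_frame (h.smoothNear_localForm hyU hy) ?_
  rw [Fintype.linearIndependent_iff]
  intro c hc
  refine Fintype.linearIndependent_iff.1 (h.linearIndependent y hyU) c ?_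
  ext v
  have := DFunLike.congr_fun hc (chartDeriv n x₀ y v)
  simp only [sum_apply, smul_apply, localForm_apply hy] at this
  rw [sum_apply]
  simp only [smul_apply]
  exact this

theorem sum_mul_localForm_frame {e : Fin n → Model n → Model n} {u : Model n}
    (he : ∀ i j, localForm n x₀ (θ i) u (e j u) = if i = j then 1 else 0) (c : Fin n → ℝ)
    (j : Fin n) : ∑ i, c i * localForm n x₀ (θ i) u (e j u) = c j := by
  simp [he]

theorem localSymbol_frame {e : Fin n → Model n → Model n} {u : Model n}
    (he : ∀ i j, localForm n x₀ (θ i) u (e j u) = if i = j then 1 else 0) (l : ℝ) (j : Fin n) :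
    localSymbol n x₀ θ (u, l) (e j u) = l ^ (j : ℕ) := by
  rw [localSymbol, sum_apply]
  exact sum_mul_localForm_frame he (fun i => l ^ (i : ℕ)) j

/-- The parameter of the hyperplane `θ(λ) = 0` is unique. -/
theorem param_eq_of_ker_eq (hn : 2 ≤ n) {e : Fin n → Model n → Model n} {u : Model n}
    (he : ∀ i j, localForm n x₀ (θ i) u (e j u) = if i = j then 1 else 0) {l l' : ℝ}
    (h : ∀ v, localSymbol n x₀ θ (u, l) v = 0 ↔ localSymbol n x₀ θ (u, l') v = 0) : l = l' := by
  obtain ⟨c, -, hc⟩ := exists_eq_mul_of_ker_eq h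
  -- On the first two frame vectors θ(λ) takes the values 1 and λ, so proportional forms have equal
  -- λ.
  have h0 := hc (e ⟨0, by omega⟩ u)
  have h1 := hc (e ⟨1, by omega⟩ u)
  rw [localSymbol_frame he, localSymbol_frame he] at h0 h1
  simp only [pow_zero, mul_one, pow_one] at h0 h1
  rw [h1, ← h0, one_mul]

end Symbol

/-! ### Local equations of α-manifolds -/

section Hypersurfaces

variable {n : ℕ} {M : Type*} [TopologicalSpace M] [ChartedSpace (Model n) M]
  [IsManifold (𝓡 n) ∞ M] {x₀ y : M}

/-- A local equation of a hypersurface in a chart. -/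
theorem IsLocalEquation.comp_symm {N V : Set M} {g : M → ℝ} (h : IsLocalEquation n N V g)
    (hyV : y ∈ V) (hy : y ∈ (chartMap n x₀).source) :
    SmoothNear (fun u => g ((chartMap n x₀).symm u)) (chartMap n x₀ y) ∧
      (∀ v, mfderiv (𝓡 n) 𝓘(ℝ, ℝ) g y v = fderiv ℝ (fun u => g ((chartMap n x₀).symm u))
        (chartMap n x₀ y) (chartDeriv n x₀ y v)) ∧
      (y ∈ N → fderiv ℝ (fun u => g ((chartMap n x₀).symm u)) (chartMap n x₀ y) ≠ 0) ∧
      ∀ᶠ z in 𝓝 y, z ∈ N ↔ g ((chartMap n x₀).symm (chartMap n x₀ z)) = 0 := by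
  have hs := smoothNear_comp_chartMap_symm h.isOpen h.smooth hyV hy
  have hd := mfderiv_eq_fderiv hy hs.differentiableAt
  refine ⟨hs, hd, fun hN h0 => ?_, ?_⟩
  · refine h.mfderiv_ne_zero y hyV hN (ContinuousLinearMap.ext fun v => ?_)
    rw [hd, h0]; rfl
  · filter_upwards [h.isOpen.mem_nhds hyV, chartMap_source_mem_nhds hy] with z hzV hz
    rw [(chartMap n x₀).left_inv hz, h.mem_iff z hzV]

theorem eventually_of_chartMap {P : Model n → Prop} (hy : y ∈ (chartMap n x₀).source)
    (h : ∀ᶠ z in 𝓝 y, P (chartMap n x₀ z)) : ∀ᶠ u in 𝓝 (chartMap n x₀ y), P u := by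
  filter_upwards [continuousAt_chartMap_symm hy h, eventually_mem_target hy] with u h1 h2
  rw [Set.mem_preimage, Set.mem_ofPred_eq, (chartMap n x₀).right_inv h2] at h1
  exact h1

/-- The tangent space of a hypersurface at one of its points, from an equation in a chart. -/
theorem HasTangentSpace.eq_ker {N : Set M} {H : Submodule ℝ (TangentSpace (𝓡 n) y)}
    (h : HasTangentSpace N y H) (hy : y ∈ (chartMap n x₀).source) {g : Model n → ℝ}
    (hg : SmoothNear g (chartMap n x₀ y)) (hg0 : g (chartMap n x₀ y) = 0)
    (hdg : fderiv ℝ g (chartMap n x₀ y) ≠ 0)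
    (hN : ∀ᶠ z in 𝓝 y, z ∈ N ↔ g (chartMap n x₀ z) = 0) (v : TangentSpace (𝓡 n) y) :
    v ∈ H ↔ fderiv ℝ g (chartMap n x₀ y) (chartDeriv n x₀ y v) = 0 := by
  obtain ⟨hyN, V, g', hyV, hloc, rfl⟩ := h
  obtain ⟨hs, hd, h0, hN'⟩ := hloc.comp_symm hyV hy
  have hg0' : g' ((chartMap n x₀).symm (chartMap n x₀ y)) = 0 := hN'.self_of_nhds.1 hyN
  have hiff : ∀ᶠ u in 𝓝 (chartMap n x₀ y), g u = 0 ↔ g' ((chartMap n x₀).symm u) = 0 :=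
    eventually_of_chartMap hy (by
      filter_upwards [hN, hN'] with z h1 h2
      rw [← h1, h2])
  rw [LinearMap.mem_ker, ContinuousLinearMap.coe_coe, hd]
  exact ⟨fun hv => fderiv_eq_zero_of_zeroSet hs hg.differentiableAt hg0' (h0 hyN)
      (hiff.mono fun u hu => hu.2) hv,
    fun hv => fderiv_eq_zero_of_zeroSet hg hs.differentiableAt hg0 hdg
      (hiff.mono fun u hu => hu.1) hv⟩

/-- An `α`-manifold has near a point a local equation in the chart, and its tangent spaces have a
smooth parameter, provided that the parameter at the point is finite. -/
theorem exists_isAlphaEquation (hn : 2 ≤ n) {G : GL2Structure n M} {U : Set M}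
    {θ : Fin n → (x : M) → Cotangent n x} (hθ : IsAdaptedCoframe G.cone U θ) (hyU : y ∈ U)
    (hy : y ∈ (chartMap n x₀).source) {l : ℝ} {N : Set M} (hN : G.IsAlphaManifold N)
    (hT : HasTangentSpace N y (LinearMap.ker (form θ l y).toLinearMap)) :
    ∃ g lam : Model n → ℝ, IsAlphaEquation (localSymbol n x₀ θ) (chartMap n x₀ y) l g lam ∧
      ∀ᶠ z in 𝓝 y, z ∈ N ↔ g (chartMap n x₀ z) = 0 := by
  obtain ⟨hyN, V, g', hyV, hloc, hker⟩ := hT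
  obtain ⟨hs, hd, h0, hN'⟩ := hloc.comp_symm hyV hy
  obtain ⟨e, he, hdual⟩ := hθ.exists_frame hyU hy
  set u₀ := chartMap n x₀ y with hu₀
  set g : Model n → ℝ := fun u => g' ((chartMap n x₀).symm u) with hg
  have hg0 : g u₀ = 0 := hN'.self_of_nhds.1 hyN
  let i₀ : Fin n := ⟨0, by omega⟩
  let i₁ : Fin n := ⟨1, by omega⟩
  obtain ⟨k₀, hk₀, hk⟩ : ∃ k : ℝ, k ≠ 0 ∧ ∀ v, fderiv ℝ g u₀ v =
      k * localSymbol n x₀ θ (u₀, l) v := by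
    refine exists_eq_mul_of_ker_eq fun w => ?_
    obtain ⟨v, rfl⟩ := (chartDeriv_bijective hy).2 w
    rw [localSymbol_apply hy, ← hd]
    have : v ∈ LinearMap.ker (form θ l y).toLinearMap ↔
      v ∈ LinearMap.ker (mfderiv (𝓡 n) 𝓘(ℝ, ℝ) g' y).toLinearMap := by rw [hker]
    exact this.symm
  have hd0 : fderiv ℝ g u₀ (e i₀ u₀) = k₀ := by
    rw [hk, localSymbol_frame hdual.self_of_nhds]; simp [i₀]
  have hd1 : fderiv ℝ g u₀ (e i₁ u₀) = k₀ * l := by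
    rw [hk, localSymbol_frame hdual.self_of_nhds]; simp [i₁]
  have hs0 : SmoothNear (fun u => fderiv ℝ g u (e i₀ u)) u₀ := hs.fderiv_right.clm_apply (he i₀)
  have hs1 : SmoothNear (fun u => fderiv ℝ g u (e i₁ u)) u₀ := hs.fderiv_right.clm_apply (he i₁)
  -- A covector c θ(a : b) has the values c aⁿ⁻¹ and c aⁿ⁻² b on e₀ and e₁. Their quotient is the
  -- parameter b / a, which is smooth as a quotient of derivatives of `g`.
  refine ⟨g, fun u => fderiv ℝ g u (e i₁ u) / fderiv ℝ g u (e i₀ u),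
    ⟨hs, hg0, hs1.div hs0 (by rw [hd0]; exact hk₀), by rw [hd0, hd1]; field_simp, h0 hyN, ?_⟩, hN'⟩
  have hne : ∀ᶠ u in 𝓝 u₀, fderiv ℝ g u (e i₀ u) ≠ 0 :=
    hs0.continuousAt.eventually_ne (by rw [hd0]; exact hk₀)
  filter_upwards [hdual, hne, eventually_mem_target hy,
    continuousAt_chartMap_symm hy (hloc.isOpen.mem_nhds hyV),
    continuousAt_chartMap_symm hy (hθ.isOpen.mem_nhds hyU)] with u hu hu0 hut huV huU hgu
  obtain ⟨z, hz, rfl⟩ : ∃ z ∈ (chartMap n x₀).source, chartMap n x₀ z = u :=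
    ⟨_, (chartMap n x₀).map_target hut, (chartMap n x₀).right_inv hut⟩
  rw [Set.mem_preimage, (chartMap n x₀).left_inv hz] at huV huU
  have hzN : z ∈ N := by
    rw [hloc.mem_iff z huV, ← (chartMap n x₀).left_inv hz]; exact hgu
  obtain ⟨-, hd', -, -⟩ := hloc.comp_symm huV hz
  obtain ⟨ξ, hξ, hξker⟩ := hN.2 z _ ⟨hzN, V, g', huV, hloc, rfl⟩
  rw [hθ.cone_eq z huU] at hξ
  obtain ⟨r, a, b, hr, -, rfl⟩ := hξ
  obtain ⟨c, hc, hcv⟩ : ∃ c : ℝ, c ≠ 0 ∧ ∀ v, mfderiv (𝓡 n) 𝓘(ℝ, ℝ) g' z v =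
      c * (homForm θ a b z v : ℝ) := by
    refine exists_eq_mul_of_ker_eq (f := mfderiv (𝓡 n) 𝓘(ℝ, ℝ) g' z) (g := homForm θ a b z)
      fun v => ?_
    have h1 : v ∈ LinearMap.ker (mfderiv (𝓡 n) 𝓘(ℝ, ℝ) g' z).toLinearMap ↔
      v ∈ LinearMap.ker (r • homForm θ a b z).toLinearMap := by rw [hξker]
    have h2 : (r • homForm θ a b z) v = r * (homForm θ a b z v : ℝ) := rfl
    rw [LinearMap.mem_ker, LinearMap.mem_ker, ContinuousLinearMap.coe_coe,
      ContinuousLinearMap.coe_coe, h2] at h1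
    exact h1.trans (by simp [hr])
  have hDg : ∀ w, fderiv ℝ g (chartMap n x₀ z) w = c * ∑ i : Fin n,
      (a ^ (n - 1 - (i : ℕ)) * b ^ (i : ℕ)) * localForm n x₀ (θ i) (chartMap n x₀ z) w := by
    intro w
    obtain ⟨v, rfl⟩ := (chartDeriv_bijective hz).2 w
    rw [← homForm_apply hz, ← hcv, hd']
  have h0' : fderiv ℝ g (chartMap n x₀ z) (e i₀ (chartMap n x₀ z)) = c * a ^ (n - 1) := by
    rw [hDg, sum_mul_localForm_frame hu]; simp [i₀]
  have h1' : fderiv ℝ g (chartMap n x₀ z) (e i₁ (chartMap n x₀ z)) = c * (a ^ (n - 1 - 1) * b) := by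
    rw [hDg, sum_mul_localForm_frame hu]; simp [i₁]
  have hpow : a ^ (n - 1) = a ^ (n - 1 - 1) * a := by
    rw [← pow_succ]; congr 1; omega
  -- The parameter ∞ would make dg(e₀) vanish, because n - 1 ≥ 1.
  have ha : a ≠ 0 := by
    rintro rfl
    rw [h0', hpow, mul_zero, mul_zero] at hu0
    exact hu0 rfl
  have hlam : fderiv ℝ g (chartMap n x₀ z) (e i₁ (chartMap n x₀ z)) /
      fderiv ℝ g (chartMap n x₀ z) (e i₀ (chartMap n x₀ z)) = b / a := by
    rw [h0', h1', hpow]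
    field_simp
  refine ⟨c * a ^ (n - 1), mul_ne_zero hc (pow_ne_zero _ ha), fun w => ?_⟩
  obtain ⟨v, rfl⟩ := (chartDeriv_bijective hz).2 w
  rw [hlam, localSymbol_apply hz, ← hd', hcv, homForm_eq_smul_form θ ha]
  exact (mul_assoc _ _ _).symm

end Hypersurfaces

/-! ### Hypersurfaces over curves in J¹ -/

section Curves

variable {E : Type*} [NormedAddCommGroup E] [NormedSpace ℝ E] {ρ : E × ℝ → J1}
  {Θ : E × ℝ → E →L[ℝ] ℝ} {u₀ : E} {l₀ : ℝ}

/-- `g = 0` is near `u₀` the projection of `ρ⁻¹(γ)`, and `ρ(u, λ(u)) = γ(S(u))` on it. -/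
structure IsCurveEquation (ρ : E × ℝ → J1) (Θ : E × ℝ → E →L[ℝ] ℝ) (u₀ : E) (l₀ : ℝ)
    (γ : ℝ → J1) (g lam S : E → ℝ) : Prop extends IsAlphaEquation Θ u₀ l₀ g lam where
  continuousAt : ContinuousAt S u₀
  eq_zero' : S u₀ = 0
  map_eq : ∀ᶠ u in 𝓝 u₀, g u = 0 → ρ (u, lam u) = γ (S u)
  of_map_eq : ∀ᶠ p : (E × ℝ) × ℝ in 𝓝 ((u₀, l₀), 0),
    ρ p.1 = γ p.2 → g p.1.1 = 0 ∧ p.1.2 = lam p.1.1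

theorem exists_isCurveEquation [FiniteDimensional ℝ E] (hρ : SmoothNear ρ (u₀, l₀))
    (hcon : ∀ᶠ z in 𝓝 (u₀, l₀), ∃ r : ℝ, r ≠ 0 ∧ ∀ v τ,
      contactForm (ρ z) (fderiv ℝ ρ z (v, τ)) = r * Θ z v) (hΘ : Θ (u₀, l₀) ≠ 0)
    {γ : ℝ → J1} (hγ : IsLegendrianAt γ 0) (hγ0 : γ 0 = ρ (u₀, l₀))
    (hind : LinearIndependent ℝ ![deriv γ 0, fderiv ℝ ρ (u₀, l₀) (0, 1)]) :
    ∃ g lam S, IsCurveEquation ρ Θ u₀ l₀ γ g lam S := by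
  obtain ⟨g, lam, S, h1, h2, h3, h4, h5, h6, h7, h8, h9⟩ :=
    exists_equation_of_legendrian hρ hcon hγ hγ0 hind
  refine ⟨g, lam, S, ⟨⟨h1, h2, h3, h4, fun h0 => hΘ ?_, h8⟩, h5.continuousAt, h6, h7, h9⟩⟩
  obtain ⟨r, hr, hv⟩ := h8.self_of_nhds h2
  ext v
  have := hv v
  rw [h0, h4] at this
  exact (mul_eq_zero.1 this.symm).resolve_left hr

/-- A hypersurface tangent to `Θ = 0` is the projection of the preimage of some curve. -/
theorem IsAlphaEquation.exists_curve [FiniteDimensional ℝ E] {g lam : E → ℝ}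
    (h : IsAlphaEquation Θ u₀ l₀ g lam) (hρ : SmoothNear ρ (u₀, l₀))
    (hsurj : Function.Surjective (fderiv ℝ ρ (u₀, l₀)))
    (hcon : ∀ᶠ z in 𝓝 (u₀, l₀), ∃ r : ℝ, r ≠ 0 ∧ ∀ v τ,
      contactForm (ρ z) (fderiv ℝ ρ z (v, τ)) = r * Θ z v) :
    ∃ γ, IsLegendrianAt γ 0 ∧ γ 0 = ρ (u₀, l₀) ∧
      LinearIndependent ℝ ![deriv γ 0, fderiv ℝ ρ (u₀, l₀) (0, 1)] ∧
      ∃ g' lam' S, IsCurveEquation ρ Θ u₀ l₀ γ g' lam' S ∧ ∀ᶠ u in 𝓝 u₀, g u = 0 ↔ g' u = 0 := by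
  have : CompleteSpace E := FiniteDimensional.complete ℝ E
  obtain ⟨γ, h1, h2, h3, S, hS, hS0, hSγ⟩ := exists_legendrian_of_equation hρ hsurj hcon h.smooth
    h.eq_zero h.fderiv_ne_zero h.smooth_param h.param_eq h.tangent
  have hΘ : Θ (u₀, l₀) ≠ 0 := by
    intro h0
    obtain ⟨k, -, hk⟩ := h.tangent.self_of_nhds h.eq_zero
    rw [h.param_eq, h0] at hk
    exact h.fderiv_ne_zero (ContinuousLinearMap.ext fun v => by rw [hk]; simp)
  obtain ⟨g', lam', S', h4⟩ := exists_isCurveEquation hρ hcon hΘ h1 h2 h3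
  have ht : Tendsto (fun u => ((u, lam u), S u)) (𝓝 u₀) (𝓝 ((u₀, l₀), 0)) := by
    have := (continuousAt_id.prodMk h.smooth_param.continuousAt).prodMk hS
    rw [ContinuousAt] at this
    simpa [h.param_eq, hS0] using this
  -- The lift of g = 0 lies over γ. This gives one inclusion of regular hypersurfaces, which
  -- suffices for equality of germs.
  have hsub : ∀ᶠ u in 𝓝 u₀, g u = 0 → g' u = 0 := by
    filter_upwards [hSγ, ht.eventually h4.of_map_eq] with u h5 h6 h7
    exact (h6 (h5 h7)).1
  refine ⟨γ, h1, h2, h3, g', lam', S', h4, ?_⟩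
  filter_upwards [hsub, eventually_eq_zero_of_zeroSet_subset h.smooth h4.smooth h.eq_zero
    h.fderiv_ne_zero h4.fderiv_ne_zero hsub] with u h5 h6
  exact ⟨h5, h6⟩

/-- If two curves have the same lift, the first is near `0` contained in the second. -/
theorem IsCurveEquation.exists_image_subset [CompleteSpace E] {γ₁ γ₂ : ℝ → J1}
    {g₁ lam₁ S₁ g₂ lam₂ S₂ : E → ℝ} (h₁ : IsCurveEquation ρ Θ u₀ l₀ γ₁ g₁ lam₁ S₁)
    (h₂ : IsCurveEquation ρ Θ u₀ l₀ γ₂ g₂ lam₂ S₂) (hρ : SmoothNear ρ (u₀, l₀))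
    (hsurj : Function.Surjective (fderiv ℝ ρ (u₀, l₀))) (hγ₁ : ContinuousAt γ₁ 0)
    (hγ0 : γ₁ 0 = ρ (u₀, l₀))
    (huniq : ∀ᶠ u in 𝓝 u₀, ∀ l l', (∀ v, Θ (u, l) v = 0 ↔ Θ (u, l') v = 0) → l = l')
    (hg : ∀ᶠ u in 𝓝 u₀, g₁ u = 0 ↔ g₂ u = 0) {I : Set ℝ} (hI : I ∈ 𝓝 (0 : ℝ)) :
    ∃ J ∈ 𝓝 (0 : ℝ), γ₁ '' J ⊆ γ₂ '' I := by
  -- Equal zero sets have equal tangent hyperplanes, and these determine the parameter.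
  have hlam : ∀ᶠ u in 𝓝 u₀, g₁ u = 0 → lam₁ u = lam₂ u := by
    filter_upwards [huniq, hg.eventually_nhds, h₁.tangent, h₂.tangent, h₁.smooth.eventually_nhds,
      h₂.smooth.eventually_nhds, h₁.smooth.fderiv_right.continuousAt.eventually_ne h₁.fderiv_ne_zero,
      h₂.smooth.fderiv_right.continuousAt.eventually_ne h₂.fderiv_ne_zero]
      with u hu hgu ht₁ ht₂ hs₁ hs₂ hne₁ hne₂ h0
    have h0' := hgu.self_of_nhds.1 h0
    obtain ⟨k₁, hk₁, hv₁⟩ := ht₁ h0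
    obtain ⟨k₂, hk₂, hv₂⟩ := ht₂ h0'
    refine hu _ _ fun v => ?_
    have e₁ : Θ (u, lam₁ u) v = 0 ↔ fderiv ℝ g₁ u v = 0 := by rw [hv₁]; simp [hk₁]
    have e₂ : Θ (u, lam₂ u) v = 0 ↔ fderiv ℝ g₂ u v = 0 := by rw [hv₂]; simp [hk₂]
    rw [e₁, e₂]
    exact ⟨fderiv_eq_zero_of_zeroSet hs₁ hs₂.differentiableAt h0 hne₁ (hgu.mono fun u h => h.1),
      fderiv_eq_zero_of_zeroSet hs₂ hs₁.differentiableAt h0' hne₂ (hgu.mono fun u h => h.2)⟩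
  have hS : ∀ᶠ u in 𝓝 u₀, S₂ u ∈ I := by
    have := h₂.continuousAt.tendsto
    rw [h₂.eq_zero'] at this
    exact this hI
  have hgood : ∀ᶠ u in 𝓝 u₀, g₁ u = 0 → lam₁ u = lam₂ u ∧ ρ (u, lam₂ u) = γ₂ (S₂ u) ∧ S₂ u ∈ I := by
    filter_upwards [hlam, hg, h₂.map_eq, hS] with u a b c d h0
    exact ⟨a h0, c (b.1 h0), d⟩
  have hfst : Tendsto (fun p : (E × ℝ) × ℝ => p.1.1) (𝓝 ((u₀, l₀), 0)) (𝓝 u₀) :=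
    (continuous_fst.comp continuous_fst).continuousAt
  have hboth := h₁.of_map_eq.and (hfst.eventually hgood)
  rw [nhds_prod_eq] at hboth
  obtain ⟨P, hP, Q, hQ, hPQ⟩ := eventually_prod_iff.1 hboth
  -- A submersion is open, so every γ₁(s) with small `s` is the image of a point near (u₀, l₀); that
  -- point lies on the common lift and hence over γ₂.
  have hmap : map ρ (𝓝 (u₀, l₀)) = 𝓝 (ρ (u₀, l₀)) :=
    (hρ.contDiffAt.hasStrictFDerivAt (by simp)).map_nhds_eq_of_surj
      (LinearMap.range_eq_top.2 hsurj)
  have himg : ∀ᶠ y in 𝓝 (γ₁ 0), ∃ z, P z ∧ ρ z = y := by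
    rw [hγ0, ← hmap, eventually_map]
    filter_upwards [hP] with z hz using ⟨z, hz, rfl⟩
  refine ⟨{s | (∃ z, P z ∧ ρ z = γ₁ s) ∧ Q s}, (hγ₁.eventually himg).and hQ, ?_⟩
  rintro _ ⟨s, ⟨⟨⟨u, l⟩, hz, hzs⟩, hs⟩, rfl⟩
  obtain ⟨h5, h6⟩ := hPQ hz hs
  obtain ⟨h7, h8⟩ := h5 hzs
  obtain ⟨h9, h10, h11⟩ := h6 h7
  refine ⟨S₂ u, h11, ?_⟩
  simp only at h8
  rw [← h10, ← h9, ← h8, hzs]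

end Curves

/-! ### Germs of lifts in the manifold -/

section Lifts

variable {n : ℕ} {M : Type*} [TopologicalSpace M] [ChartedSpace (Model n) M]

/-- The condition holds for all small `V` and `I`, so one pair serves both sets. -/
theorem IsLiftAt.eventually_iff {ρ : M × ℝ → J1} {c : M × ℝ} {γ : ℝ → J1} {s₀ : ℝ} {N N' : Set M}
    (h : IsLiftAt ρ c γ s₀ N) (h' : IsLiftAt ρ c γ s₀ N') : ∀ᶠ y in 𝓝 c.1, y ∈ N ↔ y ∈ N' := by
  obtain ⟨V, hV, I, hI, h1⟩ := h
  obtain ⟨V', hV', I', hI', h2⟩ := h'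
  filter_upwards [h1 _ (inter_mem hV hV') Set.inter_subset_left _ (inter_mem hI hI')
    Set.inter_subset_left, h2 _ (inter_mem hV hV') Set.inter_subset_right _ (inter_mem hI hI')
    Set.inter_subset_right] with y h3 h4
  rw [h3, h4]

theorem IsLiftAt.congr {ρ : M × ℝ → J1} {c : M × ℝ} {γ : ℝ → J1} {s₀ : ℝ} {N N' : Set M}
    (h : IsLiftAt ρ c γ s₀ N) (hN : ∀ᶠ y in 𝓝 c.1, y ∈ N' ↔ y ∈ N) : IsLiftAt ρ c γ s₀ N' := by
  obtain ⟨V, hV, I, hI, h1⟩ := h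
  refine ⟨V, hV, I, hI, fun V' hV' hs I' hI' hs' => ?_⟩
  filter_upwards [h1 V' hV' hs I' hI' hs', hN] with y h2 h3
  rw [h3, h2]

theorem SameCurveGerm.symm {γ₁ γ₂ : ℝ → J1} (h : SameCurveGerm γ₁ γ₂) : SameCurveGerm γ₂ γ₁ :=
  ⟨h.2, h.1⟩

theorem IsLiftAt.eventually_imp {ρ : M × ℝ → J1} {c : M × ℝ} {γ₁ γ₂ : ℝ → J1} {N₁ N₂ : Set M}
    (h₁ : IsLiftAt ρ c γ₁ 0 N₁) (h₂ : IsLiftAt ρ c γ₂ 0 N₂) (h : SameCurveGerm γ₁ γ₂) :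
    ∀ᶠ y in 𝓝 c.1, y ∈ N₁ → y ∈ N₂ := by
  obtain ⟨V, hV, I, hI, h1⟩ := h₁
  obtain ⟨V', hV', I', hI', h2⟩ := h₂
  obtain ⟨J, hJ, hJI⟩ := h.1 I' hI'
  filter_upwards [h1 _ (inter_mem hV hV') Set.inter_subset_left _ (inter_mem hI hJ)
    Set.inter_subset_left, h2 _ (inter_mem hV hV') Set.inter_subset_right _ hI' subset_rfl]
    with y h3 h4 hy
  obtain ⟨l, hl, hγ⟩ := h3.1 hy
  exact h4.2 ⟨l, hl, hJI (Set.image_mono Set.inter_subset_right hγ)⟩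

theorem IsLiftAt.eventually_iff_of_sameCurveGerm {ρ : M × ℝ → J1} {c : M × ℝ} {γ₁ γ₂ : ℝ → J1}
    {N₁ N₂ : Set M} (h₁ : IsLiftAt ρ c γ₁ 0 N₁) (h₂ : IsLiftAt ρ c γ₂ 0 N₂)
    (h : SameCurveGerm γ₁ γ₂) : ∀ᶠ y in 𝓝 c.1, y ∈ N₁ ↔ y ∈ N₂ := by
  filter_upwards [h₁.eventually_imp h₂ h, h₂.eventually_imp h₁ h.symm] with y h3 h4
  exact ⟨h3, h4⟩

variable [IsManifold (𝓡 n) ∞ M] {x₀ y : M}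

/-- Over a zero z of `g` near y, the point (z, λ(z)) and the parameter S(z) fall into any given `V`
and `I`. Conversely `of_map_eq` shows that nothing else lies over γ. -/
theorem IsCurveEquation.isLiftAt {ρ : Model n × ℝ → J1} {Θ : Model n × ℝ → Model n →L[ℝ] ℝ} {l : ℝ}
    {γ : ℝ → J1} {g lam S : Model n → ℝ} (hy : y ∈ (chartMap n x₀).source)
    (h : IsCurveEquation ρ Θ (chartMap n x₀ y) l γ g lam S) {N : Set M}
    (hN : ∀ᶠ z in 𝓝 y, z ∈ N ↔ g (chartMap n x₀ z) = 0) :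
    IsLiftAt (fun c : M × ℝ => ρ (chartMap n x₀ c.1, c.2)) (y, l) γ 0 N := by
  have hof := h.of_map_eq
  rw [nhds_prod_eq] at hof
  obtain ⟨P, hP, Q, hQ, hPQ⟩ := eventually_prod_iff.1 hof
  have hφ := continuousAt_chartMap (n := n) hy
  have hc : ContinuousAt (fun c : M × ℝ => (chartMap n x₀ c.1, c.2)) (y, l) :=
    (ContinuousAt.comp (x := (y, l)) (f := Prod.fst) hφ continuousAt_fst).prodMk continuousAt_snd
  refine ⟨{c | P (chartMap n x₀ c.1, c.2)}, hc hP, {s | Q s}, hQ, fun V hV hVP I hI hIQ => ?_⟩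
  have hlam : Tendsto (fun z => (z, lam (chartMap n x₀ z))) (𝓝 y) (𝓝 (y, l)) := by
    have h1 := h.smooth_param.continuousAt.tendsto
    rw [h.param_eq] at h1
    exact tendsto_id.prodMk_nhds (h1.comp hφ)
  have hS : Tendsto (fun z => S (chartMap n x₀ z)) (𝓝 y) (𝓝 0) := by
    have h1 := h.continuousAt.tendsto
    rw [h.eq_zero'] at h1
    exact h1.comp hφ
  filter_upwards [hN, hlam hV, hS hI, hφ.tendsto.eventually h.map_eq] with z h1 h2 h3 h4
  rw [h1]
  constructor
  · intro h0
    exact ⟨_, h2, S (chartMap n x₀ z), h3, (h4 h0).symm⟩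
  · rintro ⟨l', hl', s, hs, hsl⟩
    exact (hPQ (hVP hl') (hIQ hs) hsl.symm).1

/-- A solution of the equation in a chart is an `α`-manifold. -/
theorem IsAlphaEquation.exists_isAlphaManifold {G : GL2Structure n M} {U : Set M}
    {θ : Fin n → (x : M) → Cotangent n x} (hθ : IsAdaptedCoframe G.cone U θ) (hyU : y ∈ U)
    (hy : y ∈ (chartMap n x₀).source) {l : ℝ} {g lam : Model n → ℝ}
    (h : IsAlphaEquation (localSymbol n x₀ θ) (chartMap n x₀ y) l g lam) :
    ∃ N, G.IsAlphaManifold N ∧ HasTangentSpace N y (LinearMap.ker (form θ l y).toLinearMap) ∧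
      ∀ᶠ z in 𝓝 y, z ∈ N ↔ g (chartMap n x₀ z) = 0 := by
  have hev := h.smooth.and (h.tangent.and
    (h.smooth.fderiv_right.continuousAt.eventually_ne h.fderiv_ne_zero))
  obtain ⟨O, hO, hOo, hyO⟩ := eventually_nhds_iff.1 hev
  -- Being an α-manifold is a condition at every point and not on a germ, so the zero set is cut
  -- down to an open set where all the properties hold.
  set V : Set M := ((chartMap n x₀).source ∩ chartMap n x₀ ⁻¹' O) ∩ U with hV
  have hVo : IsOpen V := ((continuousOn_extChartAt x₀).isOpen_inter_preimage
    (isOpen_extChartAt_source x₀) hOo).inter hθ.isOpen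
  have hyV : y ∈ V := ⟨⟨hy, hyO⟩, hyU⟩
  set N : Set M := {z | z ∈ V ∧ g (chartMap n x₀ z) = 0} with hNdef
  have hdg : ∀ z ∈ V, ∀ v, mfderiv (𝓡 n) 𝓘(ℝ, ℝ) (fun z => g (chartMap n x₀ z)) z v =
      fderiv ℝ g (chartMap n x₀ z) (chartDeriv n x₀ z v) := fun z hz v =>
    mfderiv_comp_chartMap hz.1.1 ((hO _ hz.1.2).1.differentiableAt (by simp)) v
  have hloc : IsLocalEquation n N V (fun z => g (chartMap n x₀ z)) := by
    refine ⟨hVo, fun z hz => ?_, fun z hz => ⟨fun h => h.2, fun h => ⟨hz, h⟩⟩, fun z hz _ h0 => ?_⟩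
    · exact (contMDiffAt_comp_chartMap hz.1.1 (hO _ hz.1.2).1).contMDiffWithinAt
    · refine (hO _ hz.1.2).2.2 (ContinuousLinearMap.ext fun w => ?_)
      obtain ⟨v, rfl⟩ := (chartDeriv_bijective hz.1.1).2 w
      rw [← hdg z hz, h0]; rfl
  have hker : ∀ z ∈ N, ∀ v, fderiv ℝ g (chartMap n x₀ z) (chartDeriv n x₀ z v) = 0 ↔
      v ∈ LinearMap.ker (form θ (lam (chartMap n x₀ z)) z).toLinearMap := by
    intro z hz v
    obtain ⟨k, hk, hv⟩ := (hO _ hz.1.1.2).2.1 hz.2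
    rw [hv, localSymbol_apply hz.1.1.1, mul_eq_zero, or_iff_right hk]
    rfl
  have hmem : ∀ z ∈ V, ∀ᶠ z' in 𝓝 z, z' ∈ N ↔ g (chartMap n x₀ z') = 0 := by
    intro z hz
    filter_upwards [hVo.mem_nhds hz] with z' hz'
    exact ⟨fun h => h.2, fun h => ⟨hz', h⟩⟩
  refine ⟨N, ⟨fun z hz => ⟨V, _, hz.1, hloc⟩, fun z H hH => ?_⟩,
    ⟨⟨hyV, h.eq_zero⟩, V, _, hyV, hloc, ?_⟩, hmem y hyV⟩
  · have hz : z ∈ N := hH.1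
    refine ⟨form θ (lam (chartMap n x₀ z)) z, ?_, ?_⟩
    · rw [hθ.cone_eq z hz.1.2]
      exact ⟨1, 1, _, one_ne_zero, by simp, by rw [one_smul, form_eq_homForm]⟩
    · ext v
      obtain ⟨h1, h2, h3⟩ := hO _ hz.1.1.2
      have hs : SmoothNear g (chartMap n x₀ z) :=
        (hOo.eventually_mem hz.1.1.2).mono fun u hu => (hO u hu).1
      rw [hH.eq_ker hz.1.1.1 hs hz.2 h3 (hmem z hz.1), hker z hz]
  · ext v
    have h1 := hker y ⟨hyV, h.eq_zero⟩ v
    rw [h.param_eq] at h1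
    rw [← h1, ← hdg y hyV]
    rfl

end Lifts

/-! ### The Legendrian correspondence -/

section Correspondence

variable {n : ℕ} {M : Type*} [TopologicalSpace M] [ChartedSpace (Model n) M]
  [IsManifold (𝓡 n) ∞ M] {x₀ y : M}

theorem IsAdaptedCoframe.eventually_param_unique (hn : 2 ≤ n)
    {cone : (x : M) → Set (Cotangent n x)} {U : Set M} {θ : Fin n → (x : M) → Cotangent n x}
    (hθ : IsAdaptedCoframe cone U θ) (hyU : y ∈ U) (hy : y ∈ (chartMap n x₀).source) :
    ∀ᶠ u in 𝓝 (chartMap n x₀ y), ∀ l l', (∀ v, localSymbol n x₀ θ (u, l) v = 0 ↔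
      localSymbol n x₀ θ (u, l') v = 0) → l = l' := by
  obtain ⟨e, -, he⟩ := hθ.exists_frame hyU hy
  filter_upwards [he] with u hu l l' h using param_eq_of_ker_eq hn hu h

/-- All hypotheses on ρ persist at nearby points, so this applies at every c in a neighbourhood,
with one fixed chart. -/
theorem legendrianCorrespondence_of_chart (hn : 2 ≤ n) {G : GL2Structure n M} {U : Set M}
    {θ : Fin n → (x : M) → Cotangent n x} (hθ : IsAdaptedCoframe G.cone U θ) {c : M × ℝ}
    (hyU : c.1 ∈ U) (hy : c.1 ∈ (chartMap n x₀).source) {ρ : Model n × ℝ → J1}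
    (hρ : SmoothNear ρ (chartMap n x₀ c.1, c.2))
    (hsurj : Function.Surjective (fderiv ℝ ρ (chartMap n x₀ c.1, c.2)))
    (hcon : ∀ᶠ z in 𝓝 (chartMap n x₀ c.1, c.2), ∃ r : ℝ, r ≠ 0 ∧ ∀ v τ,
      contactForm (ρ z) (fderiv ℝ ρ z (v, τ)) = r * localSymbol n x₀ θ z v) :
    LegendrianCorrespondence G θ (fun c : M × ℝ => ρ (chartMap n x₀ c.1, c.2)) c := by
  obtain ⟨y, l⟩ := c
  simp only at hyU hy hρ hsurj hcon
  have huniq := hθ.eventually_param_unique hn hyU hy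
  have hdiff : diff (n := n) (fun c : M × ℝ => ρ (chartMap n x₀ c.1, c.2)) (y, l) 0 1 =
      fderiv ℝ ρ (chartMap n x₀ y, l) (0, 1) := by
    rw [diff_comp_chartMap (c := (y, l)) hy hρ.differentiableAt, map_zero]
  have hΘ : localSymbol n x₀ θ (chartMap n x₀ y, l) ≠ 0 := by
    obtain ⟨e, -, he⟩ := hθ.exists_frame hyU hy
    intro h0
    have := localSymbol_frame he.self_of_nhds l ⟨0, by omega⟩
    rw [h0] at this
    simp at this
  have hcurve : ∀ γ, IsTransverseLegendrian n
      (fun c : M × ℝ => ρ (chartMap n x₀ c.1, c.2)) (y, l) γ →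
      ∃ g lam S, IsCurveEquation ρ (localSymbol n x₀ θ) (chartMap n x₀ y) l γ g lam S := by
    rintro γ ⟨h1, h2, h3⟩
    rw [hdiff] at h3
    exact exists_isCurveEquation hρ hcon hΘ h1 h2 h3
  refine ⟨fun γ hγ => ?_, fun N hN hT => ?_, fun γ₁ γ₂ N₁ N₂ hγ₁ hγ₂ hN₁ hN₂ => ⟨fun hN => ?_,
    fun h => hN₁.eventually_iff_of_sameCurveGerm hN₂ h⟩⟩
  · obtain ⟨g, lam, S, h⟩ := hcurve γ hγ
    obtain ⟨N, h1, h2, h3⟩ := h.toIsAlphaEquation.exists_isAlphaManifold hθ hyU hy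
    exact ⟨N, h1, h2, h.isLiftAt hy h3⟩
  · obtain ⟨g, lam, h1, h2⟩ := exists_isAlphaEquation hn hθ hyU hy hN hT
    obtain ⟨γ, h3, h4, h5, g', lam', S, h6, h7⟩ := h1.exists_curve hρ hsurj hcon
    refine ⟨γ, ⟨h3, h4, by rw [hdiff]; exact h5⟩, h6.isLiftAt hy ?_⟩
    filter_upwards [h2, (continuousAt_chartMap hy).tendsto.eventually h7] with z h8 h9
    rw [h8, h9]
  · obtain ⟨g₁, lam₁, S₁, h₁⟩ := hcurve γ₁ hγ₁
    obtain ⟨g₂, lam₂, S₂, h₂⟩ := hcurve γ₂ hγ₂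
    obtain ⟨N₁', -, -, hg₁⟩ := h₁.toIsAlphaEquation.exists_isAlphaManifold hθ hyU hy
    obtain ⟨N₂', -, -, hg₂⟩ := h₂.toIsAlphaEquation.exists_isAlphaManifold hθ hyU hy
    have hg : ∀ᶠ u in 𝓝 (chartMap n x₀ y), g₁ u = 0 ↔ g₂ u = 0 := eventually_of_chartMap hy (by
      filter_upwards [hN, hg₁, hg₂, hN₁.eventually_iff (h₁.isLiftAt hy hg₁),
        hN₂.eventually_iff (h₂.isLiftAt hy hg₂)] with z e1 e2 e3 e4 e5
      rw [← e2, ← e4, e1, e5, e3])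
    have hg' := hg.mono fun u hu => hu.symm
    have hc₁ := (isLegendrianAt_iff.1 hγ₁.1).1.continuousAt
    have hc₂ := (isLegendrianAt_iff.1 hγ₂.1).1.continuousAt
    exact ⟨fun I hI => h₁.exists_image_subset h₂ hρ hsurj hc₁ hγ₁.2.1 huniq hg hI,
      fun I hI => h₂.exists_image_subset h₁ hρ hsurj hc₂ hγ₂.2.1 huniq hg' hI⟩

end Correspondence

/-! ### Legendrian curves as jets of functions -/

section Jets

theorem IsParameterFunction.smoothNear {f : ℝ → ℝ} (hf : IsParameterFunction f) :
    SmoothNear f 0 := by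
  obtain ⟨⟨I, hI, hs⟩, -, -⟩ := hf
  filter_upwards [eventually_eventually_nhds.2 hI] with t ht using hs.contDiffAt ht

theorem SmoothNear.deriv {F : Type*} [NormedAddCommGroup F] [NormedSpace ℝ F] {f : ℝ → F} {t : ℝ}
    (hf : SmoothNear f t) : SmoothNear (deriv f) t := by
  have h : SmoothNear (fun s => fderiv ℝ f s 1) t := hf.fderiv_right.clm_apply (smoothNear_const _ _)
  exact h.congr (Eventually.of_forall fun s => fderiv_apply_one_eq_deriv)

theorem hasDerivAt_jet {f : ℝ → ℝ} {t : ℝ} (hf : SmoothNear f t) :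
    HasDerivAt (jet f) (1, _root_.deriv f t, _root_.deriv (_root_.deriv f) t) t :=
  (hasDerivAt_id t).prodMk
    (hf.differentiableAt.hasDerivAt.prodMk hf.deriv.differentiableAt.hasDerivAt)

theorem isLegendrianAt_jet {f : ℝ → ℝ} {t : ℝ} (hf : SmoothNear f t) : IsLegendrianAt (jet f) t := by
  rw [isLegendrianAt_iff]
  refine ⟨(smoothNear_of_contDiff contDiff_id t).prodMk (hf.prodMk hf.deriv), ?_⟩
  filter_upwards [hf.eventually_nhds] with s hs
  rw [(hasDerivAt_jet hs).deriv]
  simp [contactForm, jet]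

/-- The first coordinate of a jet is its parameter, so a common point has the same parameter on both
curves. -/
theorem sameCurveGerm_jet_iff {f₁ f₂ : ℝ → ℝ} :
    SameCurveGerm (jet f₁) (jet f₂) ↔ f₁ =ᶠ[𝓝 0] f₂ := by
  constructor
  · rintro ⟨h, -⟩
    obtain ⟨J, hJ, hsub⟩ := h Set.univ univ_mem
    filter_upwards [hJ] with t ht
    obtain ⟨s, -, hs⟩ := hsub ⟨t, ht, rfl⟩
    have h1 : s = t := congrArg Prod.fst hs
    subst h1
    exact (congrArg (fun y : J1 => y.2.1) hs).symm
  · intro h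
    have hj : jet f₁ =ᶠ[𝓝 0] jet f₂ := by
      filter_upwards [h.eventuallyEq_nhds] with t ht
      rw [jet, jet, ht.eq_of_nhds, ht.deriv_eq]
    constructor
    · refine fun I hI => ⟨_, inter_mem hI hj, ?_⟩
      rintro _ ⟨t, ⟨ht, ht'⟩, rfl⟩
      exact ⟨t, ht, ht'.symm⟩
    · refine fun I hI => ⟨_, inter_mem hI hj, ?_⟩
      rintro _ ⟨t, ⟨ht, ht'⟩, rfl⟩
      exact ⟨t, ht, ht'⟩

/-- A Legendrian curve through the origin that is not tangent to the plane `dt = 0` is the jet of a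
function. -/
theorem exists_function_of_legendrian {γ : ℝ → J1} (hγ : IsLegendrianAt γ 0) (hγ0 : γ 0 = 0)
    (ht : (deriv γ 0).1 ≠ 0) : ∃ f, IsParameterFunction f ∧ SameCurveGerm (jet f) γ := by
  obtain ⟨hs, hl⟩ := isLegendrianAt_iff.1 hγ
  have hcomp : ∀ s, DifferentiableAt ℝ γ s → HasDerivAt (fun s => (γ s).1) (deriv γ s).1 s ∧
      HasDerivAt (fun s => (γ s).2.1) (deriv γ s).2.1 s := by
    intro s h
    have h1 := h.hasDerivAt
    exact ⟨(ContinuousLinearMap.fst ℝ ℝ (ℝ × ℝ)).hasFDerivAt.comp_hasDerivAt s h1,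
      ((ContinuousLinearMap.fst ℝ ℝ ℝ).comp
        (ContinuousLinearMap.snd ℝ ℝ (ℝ × ℝ))).hasFDerivAt.comp_hasDerivAt s h1⟩
  have hst : SmoothNear (fun s => (γ s).1) 0 := (smoothNear_of_contDiff contDiff_fst _).comp hs
  have hsz : SmoothNear (fun s => (γ s).2.1) 0 :=
    (smoothNear_of_contDiff (contDiff_fst.comp contDiff_snd) _).comp hs
  have hd0 := (hcomp 0 hs.differentiableAt).1
  -- Here t is a local parameter on the curve. The function f is z in terms of t, and dz = p dt says
  -- that p = f'.
  obtain ⟨τ, hτ, hτ0, hleft, hright⟩ := hst.exists_inverse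
    (f' := ContinuousLinearEquiv.unitsEquivAut ℝ (Units.mk0 _ ht)) (hd0.hasFDerivAt.congr_fderiv (by ext; simp))
  have h00 : (γ 0).1 = 0 := by rw [hγ0]; rfl
  rw [h00] at hτ hτ0 hright
  have hτt : Tendsto τ (𝓝 0) (𝓝 0) := by
    have := hτ.continuousAt.tendsto
    rwa [hτ0] at this
  set f : ℝ → ℝ := fun t => (γ (τ t)).2.1 with hf
  have hfs : SmoothNear f 0 := hsz.comp_of_eq hτ hτ0
  have hjet : ∀ᶠ t in 𝓝 0, jet f t = γ (τ t) := by
    filter_upwards [hτ.eventually_nhds, hright.eventually_nhds, hτt.eventually hl,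
      hτt.eventually hs.eventually_nhds] with t h1 h2 h3 h4
    obtain ⟨h5, h6⟩ := hcomp (τ t) h4.differentiableAt
    have h7 := h1.differentiableAt.hasDerivAt
    have h8 : (deriv γ (τ t)).1 * deriv τ t = 1 :=
      (h5.comp t h7).unique ((hasDerivAt_id t).congr_of_eventuallyEq h2)
    have h9 : deriv f t = (deriv γ (τ t)).2.1 * deriv τ t := (h6.comp t h7).deriv
    have h10 : (deriv γ (τ t)).2.1 = (γ (τ t)).2.2 * (deriv γ (τ t)).1 := sub_eq_zero.1 h3.2
    refine Prod.ext h2.self_of_nhds.symm (Prod.ext rfl ?_)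
    change deriv f t = _
    rw [h9, h10, mul_assoc, h8, mul_one]
  have hj0 : jet f 0 = 0 := by rw [hjet.self_of_nhds, hτ0, hγ0]
  obtain ⟨I, hIo, hI0, hIs⟩ := smoothNear_iff.1 hfs
  refine ⟨f, ⟨⟨I, hIo.mem_nhds hI0, hIs⟩, congrArg (fun y : J1 => y.2.1) hj0,
    congrArg (fun y : J1 => y.2.2) hj0⟩, fun I hI => ⟨_, inter_mem hjet (hτt hI), ?_⟩,
    fun I hI => ?_⟩
  · rintro _ ⟨t, ⟨h1, h2⟩, rfl⟩
    exact ⟨τ t, h2, h1.symm⟩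
  · have htt : Tendsto (fun s => (γ s).1) (𝓝 0) (𝓝 0) := by
      have := hst.continuousAt.tendsto
      rwa [h00] at this
    refine ⟨_, (hleft.and (htt.eventually hjet)).and (htt hI), ?_⟩
    rintro _ ⟨s, ⟨⟨h1, h2⟩, h3⟩, rfl⟩
    exact ⟨(γ s).1, h3, by rw [h2, h1]⟩

end Jets

/-! ### Existence of ρ and parametrization by functions -/

section Main

variable {n : ℕ} {M : Type*} [TopologicalSpace M] [ChartedSpace (Model n) M]
  [IsManifold (𝓡 n) ∞ M]

/-- If the vertical direction at the origin of `J¹` is the image of the fibre, the curves are graphs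
of functions. -/
theorem LegendrianCorrespondence.functionParametrization {G : GL2Structure n M}
    (hG : G.Involutive) {θ : Fin n → (x : M) → Cotangent n x} {ρ : M × ℝ → J1} {x : M}
    {H : Submodule ℝ (TangentSpace (𝓡 n) x)} (hH : G.IsAlphaHyperplane x H)
    (hHθ : H = LinearMap.ker (form θ 0 x).toLinearMap) (h : LegendrianCorrespondence G θ ρ (x, 0))
    (hρ0 : ρ (x, 0) = 0) (h1 : (diff (n := n) ρ (x, 0) 0 1).1 = 0)
    (h2 : (diff (n := n) ρ (x, 0) 0 1).2.1 = 0) : FunctionParametrization G ρ x H := by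
  subst hHθ
  -- Some α-manifold is tangent to the given hyperplane, and its curve is independent of ρ_*∂_λ,
  -- which therefore is not zero.
  have h3 : (diff (n := n) ρ (x, 0) 0 1).2.2 ≠ 0 := by
    obtain ⟨N, hN, hT⟩ := hG x _ hH
    obtain ⟨γ, ⟨-, -, hli⟩, -⟩ := h.exists_curve N hN hT
    intro h0
    have := hli.ne_zero 1
    exact this (Prod.ext h1 (Prod.ext h2 h0))
  have hjet : ∀ f, IsParameterFunction f → IsTransverseLegendrian n ρ (x, 0) (jet f) := by
    intro f hf
    refine ⟨isLegendrianAt_jet hf.smoothNear, ?_, ?_⟩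
    · rw [hρ0, jet, hf.2.1, hf.2.2]; rfl
    · rw [(hasDerivAt_jet hf.smoothNear).deriv, linearIndependent_pair_iff]
      intro s t hst
      have e1 : s * 1 + t * (diff (n := n) ρ (x, 0) 0 1).1 = 0 := congrArg Prod.fst hst
      have e2 : s * deriv (deriv f) 0 + t * (diff (n := n) ρ (x, 0) 0 1).2.2 = 0 :=
        congrArg (fun y : J1 => y.2.2) hst
      rw [h1, mul_zero, add_zero, mul_one] at e1
      rw [e1, zero_mul, zero_add] at e2
      exact ⟨e1, (mul_eq_zero.1 e2).resolve_right h3⟩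
  refine ⟨fun f hf => h.exists_alphaManifold _ (hjet f hf), fun N hN hT => ?_,
    fun f₁ f₂ N₁ N₂ hf₁ hf₂ hN₁ hN₂ =>
      (h.unique _ _ _ _ (hjet f₁ hf₁) (hjet f₂ hf₂) hN₁ hN₂).trans sameCurveGerm_jet_iff⟩
  obtain ⟨γ, ⟨hγ, hγ0, hli⟩, hlift⟩ := h.exists_curve N hN hT
  rw [hρ0] at hγ0
  have hz : (deriv γ 0).2.1 = 0 := by
    have := ((isLegendrianAt_iff.1 hγ).2.self_of_nhds).2
    rw [hγ0] at this
    simpa [contactForm] using this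
  -- The contact plane at the origin is dz = 0. If dt also vanished on γ', then γ' would be parallel
  -- to ∂_p and so to ρ_*∂_λ.
  have ht : (deriv γ 0).1 ≠ 0 := by
    intro h0
    have := (linearIndependent_pair_iff.1 hli (diff (n := n) ρ (x, 0) 0 1).2.2
      (-(deriv γ 0).2.2) (Prod.ext (by simp [h0, h1]) (Prod.ext (by simp [hz, h2])
        (by simp [mul_comm])))).1
    exact h3 this
  obtain ⟨f, hf, hsame⟩ := exists_function_of_legendrian hγ hγ0 ht
  obtain ⟨N', -, -, hN'⟩ := h.exists_alphaManifold _ (hjet f hf)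
  exact ⟨f, hf, hN'.congr (hlift.eventually_iff_of_sameCurveGerm hN' hsame.symm)⟩

theorem SmoothNear.eventually_surjective {Z V : Type*} [NormedAddCommGroup Z] [NormedSpace ℝ Z]
    [NormedAddCommGroup V] [NormedSpace ℝ V] [FiniteDimensional ℝ V] {A : Z → Z →L[ℝ] V} {z₀ : Z}
    (hA : SmoothNear A z₀) (h : Function.Surjective (A z₀)) :
    ∀ᶠ z in 𝓝 z₀, Function.Surjective (A z) := by
  have : CompleteSpace V := FiniteDimensional.complete ℝ V
  obtain ⟨s, hs⟩ := (A z₀ : Z →ₗ[ℝ] V).exists_rightInverse_of_surjective (LinearMap.range_eq_top.2 h)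
  obtain ⟨ν, -, -, hν, -⟩ := hA.exists_rightInverse (ι := LinearMap.toContinuousLinearMap s)
    (fun v => by simpa using LinearMap.congr_fun hs v)
  filter_upwards [hν] with z hz v using ⟨_, hz v⟩

/-- Involutivity provides a map to `J¹` that induces the hyperplanes `θ(λ) = 0`. -/
theorem GL2Structure.Involutive.exists_contact_map (hn : 2 ≤ n) {G : GL2Structure n M}
    (hG : G.Involutive) {U : Set M} {θ : Fin n → (x : M) → Cotangent n x}
    (hθ : IsAdaptedCoframe G.cone U θ) {x : M} (hxU : x ∈ U) :
    ∃ ρ : Model n × ℝ → J1, SmoothNear ρ (chartMap n x x, 0) ∧ ρ (chartMap n x x, 0) = 0 ∧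
      Function.Surjective (fderiv ℝ ρ (chartMap n x x, 0)) ∧
      (fderiv ℝ ρ (chartMap n x x, 0) (0, 1)).1 = 0 ∧
      ∀ᶠ z in 𝓝 (chartMap n x x, 0), ∃ a : ℝ, a ≠ 0 ∧ ∀ v τ,
        contactForm (ρ z) (fderiv ℝ ρ z (v, τ)) = a * localSymbol n x θ z v := by
  have hx : x ∈ (chartMap n x).source := mem_extChartAt_source x
  obtain ⟨e, he, hdual⟩ := hθ.exists_frame hxU hx
  set u₀ := chartMap n x x
  let i₀ : Fin n := ⟨0, by omega⟩
  let i₁ : Fin n := ⟨1, by omega⟩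
  have hfst : Tendsto (fun z : Model n × ℝ => z.1) (𝓝 (u₀, 0)) (𝓝 u₀) := continuousAt_fst
  have hder : ∀ u, (∀ i j, localForm n x (θ i) u (e j u) = if i = j then 1 else 0) →
      (∀ i, SmoothNear (localForm n x (θ i)) u) → ∀ l (j : Fin n),
      fderiv ℝ (localSymbol n x θ) (u, l) (0, 1) (e j u) = (j : ℕ) * l ^ ((j : ℕ) - 1) := by
    intro u hu hs l j
    rw [(hasFDerivAt_localSymbol hs l).2, sum_apply]
    exact sum_mul_localForm_frame hu (fun i => (i : ℕ) * l ^ ((i : ℕ) - 1)) j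
  have hθs : ∀ᶠ u in 𝓝 u₀, ∀ i, SmoothNear (localForm n x (θ i)) u :=
    eventually_all.2 fun i => (hθ.smoothNear_localForm hxU hx i).eventually_nhds
  -- On the first two frame vectors θ(λ) takes the values 1 and λ, and its λ-derivative takes 0 and
  -- 1. So e₁ - λ e₀ lies in ker θ(λ), and the derivative is 1 on it.
  refine exists_contact_map_of_symmetric
    (hasFDerivAt_localSymbol (hθ.smoothNear_localForm hxU hx) 0).1
    (e := fun z => e i₁ z.1 - z.2 • e i₀ z.1) ?_ ?_ ?_ (e₀ := e i₀ u₀) ?_ ?_ ?_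
  · have hp : SmoothNear (fun z : Model n × ℝ => z.1) (u₀, 0) := smoothNear_of_contDiff contDiff_fst _
    exact ((he i₁).comp_of_eq hp rfl).sub
      ((smoothNear_of_contDiff contDiff_snd _).smul ((he i₀).comp_of_eq hp rfl))
  · filter_upwards [hfst.eventually hdual] with z hz
    obtain ⟨u, l⟩ := z
    rw [map_sub, map_smul, localSymbol_frame hz, localSymbol_frame hz]
    simp [i₀, i₁]
  · filter_upwards [hfst.eventually hdual, hfst.eventually hθs] with z hz hs
    obtain ⟨u, l⟩ := z
    rw [map_sub, map_smul, hder u hz hs, hder u hz hs]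
    simp [i₀, i₁]
  · rw [localSymbol_frame hdual.self_of_nhds]; simp [i₀]
  · rw [hder u₀ hdual.self_of_nhds hθs.self_of_nhds]; simp [i₀]
  · filter_upwards [hfst.eventually hθs, hfst.eventually (eventually_mem_target hx),
      hfst.eventually (continuousAt_chartMap_symm hx (hθ.isOpen.mem_nhds hxU))] with z hs hzt hzU
    obtain ⟨u, l⟩ := z
    obtain ⟨y, hy, rfl⟩ : ∃ y ∈ (chartMap n x).source, chartMap n x y = u :=
      ⟨_, (chartMap n x).map_target hzt, (chartMap n x).right_inv hzt⟩
    simp only [(chartMap n x).left_inv hy] at hzU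
    -- Involutivity enters at every (y, λ) near (x, 0): the mere existence of an α-manifold there
    -- gives the integrability condition.
    obtain ⟨N, hN, hT⟩ := hG y (LinearMap.ker (form θ l y).toLinearMap) ⟨form θ l y, by
      rw [hθ.cone_eq y hzU]
      exact ⟨1, 1, _, one_ne_zero, by simp, by rw [one_smul, form_eq_homForm]⟩, rfl⟩
    obtain ⟨g, lam, hg, -⟩ := exists_isAlphaEquation hn hθ hzU hy hN hT
    exact hg.exists_symmetric (hasFDerivAt_localSymbol hs l).1

end Main

end GL2

open GL2 in
theorem proposition4 {n : ℕ} (hn : 2 ≤ n) {M : Type*} [TopologicalSpace M]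
    [ChartedSpace (EuclideanSpace ℝ (Fin n)) M] [IsManifold (𝓡 n) ∞ M]
    (G : GL2Structure n M) (hG : G.Involutive)
    (x : M) (H : Submodule ℝ (TangentSpace (𝓡 n) x)) (hH : G.IsAlphaHyperplane x H) :
    ∃ (U : Set M) (θ : Fin n → (y : M) → Cotangent n y) (W : Set (M × ℝ)) (ρ : M × ℝ → J1),
      IsAdaptedCoframe G.cone U θ ∧ x ∈ U ∧
      H = LinearMap.ker (form θ 0 x).toLinearMap ∧
      IsContactReduction θ W ρ ∧ (∀ c ∈ W, c.1 ∈ U) ∧ (x, 0) ∈ W ∧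
      ρ (x, 0) = 0 ∧ (diff (n := n) ρ (x, 0) 0 1).1 = 0 ∧
      (∀ c ∈ W, LegendrianCorrespondence G θ ρ c) ∧
      FunctionParametrization G ρ x H := by
  obtain ⟨U, θ, hxU, hθ, hHθ⟩ := G.exists_adapted_coframe hH
  obtain ⟨ρ, hρ, hρ0, hsurj, hdt, hcon⟩ := hG.exists_contact_map hn hθ hxU
  have hx : x ∈ (chartMap n x).source := mem_extChartAt_source x
  -- The requirements on ρ are collected on one open set, so that the correspondence holds at every
  -- point of W and not only at (x, 0).
  obtain ⟨O, hO, hOo, hxO⟩ := eventually_nhds_iff.1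
    (hρ.eventually_nhds.and ((hρ.fderiv_right.eventually_surjective hsurj).and hcon.eventually_nhds))
  set φ : M × ℝ → Model n × ℝ := fun c => (chartMap n x c.1, c.2) with hφ
  set S : Set (M × ℝ) := ((chartMap n x).source ∩ U) ×ˢ Set.univ with hS
  have hSo : IsOpen S := ((isOpen_extChartAt_source x).inter hθ.isOpen).prod isOpen_univ
  have hφc : ContinuousOn φ S := fun c hc => by
    have h1 : ContinuousAt (fun c : M × ℝ => chartMap n x c.1) c :=
      ContinuousAt.comp (f := Prod.fst) (continuousAt_chartMap hc.1.1) continuousAt_fst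
    exact (h1.prodMk continuousAt_snd).continuousWithinAt
  set W : Set (M × ℝ) := S ∩ φ ⁻¹' O with hW
  have hWo : IsOpen W := hφc.isOpen_inter_preimage hSo hOo
  have hxW : (x, 0) ∈ W := ⟨⟨⟨hx, hxU⟩, trivial⟩, hxO⟩
  have hdiff : ∀ c ∈ W, ∀ v τ, diff (fun c : M × ℝ => ρ (φ c)) c v τ =
      fderiv ℝ ρ (φ c) (chartDeriv n x c.1 v, τ) := fun c hc v τ =>
    diff_comp_chartMap hc.1.1.1 (hO _ hc.2).1.differentiableAt v τ
  have hform : ∀ c ∈ W, ∃ r : ℝ, r ≠ 0 ∧ ∀ (v : TangentSpace (𝓡 n) c.1) (τ : ℝ),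
      contactForm (ρ (φ c)) (diff (fun c : M × ℝ => ρ (φ c)) c v τ) =
        r * (form θ c.2 c.1 v : ℝ) := by
    intro c hc
    obtain ⟨r, hr, h⟩ := (hO _ hc.2).2.2.self_of_nhds
    refine ⟨r, hr, fun v τ => ?_⟩
    rw [hdiff c hc, h, localSymbol_apply hc.1.1.1]
  have hred : IsContactReduction θ W (fun c => ρ (φ c)) := by
    refine ⟨hWo, fun c hc => ?_, fun c hc y => ?_, hform⟩
    · exact (contMDiffAt_comp_chartMap_prod hc.1.1.1
        (hO _ hc.2).1.contDiffAt).contMDiffWithinAt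
    · obtain ⟨⟨w, τ⟩, h⟩ := (hO _ hc.2).2.1 y
      obtain ⟨v, rfl⟩ := (chartDeriv_bijective hc.1.1.1).2 w
      exact ⟨v, τ, by rw [hdiff c hc, h]⟩
  have hleg : ∀ c ∈ W, LegendrianCorrespondence G θ (fun c => ρ (φ c)) c := fun c hc =>
    legendrianCorrespondence_of_chart hn hθ hc.1.1.2 hc.1.1.1 (hO _ hc.2).1 (hO _ hc.2).2.1
      (hO _ hc.2).2.2
  have hdt' : (diff (n := n) (fun c : M × ℝ => ρ (φ c)) (x, 0) 0 1).1 = 0 := by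
    rw [hdiff (x, 0) hxW, map_zero]; exact hdt
  -- θ(λ) has no dλ-component, so the contact form, which is dz at the origin, kills ρ_*∂_λ.
  have hdz : (diff (n := n) (fun c : M × ℝ => ρ (φ c)) (x, 0) 0 1).2.1 = 0 := by
    obtain ⟨r, -, h⟩ := hform (x, 0) hxW
    have h0 := h 0 1
    have h1 : ρ (φ (x, 0)) = 0 := hρ0
    rw [h1, map_zero, mul_zero] at h0
    simpa [contactForm] using h0
  exact ⟨U, θ, W, _, hθ, hxU, hHθ, hred, fun c hc => hc.1.1.2, hxW, hρ0, hdt', hleg,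
    (hleg (x, 0) hxW).functionParametrization hG hH hHθ hρ0 hdt' hdz⟩
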